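/- Let $d\ge 0$ and let $V:\mathbb{R}^d\to\mathbb{R}$ be measurable with $\|V\|_\infty<1$; write $V$ also for the operator of multiplication by $V$ on $L^2(\mathbb{R}^d)$. Let $H_0=-\tfrac12\Delta$ be the free Hamiltonian on $L^2(\mathbb{R}^d)$, with domain $\{\psi\in L^2:\Delta\psi\in L^2\}$ (distributional Laplacian), so that $e^{-tH_0}$ is the heat semigroup with kernel $(2\pi t)^{-d/2}e^{-\|x-u\|^2/(2t)}$. Let $g_1(z)=1/(1-z)$ and $g(z)=z\,g_1(z)+g_1(0)$, and fix any radius $0<\rho<1$. For an operator $-\alpha$ generating a $C_0$-semigroup $e^{-t\alpha}$ on $L^2(\mathbb{R}^d)$, a bounded operator $A$, and $t\ge0$, put $$\exp^t(-t\alpha+tA)\psi=\sum_{m=0}^\infty\int_{0<s_1<\cdots<s_m<t}e^{-(t-s_m)\alpha}A\,e^{-(s_m-s_{m-1})\alpha}A\cdots A\,e^{-s_1\alpha}\psi\;ds_1\cdots ds_m ,$$ and define the reduced disentangling of $e^{z_0}g(z_1)$ (Lebesgue measure being attached to both operators) by $$f^t_{(R)}(-\alpha,A)\psi=\frac1{2\pi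 i}\oint_{|\xi|=\rho}g(\xi)\,\xi^{-1}\exp^t\!\left(-t\alpha+\tfrac{t}{\xi}A\right)\psi\,d\xi .$$ The operators $-H_0$, $-(H_0+V)$ and $-iH_0$ generate $C_0$-semigroups, $-i(H_0+V)$ generates a $C_0$-group of unitary operators, and the following hold (all series and integrals converging). 1. (Heat semigroup.) For all $t\ge0$ and $\psi\in L^2(\mathbb{R}^d)$, $f^t_{(R)}(-H_0,-V)\psi=e^{-t(H_0+V)}\psi$. Moreover, for $t>0$ and almost every $x\in\mathbb{R}^d$, $$f^t_{(R)}(-H_0,-V)\psi(x)=e^{-tH_0}\psi(x)-\int_{C_0^t}\int_0^t\exp\Big[-\int_0^sV(y(u)+x)\,du\Big]V(y(s)+x)\,\psi(y(t)+x)\,ds\,m(dy),$$ where $m$ is Wiener measure on the space $C_0^t$ of continuous paths $y:[0,t]\to\mathbb{R}^d$ with $y(0)=0$. 2. (Schrödinger group.) For all $t\ge0$ and $\psi\in L^2(\mathbb{R}^d)$, $f^t_{(R)}(-iH_0,-iV)\psi=e^{-it(H_0+V)}\psi$. 3. (Analytic-in-time Feynman integral.) Let $F_V(y)=\exp\left(-\int_0^tV(y(s))\,ds\right)$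 and, for $t>0$, $(J^t(F_V)\psi)(\xi)=\int_{C_0^t}F_V(y+\xi)\,\psi(y(t)+\xi)\,m(dy)$. This defines a bounded operator $J^t(F_V)$ on $L^2(\mathbb{R}^d)$ for every $t>0$, and $t\mapsto J^t(F_V)$ extends to a function on $\{\operatorname{Re}z\ge0\}$ that is analytic (in operator norm) on $\{\operatorname{Re}z>0\}$ and strongly continuous on $\{\operatorname{Re}z\ge0\}$. For every such extension, $J^t(F_V)=e^{-t(H_0+V)}$ for $t>0$ and $J^{it}(F_V)=e^{-it(H_0+V)}$ for all $t\in\mathbb{R}$. In particular $f^t_{(R)}(-H_0,-V)=J^t(F_V)$ for $t>0$ and $f^t_{(R)}(-iH_0,-iV)=J^{it}(F_V)$ for $t\ge0$. -/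

import Mathlib

open MeasureTheory ProbabilityTheory Set Filter Topology
open scoped ENNReal NNReal SchwartzMap Laplacian Real

noncomputable section

/-! ### Semigroups and groups generated by an unbounded operator -/

section Semigroups

variable {H : Type*} [NormedAddCommGroup H] [NormedSpace ℂ H]

/-- `S`, restricted to `[0, ∞)`, is the `C₀`-semigroup whose infinitesimal generator is the
unbounded operator `A`: the graph of `A` is exactly the set of pairs `(x, y)` such that
`(S h x - x) / h → y` as `h ↓ 0`. -/
structure IsC0SemigroupOf (S : ℝ → H →L[ℂ] H) (A : H →ₗ.[ℂ] H) : Prop where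
  map_zero : S 0 = ContinuousLinearMap.id ℂ H
  map_add : ∀ s t : ℝ, 0 ≤ s → 0 ≤ t → S (s + t) = (S s).comp (S t)
  strong_cont : ∀ x : H, ContinuousOn (fun t : ℝ => S t x) (Ici 0)
  generator : ∀ x y : H, (x, y) ∈ A.graph ↔
    Tendsto (fun h : ℝ => ((h : ℂ)⁻¹) • (S h x - x)) (𝓝[>] 0) (𝓝 y)

open Classical in
/-- The semigroup `t ↦ e^{tA}`, `t ≥ 0`, generated by `A` (zero if `A` is not a generator). -/
def c0Semigroup (A : H →ₗ.[ℂ] H) : ℝ → H →L[ℂ] H :=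
  if h : ∃ S : ℝ → H →L[ℂ] H, IsC0SemigroupOf S A then h.choose else 0

/-- `U` is the strongly continuous one-parameter group, indexed by `ℝ`, with generator `A`. -/
structure IsC0GroupOf (U : ℝ → H →L[ℂ] H) (A : H →ₗ.[ℂ] H) : Prop where
  map_zero : U 0 = ContinuousLinearMap.id ℂ H
  map_add : ∀ s t : ℝ, U (s + t) = (U s).comp (U t)
  strong_cont : ∀ x : H, Continuous (fun t : ℝ => U t x)
  generator : ∀ x y : H, (x, y) ∈ A.graph ↔
    Tendsto (fun h : ℝ => ((h : ℂ)⁻¹) • (U h x - x)) (𝓝[≠] 0) (𝓝 y)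

open Classical in
/-- The group `t ↦ e^{tA}`, `t ∈ ℝ`, generated by `A` (zero if `A` does not generate a group). -/
def c0Group (A : H →ₗ.[ℂ] H) : ℝ → H →L[ℂ] H :=
  if h : ∃ U : ℝ → H →L[ℂ] H, IsC0GroupOf U A then h.choose else 0

end Semigroups

/-! ### The reduced disentangling for one operator-valued function and Lebesgue measure -/

section Disentangling

variable {H : Type*} [NormedAddCommGroup H] [NormedSpace ℂ H]

/-- The simplex `{0 < s₁ < ⋯ < sₘ < t}`. -/
def timeSimplex (m : ℕ) (t : ℝ) : Set (Fin m → ℝ) :=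
  {s | StrictMono s ∧ ∀ i, s i ∈ Ioo 0 t}

/-- `S(t - sₘ) A(sₘ) S(sₘ - sₘ₋₁) A(sₘ₋₁) ⋯ A(s₁) S(s₁)`; this is `S(t)` for `m = 0`. -/
def timeOrderedProduct (S A : ℝ → H →L[ℂ] H) : (m : ℕ) → (Fin m → ℝ) → ℝ → H →L[ℂ] H
  | 0, _, t => S t
  | m + 1, s, t =>
      (S (t - s (Fin.last m))).comp
        ((A (s (Fin.last m))).comp
          (timeOrderedProduct S A m (fun i => s i.castSucc) (s (Fin.last m))))

/-- The `m`-th term of the disentangled exponential, applied to `ψ` (a strong integral). -/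
def disentangledTerm (B : H →ₗ.[ℂ] H) (A : ℝ → H →L[ℂ] H) (m : ℕ) (t : ℝ) (ψ : H) : H :=
  ∫ s in timeSimplex m t, timeOrderedProduct (c0Semigroup B) A m s t ψ

/-- The disentangled exponential `exp^t (t B + ∫_{[0,t]} A(s) ds) ψ`, where `B = -α` generates a
`C₀`-semigroup, and Lebesgue measure is attached to both `B` and `A`. -/
def disentangledExp (B : H →ₗ.[ℂ] H) (A : ℝ → H →L[ℂ] H) (t : ℝ) (ψ : H) : H :=
  ∑' m : ℕ, disentangledTerm B A m t ψ

/-- The reduced disentangling `f_(R)^t (B, A) ψ` of `f (z₀, z₁) = e^{z₀} g(z₁)`: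
`(2πi)⁻¹ ∮_{|ξ| = ρ} g(ξ) ξ⁻¹ exp^t (t B + ξ⁻¹ ∫_{[0,t]} A(s) ds) ψ dξ`. -/
def reducedDisentangling (ρ : ℝ) (g : ℂ → ℂ) (t : ℝ) (B : H →ₗ.[ℂ] H) (A : ℝ → H →L[ℂ] H)
    (ψ : H) : H :=
  (2 * π * Complex.I : ℂ)⁻¹ •
    ∮ ξ in C(0, ρ), (g ξ * ξ⁻¹) • disentangledExp B (fun s => ξ⁻¹ • A s) t ψ

/-- All the integrals and the series in the definition of `reducedDisentangling` converge. -/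
structure ReducedDisentanglingConverges (ρ : ℝ) (g : ℂ → ℂ) (t : ℝ) (B : H →ₗ.[ℂ] H)
    (A : ℝ → H →L[ℂ] H) : Prop where
  integrable : ∀ (ψ : H) (m : ℕ), IntegrableOn
    (fun s => timeOrderedProduct (c0Semigroup B) A m s t ψ) (timeSimplex m t)
  summable : ∀ (ψ : H), ∀ ξ ∈ Metric.sphere (0 : ℂ) ρ,
    Summable (fun m : ℕ => ‖disentangledTerm B (fun s => ξ⁻¹ • A s) m t ψ‖)
  circleIntegrable : ∀ ψ : H, CircleIntegrable
    (fun ξ => (g ξ * ξ⁻¹) • disentangledExp B (fun s => ξ⁻¹ • A s) t ψ) 0 ρ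

end Disentangling

/-! ### The Hamiltonian -/

/-- `L²(ℝᵈ)`, complex valued. -/
abbrev L2Space (d : ℕ) : Type := Lp ℂ 2 (volume : Measure (EuclideanSpace ℝ (Fin d)))

/-- The pairs `(f, h)` in `L² × L²` such that `h = -½ Δ f` in the sense of distributions. -/
def freeHamiltonianGraph (d : ℕ) : Submodule ℂ (L2Space d × L2Space d) where
  carrier := {p | Lp.toTemperedDistributionCLM ℂ volume 2 p.2 =
    (-(1 / 2 : ℂ)) • Δ (Lp.toTemperedDistributionCLM ℂ volume 2 p.1)}
  zero_mem' := by
    simp only [mem_ofPred_eq, TemperedDistribution.laplacian_eq_fourierMultiplierCLM,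
      Prod.fst_zero, Prod.snd_zero, map_zero, smul_zero]
  add_mem' := by
    intro a b ha hb
    simp only [mem_ofPred_eq, TemperedDistribution.laplacian_eq_fourierMultiplierCLM] at ha hb ⊢
    simp [map_add, smul_add, ha, hb]
  smul_mem' := by
    intro c a ha
    simp only [mem_ofPred_eq, TemperedDistribution.laplacian_eq_fourierMultiplierCLM] at ha ⊢
    simp only [Prod.smul_fst, Prod.smul_snd, map_smul, ha]
    rw [smul_comm c, smul_comm c]

/-- The free Hamiltonian `H₀ = -½ Δ`, with domain all `f ∈ L²` such that `Δ f ∈ L²`. -/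
def freeHamiltonian (d : ℕ) : L2Space d →ₗ.[ℂ] L2Space d :=
  (freeHamiltonianGraph d).toLinearPMap

theorem mem_graph_freeHamiltonian {d : ℕ} (f h : L2Space d) :
    (f, h) ∈ (freeHamiltonian d).graph ↔
      Lp.toTemperedDistributionCLM ℂ volume 2 h =
        (-(1 / 2 : ℂ)) • Δ (Lp.toTemperedDistributionCLM ℂ volume 2 f) := by
  have key : (freeHamiltonian d).graph = freeHamiltonianGraph d := by
    apply Submodule.toLinearPMap_graph_eq
    rintro ⟨a, b⟩ hab (rfl : a = 0)
    have hb : Lp.toTemperedDistributionCLM ℂ volume 2 b = 0 := by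
      have := hab
      simp only [freeHamiltonianGraph, Submodule.mem_mk, AddSubmonoid.mem_mk,
        AddSubsemigroup.mem_mk, mem_ofPred_eq,
        TemperedDistribution.laplacian_eq_fourierMultiplierCLM, map_zero, smul_zero] at this
      exact this
    have : b ∈ (Lp.toTemperedDistributionCLM ℂ
        (volume : Measure (EuclideanSpace ℝ (Fin d))) 2).ker := hb
    rw [Lp.ker_toTemperedDistributionCLM_eq_bot] at this
    simpa using this
  rw [key]
  rfl

/-- Multiplication by an essentially bounded real potential `V`, as a bounded operator on `L²`. -/
def mulOp {d : ℕ} {V : EuclideanSpace ℝ (Fin d) → ℝ} (hV : MemLp V ∞ volume) :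
    L2Space d →L[ℂ] L2Space d :=
  (ContinuousLinearMap.mul ℂ ℂ).holderL volume ∞ 2 2 (hV.ofReal (K := ℂ)).toLp

/-- `H₀ + V`, with the domain of `H₀`. -/
def hamiltonian {d : ℕ} {V : EuclideanSpace ℝ (Fin d) → ℝ} (hV : MemLp V ∞ volume) :
    L2Space d →ₗ.[ℂ] L2Space d :=
  freeHamiltonian d + (mulOp hV).toLinearMap.toPMap ⊤

/-! ### Wiener measure and the analytic-in-time Feynman integral -/

/-- Continuous paths `[0, t] → ℝᵈ`. -/
abbrev PathSpace (d : ℕ) (t : ℝ) : Type := C(Icc (0 : ℝ) t, EuclideanSpace ℝ (Fin d))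

/-- `C₀ᵗ`: the continuous paths `[0, t] → ℝᵈ` that start at `0`. -/
def WienerSpace (d : ℕ) (t : ℝ) : Type :=
  {y : PathSpace d t // ∀ h : (0 : ℝ) ∈ Icc (0 : ℝ) t, y ⟨0, h⟩ = 0}

instance (d : ℕ) (t : ℝ) : TopologicalSpace (WienerSpace d t) :=
  inferInstanceAs (TopologicalSpace {y : PathSpace d t // ∀ h : (0 : ℝ) ∈ Icc (0 : ℝ) t,
    y ⟨0, h⟩ = 0})

instance (d : ℕ) (t : ℝ) : MeasurableSpace (WienerSpace d t) := borel _

instance (d : ℕ) (t : ℝ) : BorelSpace (WienerSpace d t) := ⟨rfl⟩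

/-- `m` is (standard, `d`-dimensional) Wiener measure on the Borel sets of `C₀ᵗ`: the increments
of the coordinate process are independent, and the increment from `u` to `v` is a centred
Gaussian vector with covariance matrix `(v - u) I`. -/
structure IsWienerMeasure {d : ℕ} {t : ℝ} (m : Measure (WienerSpace d t)) : Prop where
  isProbabilityMeasure : IsProbabilityMeasure m
  law_increment : ∀ u v : Icc (0 : ℝ) t, u ≤ v →
    m.map (fun y => y.1 v - y.1 u) =
      (stdGaussian (EuclideanSpace ℝ (Fin d))).map (fun x => √((v : ℝ) - u) • x)
  indep_increments : HasIndepIncrements (fun (s : Icc (0 : ℝ) t) y => y.1 s) m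

/-- The value `y(s)` of a path at time `s ∈ [0, t]` (zero outside `[0, t]`). -/
def pathAt {d : ℕ} {t : ℝ} (y : PathSpace d t) (s : ℝ) : EuclideanSpace ℝ (Fin d) :=
  if h : s ∈ Icc (0 : ℝ) t then y ⟨s, h⟩ else 0

/-- The translated path `y + ξ`. -/
def pathShift {d : ℕ} {t : ℝ} (y : WienerSpace d t) (ξ : EuclideanSpace ℝ (Fin d)) :
    PathSpace d t :=
  y.1 + ContinuousMap.const _ ξ

/-- The Wiener integral `∫ F(y + ξ) ψ(y(t) + ξ) m(dy)` defines the bounded operator `J`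
on `L²(ℝᵈ)`, that is, `Jᵗ(F)` exists and equals `J`. -/
def IsFunctionSpaceIntegral {d : ℕ} {t : ℝ} (m : Measure (WienerSpace d t))
    (F : PathSpace d t → ℂ) (J : L2Space d →L[ℂ] L2Space d) : Prop :=
  ∀ ψ : L2Space d, ∀ᵐ ξ : EuclideanSpace ℝ (Fin d),
    Integrable (fun y => F (pathShift y ξ) * ψ (pathAt (pathShift y ξ) t)) m ∧
    J ψ ξ = ∫ y, F (pathShift y ξ) * ψ (pathAt (pathShift y ξ) t) ∂m

/-- `z ↦ J z` (for `Re z ≥ 0`) is the analytic-in-time operator-valued function space integral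
of the functionals `F`: it equals `Jᵗ(F)` for real `t > 0`, is analytic in the operator norm for
`Re z > 0`, and is strongly continuous for `Re z ≥ 0`. -/
structure IsAnalyticInTimeIntegral {d : ℕ} (m : (t : ℝ) → Measure (WienerSpace d t))
    (F : (t : ℝ) → PathSpace d t → ℂ) (J : ℂ → L2Space d →L[ℂ] L2Space d) : Prop where
  eq_integral : ∀ t : ℝ, 0 < t → IsFunctionSpaceIntegral (m t) (F t) (J t)
  analytic : DifferentiableOn ℂ J {z | 0 < z.re}
  strong_cont : ∀ ψ : L2Space d, ContinuousOn (fun z => J z ψ) {z | 0 ≤ z.re}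

/-- `F_V(y) = exp (-∫₀ᵗ V(y(s)) ds)`. -/
def potentialFunctional {d : ℕ} (V : EuclideanSpace ℝ (Fin d) → ℝ) (t : ℝ)
    (y : PathSpace d t) : ℂ :=
  ((Real.exp (-∫ s in (0 : ℝ)..t, V (pathAt y s)) : ℝ) : ℂ)

/-! ### The function being disentangled -/

/-- `g₁(z) = 1 / (1 - z)`. -/
def gOne (z : ℂ) : ℂ := 1 / (1 - z)

/-- `g(z) = z g₁(z) + g₁(0)`. -/
def gFun (z : ℂ) : ℂ := z * gOne z + gOne 0

end

/-!
The proof compares all the operators in question with one object, the Dyson series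
`dyson P A z = ∑ₘ zᵐ ∫ P((1 - rₘ) z) A ⋯ A P(r₁ z)` on the closed right half-plane, where
`P z = e^{-z H₀}` is the Fourier multiplier `freeSemigroup` and `A = -V`.

*Generators.* `H₀` is multiplication by `2π²‖ξ‖²` in Fourier space, so that `t ↦ P(ωt)` has
generator `-ωH₀` for `ω ≠ 0`, `Re ω ≥ 0`, with the full domain. Duhamel's formula for the Dyson
series shows that adding `A` only adds `ωA` to the derivative at zero, and uniqueness for Volterra
equations gives the semigroup law along rays; hence `t ↦ dyson P A (tω)` is generated by
`-ω(H₀ + V)`. For `ω = 1` and `ω = i` these are the heat semigroup and the Schrödinger group. A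
semigroup is determined by its generator (`IsC0SemigroupOf.eq`, `IsC0GroupOf.eq`), which identifies
the abstractly chosen `c0Semigroup` and `c0Group`.

*Reduced disentangling.* The `m`-th simplex integral is the `m`-th Dyson term, and replacing `A` by
`ξ⁻¹ A` multiplies it by `ξ⁻ᵐ`. Since `g(ξ) = ∑ ξᵐ`, the contour integral of `g(ξ) ξ⁻¹ ξ⁻ᵐ` is
`2πi` for every `m`, and summation reproduces the Dyson series
(`IsHalfPlaneSemigroup.reducedDisentangling_eq`).

*Wiener measure.* With the starting point distributed by Lebesgue measure, every position of the
path has Lebesgue distribution. An increment `w` over time `r` satisfies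
`E e^{2πi⟨w, ξ⟩} = e^{-2π²r‖ξ‖²}`, so that averaging over it is the heat semigroup, and the
independence of increments gives the Markov property (`IsWienerMeasure.integral_inner_markov`).
Expanding the Feynman–Kac weight by the fundamental theorem of calculus along paths, the
Feynman–Kac form satisfies Duhamel's formula, the same Volterra equation as the Dyson series;
hence both agree (`IsWienerMeasure.feynmanKacForm_eq`). All of this is done for
sesquilinear forms and turned into an almost everywhere pointwise identity by
`ae_eq_integral_of_forall_inner_eq`.

*Analytic continuation.* The Dyson series is weakly, hence norm analytic for `Re z > 0`, and
strongly continuous for `Re z ≥ 0`, so it is an analytic-in-time integral; the identity theorem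
makes it the only one.
-/

noncomputable section

/-! ### The Dyson series of a contraction semigroup on the right half-plane -/

section Dyson

variable {H : Type*} [NormedAddCommGroup H] [NormedSpace ℂ H]

/-- A strongly continuous family of contractions, indexed by all of `ℂ` for convenience, whose
restriction to the closed right half-plane is a semigroup. Only the values on that half-plane
matter. -/
structure IsHalfPlaneSemigroup (P : ℂ → H →L[ℂ] H) : Prop where
  at_zero : P 0 = ContinuousLinearMap.id ℂ H
  at_add : ∀ z w : ℂ, 0 ≤ z.re → 0 ≤ w.re → P (z + w) = (P z).comp (P w)
  norm_le : ∀ z : ℂ, ‖P z‖ ≤ 1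
  strong_cont : ∀ x : H, Continuous fun z => P z x

/-- The `m`-th term of the Dyson series of `e^{z (G + A)} x`, where `P z = e^{z G}`: it is the
sum over all ways of inserting `m` factors `A`, integrated along the segment from `0` to `z`. -/
def dysonTerm (P : ℂ → H →L[ℂ] H) (A : H →L[ℂ] H) : ℕ → ℂ → H → H
  | 0, z, x => P z x
  | m + 1, z, x => z • ∫ r in (0 : ℝ)..1, P ((1 - r : ℝ) * z) (A (dysonTerm P A m (r * z) x))

variable {P : ℂ → H →L[ℂ] H} {A : H →L[ℂ] H}

/-- A uniformly bounded, strongly continuous family of operators acts jointly continuously. -/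
theorem tendsto_clm_apply_of_norm_le {X : Type*} {l : Filter X} {Q : X → H →L[ℂ] H} {Q₀ : H →L[ℂ] H}
    {u : X → H} {u₀ : H} {C : ℝ} (hC : ∀ᶠ x in l, ‖Q x‖ ≤ C)
    (hQ : Tendsto (fun x => Q x u₀) l (𝓝 (Q₀ u₀))) (hu : Tendsto u l (𝓝 u₀)) :
    Tendsto (fun x => Q x (u x)) l (𝓝 (Q₀ u₀)) := by
  have h1 : Tendsto (fun x => Q x (u x - u₀)) l (𝓝 0) := by
    rw [tendsto_zero_iff_norm_tendsto_zero]
    have h2 : Tendsto (fun x => C * ‖u x - u₀‖) l (𝓝 0) := by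
      simpa using (tendsto_iff_norm_sub_tendsto_zero.1 hu).const_mul C
    refine squeeze_zero' (Eventually.of_forall fun _ => norm_nonneg _) ?_ h2
    filter_upwards [hC] with x hx
    exact (Q x).le_of_opNorm_le hx _
  simpa using h1.add hQ

namespace IsHalfPlaneSemigroup

theorem norm_apply_le (hP : IsHalfPlaneSemigroup P) (z : ℂ) (x : H) : ‖P z x‖ ≤ ‖x‖ := by
  simpa using (P z).le_of_opNorm_le (hP.norm_le z) x

theorem tendsto_apply (hP : IsHalfPlaneSemigroup P) {X : Type*} {l : Filter X} {f : X → ℂ}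
    {u : X → H} {z : ℂ} {x : H} (hf : Tendsto f l (𝓝 z)) (hu : Tendsto u l (𝓝 x)) :
    Tendsto (fun a => P (f a) (u a)) l (𝓝 (P z x)) :=
  tendsto_clm_apply_of_norm_le (Eventually.of_forall fun _ => hP.norm_le _)
    (((hP.strong_cont x).tendsto z).comp hf) hu

theorem continuous_apply (hP : IsHalfPlaneSemigroup P) {X : Type*} [TopologicalSpace X] {f : X → ℂ}
    {u : X → H} (hf : Continuous f) (hu : Continuous u) : Continuous fun a => P (f a) (u a) :=
  continuous_iff_continuousAt.2 fun a => hP.tendsto_apply (hf.tendsto a) (hu.tendsto a)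

theorem continuous_dysonTerm (hP : IsHalfPlaneSemigroup P) (A : H →L[ℂ] H) (m : ℕ) (x : H) :
    Continuous fun z => dysonTerm P A m z x := by
  induction m with
  | zero => exact hP.strong_cont x
  | succ m ih =>
    refine continuous_id.smul
      (intervalIntegral.continuous_parametric_intervalIntegral_of_continuous' ?_ 0 1)
    refine hP.continuous_apply (by fun_prop) (A.continuous.comp (ih.comp ?_))
    fun_prop

theorem continuous_dysonTerm_integrand (hP : IsHalfPlaneSemigroup P) (A : H →L[ℂ] H) (m : ℕ) (z : ℂ)
    (x : H) : Continuous fun r : ℝ => P ((1 - r : ℝ) * z) (A (dysonTerm P A m (r * z) x)) :=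
  hP.continuous_apply (by fun_prop)
    (A.continuous.comp ((hP.continuous_dysonTerm A m x).comp (by fun_prop)))

theorem dysonTerm_add (hP : IsHalfPlaneSemigroup P) (m : ℕ) (z : ℂ) (x y : H) :
    dysonTerm P A m z (x + y) = dysonTerm P A m z x + dysonTerm P A m z y := by
  induction m generalizing z with
  | zero => simp [dysonTerm]
  | succ m ih =>
    simp only [dysonTerm, ih, map_add]
    rw [intervalIntegral.integral_add, smul_add] <;>
    exact (hP.continuous_dysonTerm_integrand A m z _).intervalIntegrable _ _

theorem dysonTerm_smul (m : ℕ) (c z : ℂ) (x : H) :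
    dysonTerm P A m z (c • x) = c • dysonTerm P A m z x := by
  induction m generalizing z with
  | zero => simp [dysonTerm]
  | succ m ih =>
    simp only [dysonTerm, ih, map_smul]
    rw [intervalIntegral.integral_smul, smul_comm]

end IsHalfPlaneSemigroup

/-- Integrating a bound `C rⁿ` along a segment. -/
theorem norm_integral_zero_one_le {f : ℝ → H} {C : ℝ} {n : ℕ}
    (hf : ∀ r ∈ Icc (0 : ℝ) 1, ‖f r‖ ≤ C * r ^ n) : ‖∫ r in (0 : ℝ)..1, f r‖ ≤ C / (n + 1) := by
  have h := intervalIntegral.norm_integral_le_of_norm_le (f := f) (g := fun r => C * r ^ n)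
    (μ := volume) zero_le_one
    (ae_of_all _ fun r hr => hf r (Ioc_subset_Icc_self hr))
    ((by fun_prop : Continuous fun r : ℝ => C * r ^ n).intervalIntegrable _ _)
  refine h.trans_eq ?_
  rw [intervalIntegral.integral_const_mul, integral_pow]
  simp [div_eq_mul_inv]

namespace IsHalfPlaneSemigroup

theorem norm_dysonTerm_le (hP : IsHalfPlaneSemigroup P) (A : H →L[ℂ] H) (m : ℕ) (z : ℂ) (x : H) :
    ‖dysonTerm P A m z x‖ ≤ (‖z‖ * ‖A‖) ^ m / m.factorial * ‖x‖ := by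
  induction m generalizing z with
  | zero => simpa [dysonTerm] using hP.norm_apply_le z x
  | succ m ih =>
    have h := norm_integral_zero_one_le (n := m)
      (f := fun r : ℝ => P ((1 - r : ℝ) * z) (A (dysonTerm P A m (r * z) x)))
      (C := ‖A‖ * ((‖z‖ * ‖A‖) ^ m / m.factorial * ‖x‖)) (fun r hr => by
        refine (hP.norm_apply_le _ _).trans ((A.le_opNorm _).trans ?_)
        rw [mul_assoc ‖A‖]
        gcongr
        refine (ih _).trans_eq ?_
        rw [norm_mul, Complex.norm_real, Real.norm_of_nonneg hr.1]
        ring)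
    rw [dysonTerm, norm_smul]
    refine (mul_le_mul_of_nonneg_left h (norm_nonneg z)).trans_eq ?_
    rw [Nat.factorial_succ]
    push_cast
    field_simp
    ring

theorem summable_norm_dysonTerm (hP : IsHalfPlaneSemigroup P) (A : H →L[ℂ] H) (z : ℂ) (x : H) :
    Summable fun m => ‖dysonTerm P A m z x‖ :=
  Summable.of_nonneg_of_le (fun _ => norm_nonneg _) (fun m => hP.norm_dysonTerm_le A m z x)
    ((Real.summable_pow_div_factorial _).mul_right _)

/-- The recursion for the Dyson terms along the ray through `ω`, with time variable in `[0, t]`. -/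
theorem dysonTerm_succ_ray (A : H →L[ℂ] H) (m : ℕ) (ω : ℂ) (t : ℝ) (x : H) :
    dysonTerm P A (m + 1) (t * ω) x =
      ω • ∫ s in (0 : ℝ)..t, P ((t - s : ℝ) * ω) (A (dysonTerm P A m (s * ω) x)) := by
  have h := intervalIntegral.smul_integral_comp_mul_left (a := 0) (b := 1)
    (fun s : ℝ => P ((t - s : ℝ) * ω) (A (dysonTerm P A m (s * ω) x))) t
  rw [mul_zero, mul_one] at h
  rw [dysonTerm, ← h, mul_comm, mul_smul, Complex.coe_smul]
  congr 2
  refine intervalIntegral.integral_congr fun r _ => ?_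
  have e₁ : ((1 - r : ℝ) : ℂ) * (ω * t) = ((t - t * r : ℝ) : ℂ) * ω := by push_cast; ring
  have e₂ : (r : ℂ) * (ω * t) = ((t * r : ℝ) : ℂ) * ω := by push_cast; ring
  simp only [e₁, e₂]

end IsHalfPlaneSemigroup

theorem IsHalfPlaneSemigroup.norm_tsum_dysonTerm_le (hP : IsHalfPlaneSemigroup P) (A : H →L[ℂ] H)
    (z : ℂ) (x : H) :
    ‖∑' m, dysonTerm P A m z x‖ ≤ Real.exp (‖z‖ * ‖A‖) * ‖x‖ := by
  have h := (NormedSpace.expSeries_div_hasSum_exp (‖z‖ * ‖A‖)).mul_right ‖x‖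
  rw [← Real.exp_eq_exp_ℝ] at h
  exact tsum_of_norm_bounded h fun m => hP.norm_dysonTerm_le A m z x

/-- Iterating a linear Volterra inequality along the segment from `0` to `t` shows that its only
bounded solution is zero. -/
theorem eq_zero_of_volterra {v : ℝ → H} {K C t : ℝ} (hK : 0 ≤ K) {f : ℝ → ℝ → H}
    (hC : ∀ r ∈ Icc (0 : ℝ) 1, ‖v (r * t)‖ ≤ C)
    (hv : ∀ r ∈ Icc (0 : ℝ) 1, v (r * t) = ∫ s in (0 : ℝ)..r * t, f (r * t) s)
    (hf : ∀ r ∈ Icc (0 : ℝ) 1, ∀ q ∈ Icc (0 : ℝ) 1,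
      ‖f (r * t) (q * (r * t))‖ ≤ K * ‖v (q * (r * t))‖) : v t = 0 := by
  have key : ∀ n : ℕ, ∀ r ∈ Icc (0 : ℝ) 1,
      ‖v (r * t)‖ ≤ C * ((K * |t|) ^ n / n.factorial) * r ^ n := by
    intro n
    induction n with
    | zero => simpa using hC
    | succ n ih =>
      intro r hr
      have h := intervalIntegral.smul_integral_comp_mul_right (a := 0) (b := 1) (f (r * t)) (r * t)
      rw [zero_mul, one_mul] at h
      rw [hv r hr, ← h, norm_smul]
      have h2 := norm_integral_zero_one_le (n := n) (f := fun q => f (r * t) (q * (r * t)))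
        (C := K * (C * ((K * |t|) ^ n / n.factorial) * r ^ n)) (fun q hq => by
          refine (hf r hr q hq).trans ?_
          rw [mul_assoc K]
          gcongr
          have hqr : q * r ∈ Icc (0 : ℝ) 1 :=
            ⟨mul_nonneg hq.1 hr.1, mul_le_one₀ hq.2 hr.1 hr.2⟩
          have := ih (q * r) hqr
          rw [← mul_assoc q r t]
          refine this.trans_eq ?_
          ring)
      refine (mul_le_mul_of_nonneg_left h2 (norm_nonneg _)).trans_eq ?_
      rw [Real.norm_eq_abs, abs_mul, abs_of_nonneg hr.1, Nat.factorial_succ]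
      push_cast
      field_simp
      ring
  have hlim : Tendsto (fun n : ℕ => C * ((K * |t|) ^ n / n.factorial)) atTop (𝓝 0) := by
    simpa using (FloorSemiring.tendsto_pow_div_factorial_atTop (K * |t|)).const_mul C
  have hle : ‖v t‖ ≤ 0 := ge_of_tendsto' hlim fun n => by
    simpa using key n 1 (by simp)
  exact norm_le_zero_iff.1 hle

variable [CompleteSpace H]

open Classical in
/-- The sum `e^{z (G + A)}` of the Dyson series, where `P z = e^{z G}` (zero unless `P` is a
half-plane semigroup). -/
def dyson (P : ℂ → H →L[ℂ] H) (A : H →L[ℂ] H) (z : ℂ) : H →L[ℂ] H :=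
  if hP : IsHalfPlaneSemigroup P then
    LinearMap.mkContinuous
      { toFun := fun x => ∑' m, dysonTerm P A m z x
        map_add' := fun x y => by
          simp only [hP.dysonTerm_add]
          exact (hP.summable_norm_dysonTerm A z x).of_norm.tsum_add
            (hP.summable_norm_dysonTerm A z y).of_norm
        map_smul' := fun c x => by
          simp only [IsHalfPlaneSemigroup.dysonTerm_smul, RingHom.id_apply]
          exact (hP.summable_norm_dysonTerm A z x).of_norm.tsum_const_smul c }
      (Real.exp (‖z‖ * ‖A‖)) (fun x => hP.norm_tsum_dysonTerm_le A z x)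
  else 0

namespace IsHalfPlaneSemigroup

theorem dyson_apply (hP : IsHalfPlaneSemigroup P) (A : H →L[ℂ] H) (z : ℂ) (x : H) :
    dyson P A z x = ∑' m, dysonTerm P A m z x := by
  simp [dyson, hP]

theorem norm_dyson_le (hP : IsHalfPlaneSemigroup P) (A : H →L[ℂ] H) (z : ℂ) :
    ‖dyson P A z‖ ≤ Real.exp (‖z‖ * ‖A‖) := by
  simp only [dyson, hP, dif_pos]
  exact LinearMap.mkContinuous_norm_le _ (Real.exp_pos _).le _

theorem continuous_dyson (hP : IsHalfPlaneSemigroup P) (A : H →L[ℂ] H) (x : H) :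
    Continuous fun z => dyson P A z x := by
  simp only [hP.dyson_apply]
  refine continuous_iff_continuousAt.2 fun z => ?_
  have hs : Summable fun m : ℕ => ((‖z‖ + 1) * ‖A‖) ^ m / m.factorial * ‖x‖ :=
    (Real.summable_pow_div_factorial _).mul_right _
  suffices h : ContinuousOn (fun w => ∑' m, dysonTerm P A m w x) (Metric.closedBall z 1) from
    h.continuousAt (Metric.closedBall_mem_nhds _ one_pos)
  refine continuousOn_tsum (fun m => (hP.continuous_dysonTerm A m x).continuousOn) hs
    fun m w hw => ?_
  refine (hP.norm_dysonTerm_le A m w x).trans ?_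
  gcongr
  have := norm_le_norm_add_norm_sub' w z
  rw [Metric.mem_closedBall, dist_eq_norm] at hw
  linarith

theorem continuous_dyson_apply (hP : IsHalfPlaneSemigroup P) (A : H →L[ℂ] H) {X : Type*}
    [TopologicalSpace X] {f : X → ℂ} {u : X → H} (hf : Continuous f) (hu : Continuous u) :
    Continuous fun a => dyson P A (f a) (u a) := by
  refine continuous_iff_continuousAt.2 fun a => ?_
  refine tendsto_clm_apply_of_norm_le (C := Real.exp ((‖f a‖ + 1) * ‖A‖)) ?_
    (((hP.continuous_dyson A (u a)).comp hf).tendsto a) (hu.tendsto a)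
  have h : ∀ᶠ b in 𝓝 a, ‖f b‖ < ‖f a‖ + 1 :=
    (hf.norm.tendsto a).eventually_lt_const (by linarith)
  filter_upwards [h] with b hb
  refine (hP.norm_dyson_le A _).trans ?_
  gcongr

theorem dyson_duhamel (hP : IsHalfPlaneSemigroup P) (A : H →L[ℂ] H) (z : ℂ) (x : H) :
    dyson P A z x =
      P z x + z • ∫ r in (0 : ℝ)..1, P ((1 - r : ℝ) * z) (A (dyson P A (r * z) x)) := by
  rw [hP.dyson_apply, (hP.summable_norm_dysonTerm A z x).of_norm.tsum_eq_zero_add]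
  congr 1
  have h : HasSum (fun m => ∫ r in (0 : ℝ)..1, P ((1 - r : ℝ) * z) (A (dysonTerm P A m (r * z) x)))
      (∫ r in (0 : ℝ)..1, P ((1 - r : ℝ) * z) (A (dyson P A (r * z) x))) := by
    refine intervalIntegral.hasSum_integral_of_dominated_convergence
      (fun m _ => ‖A‖ * ((‖z‖ * ‖A‖) ^ m / m.factorial * ‖x‖))
      (fun m => (hP.continuous_dysonTerm_integrand A m z x).aestronglyMeasurable)
      (fun m => ae_of_all _ fun r hr => ?_)
      (ae_of_all _ fun r _ => ((Real.summable_pow_div_factorial _).mul_right _).mul_left _)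
      intervalIntegrable_const (ae_of_all _ fun r _ => ?_)
    · rw [uIoc_of_le zero_le_one] at hr
      refine (hP.norm_apply_le _ _).trans ((A.le_opNorm _).trans ?_)
      gcongr
      refine (hP.norm_dysonTerm_le A m _ x).trans ?_
      gcongr
      rw [norm_mul, Complex.norm_real, Real.norm_of_nonneg hr.1.le]
      exact mul_le_of_le_one_left (norm_nonneg _) hr.2
    · rw [hP.dyson_apply]
      exact ((P ((1 - r : ℝ) * z)).comp A).hasSum
        (hP.summable_norm_dysonTerm A (r * z) x).of_norm.hasSum
  exact (h.const_smul z).tsum_eq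

/-- Duhamel's formula along the ray through `ω`. -/
theorem dyson_duhamel_ray (hP : IsHalfPlaneSemigroup P) (A : H →L[ℂ] H) (ω : ℂ) (t : ℝ) (x : H) :
    dyson P A (t * ω) x =
      P (t * ω) x + ω • ∫ s in (0 : ℝ)..t, P ((t - s : ℝ) * ω) (A (dyson P A (s * ω) x)) := by
  rw [hP.dyson_duhamel]
  congr 1
  have h := intervalIntegral.smul_integral_comp_mul_left (a := 0) (b := 1)
    (fun s : ℝ => P ((t - s : ℝ) * ω) (A (dyson P A (s * ω) x))) t
  rw [mul_zero, mul_one] at h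
  rw [← h, mul_comm, mul_smul, Complex.coe_smul]
  congr 2
  refine intervalIntegral.integral_congr fun r _ => ?_
  have e₁ : ((1 - r : ℝ) : ℂ) * (ω * t) = ((t - t * r : ℝ) : ℂ) * ω := by push_cast; ring
  have e₂ : (r : ℂ) * (ω * t) = ((t * r : ℝ) : ℂ) * ω := by push_cast; ring
  simp only [e₁, e₂]

end IsHalfPlaneSemigroup

namespace IsHalfPlaneSemigroup

/-- The semigroup law of the Dyson series, for times in a set `J` (in the applications `[0, ∞)`
or `ℝ`) such that `t ω` stays in the closed right half-plane for `t ∈ J`. -/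
theorem dyson_add_ray (hP : IsHalfPlaneSemigroup P) (A : H →L[ℂ] H) {ω : ℂ} {J : Set ℝ}
    (hJ : ∀ t ∈ J, 0 ≤ ((t : ℂ) * ω).re) (hJc : ∀ t ∈ J, ∀ r ∈ Icc (0 : ℝ) 1, r * t ∈ J)
    {s t : ℝ} (hs : s ∈ J) (ht : t ∈ J) :
    dyson P A ((s + t : ℝ) * ω) = (dyson P A (s * ω)).comp (dyson P A (t * ω)) := by
  ext x
  have hcont : ∀ (u : ℝ) (y : H), Continuous fun r : ℝ =>
      P ((u - r : ℝ) * ω) (A (dyson P A (r * ω) y)) := fun u y =>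
    hP.continuous_apply (by fun_prop)
      (A.continuous.comp (hP.continuous_dyson_apply A (by fun_prop) continuous_const))
  set v : ℝ → H := fun s => dyson P A ((s + t : ℝ) * ω) x - dyson P A (s * ω) (dyson P A (t * ω) x)
    with hvdef
  have hvc : Continuous v :=
    (hP.continuous_dyson_apply A (by fun_prop) continuous_const).sub
      (hP.continuous_dyson_apply A (by fun_prop) continuous_const)
  have hvs : ∀ s ∈ J, v s = ∫ r in (0 : ℝ)..s, ω • P ((s - r : ℝ) * ω) (A (v r)) := by
    intro s hs
    have h1 : dyson P A ((s + t : ℝ) * ω) x = P (s * ω) (dyson P A (t * ω) x) +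
        ω • ∫ r in (0 : ℝ)..s, P ((s - r : ℝ) * ω) (A (dyson P A ((r + t : ℝ) * ω) x)) := by
      rw [hP.dyson_duhamel_ray A ω (s + t), hP.dyson_duhamel_ray A ω t, map_add, map_smul,
        ← ContinuousLinearMap.intervalIntegral_comp_comm _ ((hcont t x).intervalIntegrable _ _),
        ← intervalIntegral.integral_add_adjacent_intervals
          ((hcont (s + t) x).intervalIntegrable 0 t)
          ((hcont (s + t) x).intervalIntegrable t (s + t)),
        smul_add, ← add_assoc]
      congr 1
      · congr 1
        · rw [← ContinuousLinearMap.comp_apply, ← hP.at_add _ _ (hJ s hs) (hJ t ht)]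
          have e : ((s + t : ℝ) : ℂ) * ω = s * ω + t * ω := by push_cast; ring
          rw [e]
        · congr 1
          -- for `r` between `0` and `t`, the time `t - r` is again in `J`
          refine intervalIntegral.integral_congr fun r hr => ?_
          have hr' : t - r ∈ J := by
            rcases eq_or_ne t 0 with h0 | h0
            · subst h0
              have : r = 0 := by simpa using hr
              simpa [this] using ht
            · have : t - r = ((t - r) / t) * t := by field_simp
              rw [this]
              refine hJc t ht _ ?_
              rcases lt_or_gt_of_ne h0 with h | h
              · rw [uIcc_of_ge h.le] at hr
                constructor
                · exact div_nonneg_of_nonpos (by linarith [hr.1]) h.le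
                · rw [div_le_one_of_neg h]; linarith [hr.2]
              · rw [uIcc_of_le h.le] at hr
                constructor
                · exact div_nonneg (by linarith [hr.2]) h.le
                · rw [div_le_one h]; linarith [hr.1]
          have e : ((s + t - r : ℝ) : ℂ) * ω = s * ω + ((t - r : ℝ) : ℂ) * ω := by push_cast; ring
          simp only [e, hP.at_add _ _ (hJ s hs) (hJ _ hr'), ContinuousLinearMap.comp_apply]
      · congr 1
        have h := intervalIntegral.integral_comp_add_right (a := 0) (b := s)
          (fun r => P (((s + t) - r : ℝ) * ω) (A (dyson P A (r * ω) x))) t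
        rw [zero_add] at h
        rw [← h]
        refine intervalIntegral.integral_congr fun r _ => ?_
        have e : ((s + t - (r + t) : ℝ) : ℂ) = ((s - r : ℝ) : ℂ) := by push_cast; ring
        simp only [e]
    simp only [hvdef]
    rw [h1, hP.dyson_duhamel_ray A ω s, add_sub_add_left_eq_sub, ← smul_sub,
      intervalIntegral.integral_smul, ← intervalIntegral.integral_sub]
    · simp only [map_sub]
    · exact (hP.continuous_apply (by fun_prop) (A.continuous.comp
        (hP.continuous_dyson_apply A (by fun_prop) continuous_const))).intervalIntegrable _ _
    · exact (hcont s _).intervalIntegrable _ _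
  obtain ⟨C, hC⟩ := (isCompact_Icc (a := (0 : ℝ)) (b := 1)).exists_bound_of_continuousOn
    (f := fun r => v (r * s)) (hvc.comp (by fun_prop)).continuousOn
  have h0 : v s = 0 := by
    refine eq_zero_of_volterra (K := ‖ω‖ * ‖A‖) (by positivity)
      (f := fun s r => ω • P ((s - r : ℝ) * ω) (A (v r))) hC
      (fun r hr => hvs _ (hJc s hs r hr)) fun r _ q _ => ?_
    rw [norm_smul, mul_assoc]
    gcongr
    exact (hP.norm_apply_le _ _).trans (A.le_opNorm _)
  simpa [hvdef, sub_eq_zero] using h0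

theorem dyson_zero (hP : IsHalfPlaneSemigroup P) (A : H →L[ℂ] H) :
    dyson P A 0 = ContinuousLinearMap.id ℂ H := by
  ext x
  rw [hP.dyson_duhamel]
  simp [hP.at_zero]

end IsHalfPlaneSemigroup

end Dyson

/-! ### Generators, uniqueness of semigroups, and Duhamel's formula from the right -/

section Generators

variable {H : Type*} [NormedAddCommGroup H] [NormedSpace ℂ H]

theorem tendsto_sub_nhdsGT_zero (s : ℝ) : Tendsto (fun u => u - s) (𝓝[>] s) (𝓝[>] 0) := by
  refine tendsto_nhdsWithin_iff.2 ⟨?_, ?_⟩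
  · have h : Tendsto (fun u : ℝ => u - s) (𝓝 s) (𝓝 (s - s)) :=
      (continuous_id.sub continuous_const).tendsto s
    rw [sub_self] at h
    exact h.mono_left nhdsWithin_le_nhds
  · filter_upwards [self_mem_nhdsWithin] with u hu
    exact mem_Ioi.2 (sub_pos.2 (mem_Ioi.1 hu))

theorem hasDerivWithinAt_Ioi_of_tendsto {f : ℝ → H} {f' : H} {s : ℝ}
    (h : Tendsto (fun h : ℝ => (h : ℂ)⁻¹ • (f (s + h) - f s)) (𝓝[>] 0) (𝓝 f')) :
    HasDerivWithinAt f f' (Ioi s) s := by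
  rw [hasDerivWithinAt_iff_tendsto_slope' (by simp)]
  refine (h.comp (tendsto_sub_nhdsGT_zero s)).congr fun u => ?_
  simp only [Function.comp, slope, vsub_eq_sub, add_sub_cancel]
  rw [← Complex.ofReal_inv, Complex.coe_smul]

/-- A semigroup `S`, bounded on `[0, t]`, agrees at `t` with any semigroup `S'` that has the same
derivative at zero on a dense, `S'`-invariant set: `s ↦ S (t - s) (S' s x)` has vanishing right
derivative. -/
theorem eq_of_tendsto_slope_eq {S S' : ℝ → H →L[ℂ] H} {D : Set H} (hD : Dense D) {t C : ℝ}
    (ht : 0 ≤ t) (hS0 : S 0 = ContinuousLinearMap.id ℂ H)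
    (hS : ∀ s r : ℝ, 0 ≤ s → 0 ≤ r → S (s + r) = (S s).comp (S r))
    (hSc : ∀ x, ContinuousOn (fun s => S s x) (Ici 0)) (hSC : ∀ s ∈ Icc 0 t, ‖S s‖ ≤ C)
    (hS'0 : S' 0 = ContinuousLinearMap.id ℂ H)
    (hS' : ∀ s r : ℝ, 0 ≤ s → 0 ≤ r → S' (s + r) = (S' s).comp (S' r))
    (hS'c : ∀ x, ContinuousOn (fun s => S' s x) (Ici 0))
    (hinv : ∀ x ∈ D, ∀ s, 0 ≤ s → S' s x ∈ D)
    (hder : ∀ x ∈ D, Tendsto (fun h : ℝ => (h : ℂ)⁻¹ • (S' h x - S h x)) (𝓝[>] 0) (𝓝 0)) :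
    S' t = S t := by
  refine ContinuousLinearMap.ext fun x => ?_
  refine congrFun (Continuous.ext_on hD (S' t).continuous (S t).continuous fun x hx => ?_) x
  have hcont : ContinuousOn (fun s => S (t - s) (S' s x)) (Icc 0 t) := by
    intro s hs
    refine tendsto_clm_apply_of_norm_le (C := C) ?_ ?_ ?_
    · filter_upwards [self_mem_nhdsWithin] with u hu
      exact hSC _ ⟨by linarith [hu.2], by linarith [hu.1]⟩
    · refine ((hSc (S' s x)) (t - s) (sub_nonneg.2 hs.2)).tendsto.comp
        (tendsto_nhdsWithin_iff.2 ⟨?_, ?_⟩)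
      · exact ((continuous_const.sub continuous_id).tendsto s).mono_left nhdsWithin_le_nhds
      · filter_upwards [self_mem_nhdsWithin] with u hu
        exact sub_nonneg.2 hu.2
    · exact ((hS'c x) s hs.1).mono Icc_subset_Ici_self
  have hconst := constant_of_has_deriv_right_zero hcont (fun s hs => by
    refine HasDerivWithinAt.Ici_of_Ioi (hasDerivWithinAt_Ioi_of_tendsto ?_)
    have hts : 0 < t - s := sub_pos.2 hs.2
    have hsmall : ∀ᶠ h in 𝓝[>] (0 : ℝ), h ∈ Ioo 0 (t - s) := Ioo_mem_nhdsGT hts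
    have h1 : Tendsto (fun h : ℝ => S (t - (s + h)) ((h : ℂ)⁻¹ • (S' h (S' s x) - S h (S' s x))))
        (𝓝[>] 0) (𝓝 ((0 : H →L[ℂ] H) 0)) := by
      rw [zero_apply, tendsto_zero_iff_norm_tendsto_zero]
      have h2 := (tendsto_zero_iff_norm_tendsto_zero.1
        (hder _ (hinv x hx s hs.1))).const_mul C
      rw [mul_zero] at h2
      refine squeeze_zero' (Eventually.of_forall fun _ => norm_nonneg _) ?_ h2
      filter_upwards [hsmall] with h hh
      exact (S _).le_of_opNorm_le (hSC _ ⟨by linarith [hh.2], by linarith [hh.1, hs.1]⟩) _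
    rw [zero_apply] at h1
    refine h1.congr' ?_
    filter_upwards [hsmall] with h hh
    have e1 : S' (s + h) = (S' h).comp (S' s) := by rw [add_comm, hS' _ _ hh.1.le hs.1]
    have e2 : S (t - s) = (S (t - (s + h))).comp (S h) := by
      rw [← hS _ _ (by linarith [hh.2]) hh.1.le]
      congr 1
      ring
    simp only [e1, e2, map_smul, map_sub, ContinuousLinearMap.comp_apply]) t (right_mem_Icc.2 ht)
  simpa [hS0, hS'0] using hconst

theorem IsC0SemigroupOf.mem_graph_apply {S : ℝ → H →L[ℂ] H} {B : H →ₗ.[ℂ] H}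
    (hS : IsC0SemigroupOf S B) {x y : H} (hxy : (x, y) ∈ B.graph) {t : ℝ} (ht : 0 ≤ t) :
    (S t x, S t y) ∈ B.graph := by
  rw [hS.generator] at hxy ⊢
  refine (((S t).continuous.tendsto y).comp hxy).congr' ?_
  filter_upwards [self_mem_nhdsWithin] with h hh
  have e : (S t).comp (S h) = (S h).comp (S t) := by
    rw [← hS.map_add _ _ ht (le_of_lt hh), ← hS.map_add _ _ (le_of_lt hh) ht, add_comm]
  simp only [Function.comp, map_smul, map_sub]
  rw [← ContinuousLinearMap.comp_apply (S t), e, ContinuousLinearMap.comp_apply]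

theorem IsC0SemigroupOf.eq {S S' : ℝ → H →L[ℂ] H} {B : H →ₗ.[ℂ] H} (hS : IsC0SemigroupOf S B)
    (hS' : IsC0SemigroupOf S' B) (hD : Dense (B.domain : Set H)) {t C : ℝ} (ht : 0 ≤ t)
    (hSC : ∀ s ∈ Icc 0 t, ‖S s‖ ≤ C) : S' t = S t := by
  refine eq_of_tendsto_slope_eq hD ht hS.map_zero hS.map_add hS.strong_cont hSC hS'.map_zero
    hS'.map_add hS'.strong_cont (fun x hx s hs => ?_) (fun x hx => ?_)
  · obtain ⟨y, hy⟩ := LinearPMap.mem_domain_iff.1 hx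
    exact LinearPMap.mem_domain_of_mem_graph (hS'.mem_graph_apply hy hs)
  · obtain ⟨y, hy⟩ := LinearPMap.mem_domain_iff.1 hx
    have h := ((hS'.generator x y).1 hy).sub ((hS.generator x y).1 hy)
    rw [sub_self] at h
    refine h.congr fun h => ?_
    rw [← smul_sub, sub_sub_sub_cancel_right]

theorem IsC0SemigroupOf.c0Semigroup {S : ℝ → H →L[ℂ] H} {B : H →ₗ.[ℂ] H}
    (hS : IsC0SemigroupOf S B) : IsC0SemigroupOf (c0Semigroup B) B := by
  have h : ∃ S : ℝ → H →L[ℂ] H, IsC0SemigroupOf S B := ⟨S, hS⟩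
  rw [_root_.c0Semigroup, dif_pos h]
  exact h.choose_spec

theorem IsC0GroupOf.c0Group {S : ℝ → H →L[ℂ] H} {B : H →ₗ.[ℂ] H}
    (hS : IsC0GroupOf S B) : IsC0GroupOf (c0Group B) B := by
  have h : ∃ S : ℝ → H →L[ℂ] H, IsC0GroupOf S B := ⟨S, hS⟩
  rw [_root_.c0Group, dif_pos h]
  exact h.choose_spec

theorem IsC0GroupOf.mem_graph_apply {S : ℝ → H →L[ℂ] H} {B : H →ₗ.[ℂ] H}
    (hS : IsC0GroupOf S B) {x y : H} (hxy : (x, y) ∈ B.graph) (t : ℝ) :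
    (S t x, S t y) ∈ B.graph := by
  rw [hS.generator] at hxy ⊢
  refine (((S t).continuous.tendsto y).comp hxy).congr fun h => ?_
  have e : (S t).comp (S h) = (S h).comp (S t) := by
    rw [← hS.map_add, ← hS.map_add, add_comm]
  simp only [Function.comp, map_smul, map_sub]
  rw [← ContinuousLinearMap.comp_apply (S t), e, ContinuousLinearMap.comp_apply]

theorem IsC0GroupOf.eq {S S' : ℝ → H →L[ℂ] H} {B : H →ₗ.[ℂ] H} (hS : IsC0GroupOf S B)
    (hS' : IsC0GroupOf S' B) (hD : Dense (B.domain : Set H))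
    (hSC : ∀ t, 0 ≤ t → ∃ C, ∀ s ∈ Icc 0 t, ‖S s‖ ≤ C) : S' = S := by
  have hle : 𝓝[>] (0 : ℝ) ≤ 𝓝[≠] 0 := nhdsWithin_mono _ fun x hx => (ne_of_gt hx : x ≠ 0)
  have hpos : ∀ t, 0 ≤ t → S' t = S t := by
    intro t ht
    obtain ⟨C, hC⟩ := hSC t ht
    refine eq_of_tendsto_slope_eq hD ht hS.map_zero (fun s r _ _ => hS.map_add s r)
      (fun x => (hS.strong_cont x).continuousOn) hC hS'.map_zero (fun s r _ _ => hS'.map_add s r)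
      (fun x => (hS'.strong_cont x).continuousOn) (fun x hx s hs => ?_) (fun x hx => ?_)
    · obtain ⟨y, hy⟩ := LinearPMap.mem_domain_iff.1 hx
      exact LinearPMap.mem_domain_of_mem_graph (hS'.mem_graph_apply hy s)
    · obtain ⟨y, hy⟩ := LinearPMap.mem_domain_iff.1 hx
      have h := (((hS'.generator x y).1 hy).sub ((hS.generator x y).1 hy)).mono_left hle
      rw [sub_self] at h
      refine h.congr fun h => ?_
      rw [← smul_sub, sub_sub_sub_cancel_right]
  funext t
  rcases le_total 0 t with ht | ht
  · exact hpos t ht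
  · -- both `S t` and `S' t` are inverse to `S (-t) = S' (-t)`
    have e1 : (S' t).comp (S' (-t)) = ContinuousLinearMap.id ℂ H := by
      rw [← hS'.map_add, add_neg_cancel, hS'.map_zero]
    have e2 : (S (-t)).comp (S t) = ContinuousLinearMap.id ℂ H := by
      rw [← hS.map_add, neg_add_cancel, hS.map_zero]
    rw [hpos (-t) (by linarith)] at e1
    calc S' t = (S' t).comp ((S (-t)).comp (S t)) := by rw [e2, ContinuousLinearMap.comp_id]
      _ = S t := by rw [← ContinuousLinearMap.comp_assoc, e1, ContinuousLinearMap.id_comp]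

/-- A group with densely defined, dissipative and accretive generator is unitary. -/
theorem IsC0GroupOf.mem_unitary {H : Type*} [NormedAddCommGroup H] [InnerProductSpace ℂ H]
    [CompleteSpace H] {U : ℝ → H →L[ℂ] H} {B : H →ₗ.[ℂ] H} (hU : IsC0GroupOf U B)
    (hD : Dense (B.domain : Set H)) (hB : ∀ x y : H, (x, y) ∈ B.graph → (inner ℂ x y).re = 0)
    (t : ℝ) : U t ∈ unitary (H →L[ℂ] H) := by
  have hnorm : ∀ (t : ℝ) (x : H), ‖U t x‖ = ‖x‖ := by
    intro t x
    refine congrFun (Continuous.ext_on hD (U t).continuous.norm continuous_norm fun x hx => ?_) x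
    obtain ⟨y, hy⟩ := LinearPMap.mem_domain_iff.1 hx
    have hd : ∀ s, HasDerivAt (fun s => U s x) (U s y) s := by
      intro s
      rw [hasDerivAt_iff_tendsto_slope_zero]
      refine ((hU.generator _ _).1 (hU.mem_graph_apply hy s)).congr fun h => ?_
      rw [← Complex.ofReal_inv, Complex.coe_smul, add_comm, hU.map_add]
      rfl
    let _ : InnerProductSpace ℝ H := InnerProductSpace.rclikeToReal ℂ H
    have hn : ∀ s, HasDerivAt (fun s => ‖U s x‖ ^ 2) 0 s := by
      intro s
      have h := (hd s).norm_sq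
      have h0 : inner ℝ (U s x) (U s y) = (inner ℂ (U s x) (U s y)).re := rfl
      rwa [h0, hB _ _ (hU.mem_graph_apply hy s), mul_zero] at h
    have h := is_const_of_deriv_eq_zero (fun s => (hn s).differentiableAt)
      (fun s => (hn s).deriv) t 0
    simp only [hU.map_zero, ContinuousLinearMap.id_apply] at h
    exact (sq_eq_sq₀ (norm_nonneg _) (norm_nonneg _)).1 h
  have h1 : star (U t) * U t = 1 := (U t).norm_map_iff_adjoint_comp_self.1 (hnorm t)
  have h2 : U t * U (-t) = 1 := by
    have := hU.map_add t (-t)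
    rw [add_neg_cancel, hU.map_zero] at this
    exact this.symm
  have h3 : star (U t) = U (-t) := left_inv_eq_right_inv h1 h2
  exact Unitary.mem_iff.2 ⟨h1, by rw [h3, h2]⟩

variable [CompleteSpace H] {P : ℂ → H →L[ℂ] H} {A : H →L[ℂ] H}

namespace IsHalfPlaneSemigroup

/-- The derivative at zero of the Dyson series, relative to `P`, is `ω A` along the ray
through `ω`. -/
theorem tendsto_slope_dyson_sub (hP : IsHalfPlaneSemigroup P) (A : H →L[ℂ] H) (ω : ℂ)
    {y : ℝ → H} {y₀ : H} {l : Filter ℝ} (hl : l ≤ 𝓝[≠] 0) (hy : Tendsto y l (𝓝 y₀)) :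
    Tendsto (fun h : ℝ => (h : ℂ)⁻¹ • (dyson P A (h * ω) (y h) - P (h * ω) (y h))) l
      (𝓝 (ω • A y₀)) := by
  have hc : Continuous fun p : ℂ × H =>
      ∫ r in (0 : ℝ)..1, P ((1 - r : ℝ) * p.1) (A (dyson P A (r * p.1) p.2)) := by
    refine intervalIntegral.continuous_parametric_intervalIntegral_of_continuous' ?_ 0 1
    exact hP.continuous_apply (by fun_prop)
      (A.continuous.comp (hP.continuous_dyson_apply A (by fun_prop) (by fun_prop)))
  have h0 : Tendsto (fun h : ℝ => ((h : ℂ) * ω, y h)) l (𝓝 (0, y₀)) := by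
    refine Tendsto.prodMk_nhds ?_ hy
    have : Tendsto (fun h : ℝ => (h : ℂ) * ω) (𝓝 0) (𝓝 (((0 : ℝ) : ℂ) * ω)) :=
      Continuous.tendsto (by fun_prop) 0
    rw [Complex.ofReal_zero, zero_mul] at this
    exact this.mono_left (hl.trans nhdsWithin_le_nhds)
  have h1 := ((hc.tendsto (0, y₀)).comp h0).const_smul ω
  have h2 : (∫ r in (0 : ℝ)..1, P ((1 - r : ℝ) * (0 : ℂ)) (A (dyson P A (r * (0 : ℂ)) y₀))) =
      A y₀ := by
    simp [hP.at_zero, hP.dyson_zero]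
  simp only [h2] at h1
  refine h1.congr' ?_
  filter_upwards [hl self_mem_nhdsWithin] with h hh
  have hh' : (h : ℂ) ≠ 0 := Complex.ofReal_ne_zero.2 hh
  rw [hP.dyson_duhamel A (h * ω) (y h), add_sub_cancel_left, smul_smul, inv_mul_cancel_left₀ hh']
  rfl

theorem tendsto_slope_dyson_iff (hP : IsHalfPlaneSemigroup P) (A : H →L[ℂ] H) (ω : ℂ) (x y : H)
    {l : Filter ℝ} (hl : l ≤ 𝓝[≠] 0) :
    Tendsto (fun h : ℝ => (h : ℂ)⁻¹ • (dyson P A (h * ω) x - x)) l (𝓝 y) ↔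
      Tendsto (fun h : ℝ => (h : ℂ)⁻¹ • (P (h * ω) x - x)) l (𝓝 (y - ω • A x)) := by
  have h := hP.tendsto_slope_dyson_sub A ω hl (tendsto_const_nhds (x := x))
  constructor
  · intro h1
    refine (h1.sub h).congr fun h => ?_
    rw [← smul_sub]
    congr 1
    abel
  · intro h1
    have h2 := h1.add h
    rw [sub_add_cancel] at h2
    refine h2.congr fun h => ?_
    rw [← smul_add]
    congr 1
    abel

/-- Duhamel's formula with the perturbed semigroup on the left. -/
theorem dyson_duhamel_right (hP : IsHalfPlaneSemigroup P) (A : H →L[ℂ] H) {ω : ℂ} (hω : 0 ≤ ω.re)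
    {t : ℝ} (ht : 0 ≤ t) (x : H) :
    dyson P A (t * ω) x =
      P (t * ω) x + ω • ∫ s in (0 : ℝ)..t, dyson P A (s * ω) (A (P ((t - s : ℝ) * ω) x)) := by
  have hre : ∀ s : ℝ, 0 ≤ s → 0 ≤ ((s : ℂ) * ω).re := fun s hs => by
    rw [Complex.re_ofReal_mul]
    exact mul_nonneg hs hω
  have hmul : ∀ s r : ℝ, 0 ≤ s → 0 ≤ r →
      dyson P A ((s + r : ℝ) * ω) = (dyson P A (s * ω)).comp (dyson P A (r * ω)) :=
    fun s r hs hr => hP.dyson_add_ray A (J := Ici 0) hre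
      (fun t ht r hr => mul_nonneg hr.1 ht) hs hr
  have hc : Continuous fun s : ℝ => dyson P A (s * ω) (P ((t - s : ℝ) * ω) x) :=
    hP.continuous_dyson_apply A (by fun_prop) (hP.continuous_apply (by fun_prop) continuous_const)
  have hc' : Continuous fun s : ℝ => dyson P A (s * ω) (A (P ((t - s : ℝ) * ω) x)) :=
    hP.continuous_dyson_apply A (by fun_prop)
      (A.continuous.comp (hP.continuous_apply (by fun_prop) continuous_const))
  have h := intervalIntegral.integral_eq_sub_of_hasDeriv_right (a := 0) (b := t) hc.continuousOn
    (f' := fun s : ℝ => ω • dyson P A (s * ω) (A (P ((t - s : ℝ) * ω) x))) (fun s hs => by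
      rw [min_eq_left ht, max_eq_right ht] at hs
      refine hasDerivWithinAt_Ioi_of_tendsto ?_
      have hy : Tendsto (fun h : ℝ => P ((t - (s + h) : ℝ) * ω) x) (𝓝[>] 0)
          (𝓝 (P ((t - s : ℝ) * ω) x)) := by
        have := (hP.continuous_apply (f := fun h : ℝ => ((t - (s + h) : ℝ) : ℂ) * ω)
          (u := fun _ => x) (by fun_prop) continuous_const).tendsto 0
        rw [add_zero] at this
        exact this.mono_left nhdsWithin_le_nhds
      have h1 := hP.tendsto_slope_dyson_sub A ω
        (nhdsWithin_mono _ fun x hx => (ne_of_gt hx : x ≠ 0)) hy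
      have h2 := ((dyson P A (s * ω)).continuous.tendsto _).comp h1
      rw [map_smul] at h2
      refine h2.congr' ?_
      filter_upwards [Ioo_mem_nhdsGT (sub_pos.2 hs.2)] with h hh
      have e : ((t - s : ℝ) : ℂ) * ω = h * ω + ((t - (s + h) : ℝ) : ℂ) * ω := by push_cast; ring
      rw [hmul _ _ hs.1.le hh.1.le, e,
        hP.at_add _ _ (hre h hh.1.le) (hre _ (by linarith [hh.2]))]
      simp only [Function.comp, ContinuousLinearMap.comp_apply, map_smul, map_sub])
    ((hc'.const_smul ω).intervalIntegrable _ _)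
  rw [intervalIntegral.integral_smul] at h
  rw [h]
  simp [hP.at_zero, hP.dyson_zero]

end IsHalfPlaneSemigroup

end Generators

/-! ### Holomorphy of the Dyson series -/

section Holomorphy

theorem ContinuousLinearMap.circleIntegral_comp_comm {E F : Type*} [NormedAddCommGroup E]
    [NormedSpace ℂ E] [CompleteSpace E] [NormedAddCommGroup F] [NormedSpace ℂ F] [CompleteSpace F]
    (L : E →L[ℂ] F) {f : ℂ → E} {c : ℂ} {R : ℝ} (hf : CircleIntegrable f c R) :
    ∮ z in C(c, R), L (f z) = L (∮ z in C(c, R), f z) := by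
  simp only [circleIntegral, ← map_smul]
  exact L.intervalIntegral_comp_comm hf.out

/-- An operator-valued function that is weakly holomorphic and locally bounded is holomorphic in
the operator norm: by the Schwarz lemma it is norm-continuous, hence equal to its Cauchy
integral. -/
theorem differentiableOn_of_weakly_differentiableOn {H : Type*} [NormedAddCommGroup H]
    [InnerProductSpace ℂ H] [CompleteSpace H] {f : ℂ → H →L[ℂ] H} {U : Set ℂ} (hU : IsOpen U)
    {M : ℂ → ℝ} (hM : Continuous M) (hfM : ∀ z ∈ U, ‖f z‖ ≤ M z)
    (hf : ∀ x y : H, DifferentiableOn ℂ (fun z => inner ℂ y (f z x)) U) :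
    DifferentiableOn ℂ f U := by
  intro z₀ hz₀
  obtain ⟨r, hr, hrU⟩ := Metric.isOpen_iff.1 hU z₀ hz₀
  obtain ⟨R, hR⟩ := (isCompact_closedBall z₀ r).exists_bound_of_continuousOn hM.continuousOn
  have hRf : ∀ z ∈ Metric.ball z₀ r, ‖f z‖ ≤ R := fun z hz =>
    (hfM z (hrU hz)).trans ((le_abs_self _).trans (hR z (Metric.ball_subset_closedBall hz)))
  have hR0 : 0 ≤ R := (norm_nonneg _).trans (hRf z₀ (Metric.mem_ball_self hr))
  have hlip : ∀ w ∈ Metric.ball z₀ (r / 2), ∀ z ∈ Metric.ball w (r / 2),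
      ‖f z - f w‖ ≤ 2 * R / (r / 2) * dist z w := by
    intro w hw z hz
    have hsub : Metric.ball w (r / 2) ⊆ Metric.ball z₀ r := by
      refine Metric.ball_subset_ball' ?_
      rw [Metric.mem_ball] at hw
      linarith
    refine ContinuousLinearMap.opNorm_le_of_re_inner_le (𝕜 := ℂ) (by positivity)
      fun x y hx hy => ?_
    have hd := Complex.dist_le_div_mul_dist_of_mapsTo_ball (f := fun z => inner ℂ y (f z x))
      (c := w) (z := z) (R₁ := r / 2) (R₂ := 2 * R) ((hf x y).mono (hsub.trans hrU))
      (fun u hu => by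
        rw [Metric.mem_closedBall, dist_eq_norm, ← inner_sub_right, ← sub_apply]
        refine (norm_inner_le_norm _ _).trans ?_
        rw [hy, one_mul]
        refine ((f u - f w).le_opNorm x).trans ?_
        rw [hx, mul_one]
        refine (norm_sub_le _ _).trans ?_
        have h1 := hRf u (hsub hu)
        have h2 := hRf w (hsub (Metric.mem_ball_self (by positivity)))
        linarith) hz
    rw [dist_eq_norm, ← inner_sub_right, ← sub_apply] at hd
    refine le_trans ?_ hd
    rw [← inner_conj_symm, RCLike.conj_re]
    exact RCLike.re_le_norm _
  have hcont : ContinuousOn f (Metric.ball z₀ (r / 2)) := by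
    intro w hw
    refine ContinuousAt.continuousWithinAt ?_
    rw [ContinuousAt, tendsto_iff_norm_sub_tendsto_zero]
    have h0 : Tendsto (fun z => 2 * R / (r / 2) * dist z w) (𝓝 w) (𝓝 0) := by
      have : Tendsto (fun z => 2 * R / (r / 2) * dist z w) (𝓝 w)
          (𝓝 (2 * R / (r / 2) * dist w w)) := Continuous.tendsto (by fun_prop) w
      simpa using this
    refine squeeze_zero' (Eventually.of_forall fun _ => norm_nonneg _) ?_ h0
    filter_upwards [Metric.ball_mem_nhds w (half_pos hr)] with z hz
    exact hlip w hw z hz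
  -- the Cauchy integral over a circle inside the ball on which `f` is continuous
  lift r / 4 to ℝ≥0 using by positivity with ρ hρ
  have hρ0 : 0 < ρ := by
    rw [← NNReal.coe_pos, hρ]
    positivity
  have hρr : (ρ : ℝ) < r / 2 := by
    rw [hρ]
    linarith
  have hci : CircleIntegrable f z₀ ρ :=
    (hcont.mono fun z hz => by
      rw [mem_sphere_iff_norm] at hz
      rw [mem_ball_iff_norm, hz]
      exact hρr).circleIntegrable ρ.2
  have hF := hasFPowerSeriesOn_cauchy_integral hci hρ0
  have heq : ∀ w ∈ Metric.ball z₀ (ρ : ℝ),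
      (2 * π * Complex.I : ℂ)⁻¹ • ∮ z in C(z₀, ρ), (z - w)⁻¹ • f z = f w := by
    intro w hw
    have hwi : CircleIntegrable (fun z => (z - w)⁻¹ • f z) z₀ ρ := by
      refine ContinuousOn.circleIntegrable ρ.2 (ContinuousOn.fun_smul ?_ (hcont.mono fun z hz => by
        rw [mem_sphere_iff_norm] at hz
        rw [mem_ball_iff_norm, hz]
        exact hρr))
      refine ContinuousOn.inv₀ (by fun_prop) fun z hz h => ?_
      rw [sub_eq_zero] at h
      rw [Metric.mem_sphere, h] at hz
      rw [Metric.mem_ball, hz] at hw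
      exact lt_irrefl _ hw
    refine ContinuousLinearMap.ext fun x => ext_inner_left ℂ fun y => ?_
    have hdc : DiffContOnCl ℂ (fun z => inner ℂ y (f z x)) (Metric.ball z₀ ρ) := by
      refine ((hf x y).mono fun z hz => hrU ?_).diffContOnCl
      rw [closure_ball _ (by positivity)] at hz
      rw [Metric.mem_closedBall] at hz
      rw [Metric.mem_ball]
      linarith
    have hC := hdc.circleIntegral_sub_inv_smul hw
    set L : (H →L[ℂ] H) →L[ℂ] ℂ := (innerSL ℂ y).comp (ContinuousLinearMap.apply ℂ H x) with hL
    have hLapp : ∀ T : H →L[ℂ] H, L T = inner ℂ y (T x) := fun T => rfl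
    rw [← hLapp, ← hLapp, map_smul, ← L.circleIntegral_comp_comm hwi]
    simp only [map_smul]
    simp only [hLapp]
    rw [hC, inv_smul_smul₀ Complex.two_pi_I_ne_zero]
  refine (hF.differentiableOn.differentiableAt (x := z₀)
    (Metric.eball_mem_nhds _ (by simpa using hρ0))).congr_of_eventuallyEq ?_
    |>.differentiableWithinAt
  filter_upwards [Metric.ball_mem_nhds z₀ (NNReal.coe_pos.2 hρ0)] with w hw
  exact (heq w hw).symm

/-- Integrals of holomorphic functions depending continuously on a parameter are holomorphic. -/
theorem differentiableOn_integral_of_continuous_of_differentiableOn {E : Type*}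
    [NormedAddCommGroup E] [NormedSpace ℂ E] [CompleteSpace E] {F : ℂ → ℝ → E} {U : Set ℂ}
    (hU : IsOpen U) (hc : Continuous (Function.uncurry F))
    (hF : ∀ r ∈ Ioo (0 : ℝ) 1, DifferentiableOn ℂ (fun z => F z r) U) :
    DifferentiableOn ℂ (fun z => ∫ r in (0 : ℝ)..1, F z r) U := by
  intro z₀ hz₀
  obtain ⟨δ, hδ, hδU⟩ := Metric.isOpen_iff.1 hU z₀ hz₀
  obtain ⟨M, hM⟩ := ((isCompact_closedBall z₀ δ).prod (isCompact_Icc (a := (0 : ℝ)) (b := 1)))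
    |>.exists_bound_of_continuousOn hc.continuousOn
  have hae : ∀ᵐ r : ℝ, r ∈ uIoc (0 : ℝ) 1 → r ∈ Ioo (0 : ℝ) 1 := by
    have h1 : ∀ᵐ r : ℝ, r ≠ 1 := by simp [ae_iff]
    filter_upwards [h1] with r hr h
    rw [uIoc_of_le zero_le_one] at h
    exact ⟨h.1, lt_of_le_of_ne h.2 hr⟩
  have hFc : ∀ z, Continuous (F z) := fun z => hc.comp (by fun_prop : Continuous fun r => (z, r))
  have hdiff : ∀ r ∈ Ioo (0 : ℝ) 1, ∀ z ∈ Metric.ball z₀ (δ / 2),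
      HasDerivAt (fun z => F z r) (deriv (fun z => F z r) z) z := fun r hr z hz =>
    ((hF r hr).differentiableAt (hU.mem_nhds (hδU (Metric.ball_subset_ball (by linarith) hz))))
      |>.hasDerivAt
  have hbd : ∀ r ∈ Ioo (0 : ℝ) 1, ∀ z ∈ Metric.ball z₀ (δ / 2),
      ‖deriv (fun z => F z r) z‖ ≤ M / (δ / 4) := by
    intro r hr z hz
    have hsub : Metric.closedBall z (δ / 4) ⊆ Metric.ball z₀ δ := by
      refine Metric.closedBall_subset_ball' ?_
      rw [Metric.mem_ball] at hz
      linarith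
    refine Complex.norm_deriv_le_of_forall_mem_sphere_norm_le (by positivity) ?_ fun w hw => ?_
    · refine ((hF r hr).mono ?_).diffContOnCl
      rw [closure_ball _ (by positivity)]
      exact hsub.trans hδU
    · exact hM (w, r) ⟨Metric.ball_subset_closedBall (hsub (Metric.sphere_subset_closedBall hw)),
        Ioo_subset_Icc_self hr⟩
  have hmeas : AEStronglyMeasurable (fun r => deriv (fun z => F z r) z₀)
      (volume.restrict (uIoc (0 : ℝ) 1)) := by
    refine aestronglyMeasurable_of_tendsto_ae atTop
      (f := fun (n : ℕ) r => ((1 : ℂ) / ((n : ℂ) + 1))⁻¹ • (F (z₀ + 1 / ((n : ℂ) + 1)) r - F z₀ r))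
      (fun n => ((hFc _).sub (hFc _)).const_smul _ |>.aestronglyMeasurable) ?_
    rw [ae_restrict_iff' measurableSet_uIoc]
    filter_upwards [hae] with r hr hr'
    have h := hasDerivAt_iff_tendsto_slope_zero.1
      (hdiff r (hr hr') z₀ (Metric.mem_ball_self (half_pos hδ)))
    refine h.comp (tendsto_nhdsWithin_iff.2
      ⟨tendsto_one_div_add_atTop_nhds_zero_nat (𝕜 := ℂ), Eventually.of_forall fun n => ?_⟩)
    have : ((n : ℂ) + 1) ≠ 0 := Nat.cast_add_one_ne_zero n
    simpa using this
  exact (intervalIntegral.hasDerivAt_integral_of_dominated_loc_of_deriv_le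
    (Metric.ball_mem_nhds z₀ (half_pos hδ))
    (Eventually.of_forall fun z => (hFc z).aestronglyMeasurable)
    ((hFc z₀).intervalIntegrable _ _) hmeas
    (hae.mono fun r hr hr' z hz => hbd r (hr hr') z hz) intervalIntegrable_const
    (hae.mono fun r hr hr' z hz => hdiff r (hr hr') z hz)).2.differentiableAt
    |>.differentiableWithinAt

variable {H : Type*} [NormedAddCommGroup H] [InnerProductSpace ℂ H] [CompleteSpace H]
  {P : ℂ → H →L[ℂ] H}

theorem isOpen_re_pos : IsOpen {z : ℂ | 0 < z.re} :=
  isOpen_lt continuous_const Complex.continuous_re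

namespace IsHalfPlaneSemigroup

theorem differentiableOn_dysonTerm (hP : IsHalfPlaneSemigroup P)
    (hPd : DifferentiableOn ℂ P {z | 0 < z.re}) (A : H →L[ℂ] H) (m : ℕ) (x : H) :
    DifferentiableOn ℂ (fun z => dysonTerm P A m z x) {z | 0 < z.re} := by
  induction m with
  | zero => exact hPd.clm_apply (differentiableOn_const x)
  | succ m ih =>
    refine differentiableOn_id.smul
      (differentiableOn_integral_of_continuous_of_differentiableOn isOpen_re_pos ?_ fun r hr => ?_)
    · exact hP.continuous_apply (by fun_prop)
        (A.continuous.comp ((hP.continuous_dysonTerm A m x).comp (by fun_prop)))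
    · refine DifferentiableOn.clm_apply (hPd.comp (by fun_prop) fun z hz => ?_)
        (A.differentiable.comp_differentiableOn (ih.comp (by fun_prop) fun z hz => ?_))
      · rw [mem_ofPred_eq, Complex.re_ofReal_mul]
        exact mul_pos (by linarith [hr.2]) hz
      · rw [mem_ofPred_eq, Complex.re_ofReal_mul]
        exact mul_pos hr.1 hz

theorem differentiableOn_dyson (hP : IsHalfPlaneSemigroup P)
    (hPd : DifferentiableOn ℂ P {z | 0 < z.re}) (A : H →L[ℂ] H) :
    DifferentiableOn ℂ (dyson P A) {z | 0 < z.re} := by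
  refine differentiableOn_of_weakly_differentiableOn isOpen_re_pos
    (M := fun z => Real.exp (‖z‖ * ‖A‖)) (by fun_prop) (fun z _ => hP.norm_dyson_le A z)
    fun x y => ?_
  refine (innerSL ℂ y).differentiable.comp_differentiableOn (f := fun z => dyson P A z x) ?_
  simp only [hP.dyson_apply]
  intro z₀ hz₀
  have hs : Summable fun m : ℕ => ((‖z₀‖ + 1) * ‖A‖) ^ m / m.factorial * ‖x‖ :=
    (Real.summable_pow_div_factorial _).mul_right _
  have hopen : IsOpen ({z : ℂ | 0 < z.re} ∩ Metric.ball z₀ 1) :=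
    isOpen_re_pos.inter Metric.isOpen_ball
  refine ((Complex.differentiableOn_tsum_of_summable_norm hs
    (fun m => (hP.differentiableOn_dysonTerm hPd A m x).mono inter_subset_left) hopen
    fun m w hw => ?_).differentiableAt
      (hopen.mem_nhds ⟨hz₀, Metric.mem_ball_self one_pos⟩)).differentiableWithinAt
  refine (hP.norm_dysonTerm_le A m w x).trans ?_
  have hw' := norm_le_norm_add_norm_sub' w z₀
  have hw2 := hw.2
  rw [Metric.mem_ball, dist_eq_norm] at hw2
  gcongr
  linarith

end IsHalfPlaneSemigroup

end Holomorphy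

/-! ### The disentangled exponential as a Dyson series -/

section Simplex

variable {H : Type*} [NormedAddCommGroup H] [NormedSpace ℂ H]

theorem measurableSet_timeSimplex (m : ℕ) (t : ℝ) : MeasurableSet (timeSimplex m t) := by
  have h : timeSimplex m t =
      (⋂ i : Fin m, ⋂ j : Fin m, ⋂ _ : i < j, {s : Fin m → ℝ | s i < s j}) ∩
        ⋂ i : Fin m, {s : Fin m → ℝ | s i ∈ Ioo 0 t} := by
    ext s
    simp [timeSimplex, StrictMono]
  rw [h]
  refine MeasurableSet.inter ?_ ?_
  · exact MeasurableSet.iInter fun i => MeasurableSet.iInter fun j => MeasurableSet.iInter fun _ =>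
      measurableSet_lt (measurable_pi_apply i) (measurable_pi_apply j)
  · exact MeasurableSet.iInter fun i => measurable_pi_apply i measurableSet_Ioo

theorem volume_timeSimplex_lt_top (m : ℕ) (t : ℝ) : volume (timeSimplex m t) < ∞ := by
  have h : timeSimplex m t ⊆ Set.pi univ fun _ => Icc 0 t := fun s hs i _ =>
    Ioo_subset_Icc_self (hs.2 i)
  exact (measure_mono h).trans_lt
    (isCompact_univ_pi fun _ : Fin m => isCompact_Icc (a := (0 : ℝ)) (b := t)).measure_lt_top

theorem mem_timeSimplex_succ_iff {m : ℕ} {t : ℝ} {s : Fin (m + 1) → ℝ} :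
    s ∈ timeSimplex (m + 1) t ↔
      s (Fin.last m) ∈ Ioo 0 t ∧ (fun i => s i.castSucc) ∈ timeSimplex m (s (Fin.last m)) := by
  constructor
  · rintro ⟨h1, h2⟩
    exact ⟨h2 _, fun i j hij => h1 (Fin.castSucc_lt_castSucc_iff.2 hij),
      fun i => ⟨(h2 _).1, h1 (Fin.castSucc_lt_last i)⟩⟩
  · rintro ⟨h1, h2, h3⟩
    refine ⟨fun i j hij => ?_, fun i => ?_⟩
    · induction j using Fin.lastCases with
      | last =>
        obtain ⟨i', rfl⟩ := Fin.exists_castSucc_eq.2 hij.ne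
        exact (h3 i').2
      | cast j =>
        obtain ⟨i', rfl⟩ := Fin.exists_castSucc_eq.2 (hij.trans (Fin.castSucc_lt_last j)).ne
        exact h2 (Fin.castSucc_lt_castSucc_iff.1 hij)
    · induction i using Fin.lastCases with
      | last => exact h1
      | cast i => exact ⟨(h3 i).1, (h3 i).2.trans h1.2⟩

theorem timeOrderedProduct_congr {S S' : ℝ → H →L[ℂ] H} (A : ℝ → H →L[ℂ] H)
    (h : ∀ t, 0 ≤ t → S t = S' t) (m : ℕ) {t : ℝ} (ht : 0 ≤ t) {s : Fin m → ℝ}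
    (hs : s ∈ timeSimplex m t) : timeOrderedProduct S A m s t = timeOrderedProduct S' A m s t := by
  induction m generalizing t with
  | zero => exact h t ht
  | succ m ih =>
    obtain ⟨h1, h2⟩ := mem_timeSimplex_succ_iff.1 hs
    simp only [timeOrderedProduct, h _ (sub_nonneg.2 h1.2.le), ih h1.1.le h2]

variable {P : ℂ → H →L[ℂ] H}

namespace IsHalfPlaneSemigroup

theorem continuous_timeOrderedProduct (hP : IsHalfPlaneSemigroup P) (ω : ℂ) (A : H →L[ℂ] H) (m : ℕ)
    (ψ : H) : Continuous fun p : (Fin m → ℝ) × ℝ =>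
      timeOrderedProduct (fun t => P (t * ω)) (fun _ => A) m p.1 p.2 ψ := by
  induction m with
  | zero => exact hP.continuous_apply (by fun_prop) continuous_const
  | succ m ih =>
    refine hP.continuous_apply (by fun_prop) (A.continuous.comp ?_)
    exact ih.comp (by fun_prop : Continuous fun p : (Fin (m + 1) → ℝ) × ℝ =>
      ((fun i : Fin m => p.1 i.castSucc), p.1 (Fin.last m)))

theorem norm_timeOrderedProduct_le (hP : IsHalfPlaneSemigroup P) (ω : ℂ) (A : H →L[ℂ] H) (m : ℕ)
    (s : Fin m → ℝ) (t : ℝ) (ψ : H) :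
    ‖timeOrderedProduct (fun t => P (t * ω)) (fun _ => A) m s t ψ‖ ≤ ‖A‖ ^ m * ‖ψ‖ := by
  induction m generalizing t with
  | zero => simpa [timeOrderedProduct] using hP.norm_apply_le (t * ω) ψ
  | succ m ih =>
    refine (hP.norm_apply_le _ _).trans ((A.le_opNorm _).trans ?_)
    rw [pow_succ', mul_assoc]
    gcongr
    exact ih _ _

theorem integrableOn_timeOrderedProduct (hP : IsHalfPlaneSemigroup P) (ω : ℂ) (A : H →L[ℂ] H)
    (m : ℕ) (t : ℝ) (ψ : H) : IntegrableOn (fun s =>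
      timeOrderedProduct (fun t => P (t * ω)) (fun _ => A) m s t ψ) (timeSimplex m t) := by
  refine Measure.integrableOn_of_bounded (volume_timeSimplex_lt_top m t).ne
    (Continuous.aestronglyMeasurable ?_)
    (ae_of_all _ fun s => hP.norm_timeOrderedProduct_le ω A m s t ψ)
  exact (hP.continuous_timeOrderedProduct ω A m ψ).comp
    (by fun_prop : Continuous fun s : Fin m → ℝ => (s, t))

variable [CompleteSpace H]

/-- Integrating out the largest time of the simplex gives the recursion of the Dyson series. -/
theorem integral_timeOrderedProduct (hP : IsHalfPlaneSemigroup P) (ω c : ℂ) (A : H →L[ℂ] H)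
    (m : ℕ) {t : ℝ} (ht : 0 ≤ t) (ψ : H) :
    ∫ s in timeSimplex m t, timeOrderedProduct (fun t => P (t * ω)) (fun _ => c • ω • A) m s t ψ =
      c ^ m • dysonTerm P A m (t * ω) ψ := by
  induction m generalizing t with
  | zero =>
    have h : timeSimplex 0 t = univ := by
      ext s
      simp [timeSimplex, Subsingleton.strictMono]
    simp [h, timeOrderedProduct, dysonTerm, volume_pi, Measure.real]
  | succ m ih =>
    set Q : ℝ → H →L[ℂ] H := fun t => P (t * ω) with hQ
    set e := MeasurableEquiv.piFinSuccAbove (fun _ : Fin (m + 1) => ℝ) (Fin.last m) with he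
    have hmp : MeasurePreserving e volume volume :=
      volume_preserving_piFinSuccAbove (fun _ => ℝ) (Fin.last m)
    have hes : ∀ s, e s = (s (Fin.last m), fun i : Fin m => s i.castSucc) := by
      intro s
      simp only [he, MeasurableEquiv.piFinSuccAbove_apply, Fin.insertNthEquiv_last]
      rfl
    set T : Set (ℝ × (Fin m → ℝ)) := {p | p.1 ∈ Ioo 0 t ∧ p.2 ∈ timeSimplex m p.1} with hT
    have hpre : e ⁻¹' T = timeSimplex (m + 1) t := by
      ext s
      rw [mem_timeSimplex_succ_iff, mem_preimage, hes]
      rfl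
    set G : ℝ × (Fin m → ℝ) → H := fun p =>
      Q (t - p.1) ((c • ω • A) (timeOrderedProduct Q (fun _ => c • ω • A) m p.2 p.1 ψ)) with hG
    have hTm : MeasurableSet T := by
      rw [← e.measurableSet_preimage, hpre]
      exact measurableSet_timeSimplex _ _
    have h1 : ∫ s in timeSimplex (m + 1) t,
        timeOrderedProduct Q (fun _ => c • ω • A) (m + 1) s t ψ = ∫ p in T, G p := by
      rw [← hpre, ← hmp.setIntegral_preimage_emb e.measurableEmbedding]
      refine setIntegral_congr_fun (hpre ▸ measurableSet_timeSimplex _ _) fun s _ => ?_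
      simp only [hG, hes]
      rfl
    have hint : IntegrableOn G T := by
      rw [← hmp.integrableOn_comp_preimage e.measurableEmbedding, hpre]
      refine (hP.integrableOn_timeOrderedProduct ω (c • ω • A) (m + 1) t ψ).congr_fun
        (fun s _ => ?_) (measurableSet_timeSimplex _ _)
      simp only [Function.comp, hG, hes]
      rfl
    have hc : Continuous fun r : ℝ => P ((t - r : ℝ) * ω) (A (dysonTerm P A m (r * ω) ψ)) :=
      hP.continuous_apply (by fun_prop)
        (A.continuous.comp ((hP.continuous_dysonTerm A m ψ).comp (by fun_prop)))
    rw [h1, ← integral_indicator hTm, Measure.volume_eq_prod,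
      integral_prod _ ((integrable_indicator_iff hTm).2 hint)]
    have h2 : ∀ r, ∫ s, T.indicator G (r, s) = (Ioo 0 t).indicator
        (fun r => c ^ (m + 1) • ω • P ((t - r : ℝ) * ω) (A (dysonTerm P A m (r * ω) ψ))) r := by
      intro r
      by_cases hr : r ∈ Ioo 0 t
      · have hind : (fun s => T.indicator G (r, s)) =
            (timeSimplex m r).indicator fun s => G (r, s) := by
          funext s
          by_cases hs : s ∈ timeSimplex m r
          · rw [indicator_of_mem hs, indicator_of_mem (show (r, s) ∈ T from ⟨hr, hs⟩)]
          · rw [indicator_of_notMem hs, indicator_of_notMem fun h => hs h.2]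
        rw [hind, integral_indicator (measurableSet_timeSimplex _ _), indicator_of_mem hr]
        have h3 := ((Q (t - r)).comp (c • ω • A)).integral_comp_comm
          (hP.integrableOn_timeOrderedProduct ω (c • ω • A) m r ψ)
        rw [ih hr.1.le] at h3
        refine h3.trans ?_
        simp only [hQ, ContinuousLinearMap.comp_apply, _root_.smul_apply, map_smul, smul_smul]
        congr 1
        ring
      · rw [indicator_of_notMem hr]
        have : ∀ s, T.indicator G (r, s) = 0 := fun s => indicator_of_notMem (fun h => hr h.1) _
        simp [this]
    simp only [h2]
    rw [integral_indicator measurableSet_Ioo, ← integral_Ioc_eq_integral_Ioo,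
      ← intervalIntegral.integral_of_le ht, intervalIntegral.integral_smul,
      intervalIntegral.integral_smul, dysonTerm_succ_ray]

end IsHalfPlaneSemigroup

end Simplex

/-! ### The contour integral of the reduced disentangling -/

section Contour

theorem gFun_eq {ξ : ℂ} (h : ξ ≠ 1) : gFun ξ = (1 - ξ)⁻¹ := by
  have h' : 1 - ξ ≠ 0 := sub_ne_zero.2 h.symm
  simp only [gFun, gOne]
  field_simp
  ring

variable {ρ : ℝ}

theorem ne_one_of_mem_closedBall (hρ1 : ρ < 1) {ξ : ℂ} (h : ξ ∈ Metric.closedBall (0 : ℂ) ρ) :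
    ξ ≠ 1 := by
  rintro rfl
  simp at h
  linarith

theorem continuousOn_gFun (hρ1 : ρ < 1) : ContinuousOn gFun (Metric.closedBall (0 : ℂ) ρ) := by
  refine ContinuousOn.congr (f := fun ξ => (1 - ξ)⁻¹) ?_ fun ξ hξ =>
    gFun_eq (ne_one_of_mem_closedBall hρ1 hξ)
  exact ContinuousOn.inv₀ (by fun_prop) fun ξ hξ =>
    sub_ne_zero.2 (ne_one_of_mem_closedBall hρ1 hξ).symm

/-- All Taylor coefficients of `g` at zero equal one, in Cauchy's integral form. -/
theorem circleIntegral_gFun (hρ0 : 0 < ρ) (hρ1 : ρ < 1) (m : ℕ) :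
    ∮ ξ in C(0, ρ), gFun ξ * ξ⁻¹ * ξ⁻¹ ^ m = 2 * π * Complex.I := by
  have hd : DiffContOnCl ℂ (fun ξ : ℂ => (1 - ξ)⁻¹) (Metric.ball 0 ρ) := by
    refine DifferentiableOn.diffContOnCl ?_
    rw [closure_ball _ hρ0.ne']
    exact DifferentiableOn.inv (by fun_prop) fun ξ hξ =>
      sub_ne_zero.2 (ne_one_of_mem_closedBall hρ1 hξ).symm
  have hne : ∀ ξ ∈ Metric.sphere (0 : ℂ) ρ, ξ ≠ 0 := fun ξ hξ => by
    rintro rfl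
    simp at hξ
    exact hρ0.ne hξ
  have hne1 : ∀ ξ ∈ Metric.sphere (0 : ℂ) ρ, ξ ≠ 1 := fun ξ hξ =>
    ne_one_of_mem_closedBall hρ1 (Metric.sphere_subset_closedBall hξ)
  have hg : ∀ k : ℕ, ∮ ξ in C(0, ρ), gFun ξ * ξ⁻¹ * ξ⁻¹ ^ k =
      ∮ ξ in C(0, ρ), (1 - ξ)⁻¹ * ξ⁻¹ ^ (k + 1) := fun k =>
    circleIntegral.integral_congr hρ0.le fun ξ hξ => by
      simp only [gFun_eq (hne1 ξ hξ)]
      ring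
  rw [hg]
  induction m with
  | zero =>
    have h := hd.circleIntegral_sub_inv_smul (Metric.mem_ball_self hρ0)
    simp only [sub_zero, inv_one, smul_eq_mul, mul_one] at h
    rw [← h]
    refine circleIntegral.integral_congr hρ0.le fun ξ _ => ?_
    rw [zero_add, pow_one, mul_comm]
  | succ m ih =>
    -- `1 / ((1 - ξ) ξ ^ (m + 2)) = 1 / ξ ^ (m + 2) + 1 / ((1 - ξ) ξ ^ (m + 1))`
    have hsplit : ∮ ξ in C(0, ρ), (1 - ξ)⁻¹ * ξ⁻¹ ^ (m + 1 + 1) =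
        ∮ ξ in C(0, ρ), ((ξ - 0) ^ (-(m + 2 : ℤ)) + (1 - ξ)⁻¹ * ξ⁻¹ ^ (m + 1)) := by
      refine circleIntegral.integral_congr hρ0.le fun ξ hξ => ?_
      have h0 := hne ξ hξ
      have h1 : 1 - ξ ≠ 0 := sub_ne_zero.2 (hne1 ξ hξ).symm
      simp only [sub_zero]
      rw [show (m + 2 : ℤ) = ((m + 2 : ℕ) : ℤ) by push_cast; ring, zpow_neg, zpow_natCast,
        inv_pow, inv_pow]
      field_simp
      ring
    rw [hsplit, circleIntegral.integral_add, ih,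
      circleIntegral.integral_sub_zpow_of_ne (by omega), zero_add]
    · refine ContinuousOn.circleIntegrable hρ0.le
        (ContinuousOn.zpow₀ (by fun_prop) _ fun ξ hξ => ?_)
      exact Or.inl (by simpa using hne ξ hξ)
    · refine ContinuousOn.circleIntegrable hρ0.le (ContinuousOn.mul ?_ ?_)
      · exact ContinuousOn.inv₀ (by fun_prop) fun ξ hξ => sub_ne_zero.2 (hne1 ξ hξ).symm
      · exact (ContinuousOn.inv₀ continuousOn_id hne).pow _

variable {H : Type*} [NormedAddCommGroup H] [NormedSpace ℂ H]
  {P : ℂ → H →L[ℂ] H}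

namespace IsHalfPlaneSemigroup

theorem norm_smul_dysonTerm_le (hP : IsHalfPlaneSemigroup P) (A : H →L[ℂ] H) (z : ℂ) (ψ : H)
    {ξ : ℂ} (hξ : ξ ∈ Metric.sphere (0 : ℂ) ρ) (m : ℕ) :
    ‖ξ⁻¹ ^ m • dysonTerm P A m z ψ‖ ≤ (ρ⁻¹ * (‖z‖ * ‖A‖)) ^ m / m.factorial * ‖ψ‖ := by
  rw [mem_sphere_zero_iff_norm] at hξ
  have h0 : 0 ≤ ρ := hξ ▸ norm_nonneg ξ
  rw [norm_smul, norm_pow, norm_inv, hξ]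
  refine (mul_le_mul_of_nonneg_left (hP.norm_dysonTerm_le A m z ψ) (by positivity)).trans_eq ?_
  rw [mul_pow ρ⁻¹]
  ring

variable [CompleteSpace H]

theorem disentangledTerm_eq (hP : IsHalfPlaneSemigroup P) {ω : ℂ} {B : H →ₗ.[ℂ] H}
    (hB : ∀ t, 0 ≤ t → c0Semigroup B t = P (t * ω)) (A : H →L[ℂ] H) (c : ℂ) (m : ℕ) {t : ℝ}
    (ht : 0 ≤ t) (ψ : H) :
    disentangledTerm B (fun _ => c • ω • A) m t ψ = c ^ m • dysonTerm P A m (t * ω) ψ := by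
  rw [← hP.integral_timeOrderedProduct ω c A m ht ψ, disentangledTerm]
  refine setIntegral_congr_fun (measurableSet_timeSimplex m t) fun s hs => ?_
  simp only [timeOrderedProduct_congr (fun _ => c • ω • A) hB m ht hs]

theorem disentangledExp_eq (hP : IsHalfPlaneSemigroup P) {ω : ℂ} {B : H →ₗ.[ℂ] H}
    (hB : ∀ t, 0 ≤ t → c0Semigroup B t = P (t * ω)) (A : H →L[ℂ] H) (c : ℂ) {t : ℝ}
    (ht : 0 ≤ t) (ψ : H) :
    disentangledExp B (fun _ => c • ω • A) t ψ = ∑' m, c ^ m • dysonTerm P A m (t * ω) ψ := by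
  simp only [disentangledExp, hP.disentangledTerm_eq hB A c _ ht]

theorem continuousOn_tsum_smul_dysonTerm (hP : IsHalfPlaneSemigroup P) (A : H →L[ℂ] H) (z : ℂ)
    (ψ : H) (hρ0 : 0 < ρ) :
    ContinuousOn (fun ξ : ℂ => ∑' m, ξ⁻¹ ^ m • dysonTerm P A m z ψ) (Metric.sphere 0 ρ) := by
  have hs : Summable fun m : ℕ => (ρ⁻¹ * (‖z‖ * ‖A‖)) ^ m / m.factorial * ‖ψ‖ :=
    (Real.summable_pow_div_factorial _).mul_right _
  refine continuousOn_tsum (fun m => ContinuousOn.fun_smul (ContinuousOn.pow ?_ m)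
    continuousOn_const) hs fun m ξ hξ => hP.norm_smul_dysonTerm_le A z ψ hξ m
  refine ContinuousOn.inv₀ continuousOn_id fun ξ hξ => ?_
  rw [mem_sphere_zero_iff_norm] at hξ
  exact norm_pos_iff.1 (hξ.symm ▸ hρ0)

theorem reducedDisentanglingConverges (hP : IsHalfPlaneSemigroup P) {ω : ℂ} {B : H →ₗ.[ℂ] H}
    (hB : ∀ t, 0 ≤ t → c0Semigroup B t = P (t * ω)) (A : H →L[ℂ] H) (hρ0 : 0 < ρ) (hρ1 : ρ < 1)
    {t : ℝ} (ht : 0 ≤ t) : ReducedDisentanglingConverges ρ gFun t B (fun _ => ω • A) where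
  integrable ψ m := by
    have h := hP.integrableOn_timeOrderedProduct ω (ω • A) m t ψ
    refine h.congr_fun (fun s hs => ?_) (measurableSet_timeSimplex m t)
    simp only [timeOrderedProduct_congr (fun _ => ω • A) hB m ht hs]
  summable ψ ξ hξ := by
    simp only [hP.disentangledTerm_eq hB A ξ⁻¹ _ ht]
    exact Summable.of_nonneg_of_le (fun _ => norm_nonneg _)
      (fun m => hP.norm_smul_dysonTerm_le A _ ψ hξ m)
      ((Real.summable_pow_div_factorial _).mul_right _)
  circleIntegrable ψ := by
    simp only [hP.disentangledExp_eq hB A _ ht]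
    refine ContinuousOn.circleIntegrable hρ0.le (ContinuousOn.fun_smul (ContinuousOn.fun_mul ?_ ?_)
      (hP.continuousOn_tsum_smul_dysonTerm A _ ψ hρ0))
    · exact (continuousOn_gFun hρ1).mono Metric.sphere_subset_closedBall
    · refine ContinuousOn.inv₀ continuousOn_id fun ξ hξ => ?_
      rw [mem_sphere_zero_iff_norm] at hξ
      exact norm_pos_iff.1 (hξ.symm ▸ hρ0)

/-- Integrating the Dyson series of `ξ⁻¹ A` term by term against `g(ξ) ξ⁻¹` picks every term with
coefficient one. -/
theorem reducedDisentangling_eq (hP : IsHalfPlaneSemigroup P) {ω : ℂ} {B : H →ₗ.[ℂ] H}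
    (hB : ∀ t, 0 ≤ t → c0Semigroup B t = P (t * ω)) (A : H →L[ℂ] H) (hρ0 : 0 < ρ) (hρ1 : ρ < 1)
    {t : ℝ} (ht : 0 ≤ t) (ψ : H) :
    reducedDisentangling ρ gFun t B (fun _ => ω • A) ψ = dyson P A (t * ω) ψ := by
  simp only [reducedDisentangling, hP.disentangledExp_eq hB A _ ht]
  set D : ℕ → H := fun m => dysonTerm P A m (t * ω) ψ with hD
  have hs : ∀ K : ℝ, Summable fun m : ℕ =>
      K * ((ρ⁻¹ * (‖(t : ℂ) * ω‖ * ‖A‖)) ^ m / m.factorial * ‖ψ‖) :=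
    fun K => ((Real.summable_pow_div_factorial _).mul_right _).mul_left K
  have hcg : ContinuousOn (fun ξ : ℂ => gFun ξ * ξ⁻¹) (Metric.sphere 0 ρ) := by
    refine ContinuousOn.mul ((continuousOn_gFun hρ1).mono Metric.sphere_subset_closedBall) ?_
    refine ContinuousOn.inv₀ continuousOn_id fun ξ hξ => ?_
    rw [mem_sphere_zero_iff_norm] at hξ
    exact norm_pos_iff.1 (hξ.symm ▸ hρ0)
  have hcp : ∀ m : ℕ, ContinuousOn (fun ξ : ℂ => ξ⁻¹ ^ m) (Metric.sphere 0 ρ) := by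
    intro m
    refine ContinuousOn.pow (ContinuousOn.inv₀ continuousOn_id fun ξ hξ => ?_) m
    rw [mem_sphere_zero_iff_norm] at hξ
    exact norm_pos_iff.1 (hξ.symm ▸ hρ0)
  obtain ⟨K, hK⟩ := (isCompact_sphere (0 : ℂ) ρ).exists_bound_of_continuousOn hcg
  have hmem : ∀ θ, circleMap 0 ρ θ ∈ Metric.sphere (0 : ℂ) ρ := circleMap_mem_sphere 0 hρ0.le
  have hcm : ∀ {f : ℂ → ℂ}, ContinuousOn f (Metric.sphere 0 ρ) →
      Continuous fun θ => f (circleMap 0 ρ θ) := fun hf =>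
    hf.comp_continuous (continuous_circleMap 0 ρ) hmem
  have hsum : HasSum (fun m => ∮ ξ in C(0, ρ), (gFun ξ * ξ⁻¹) • ξ⁻¹ ^ m • D m)
      (∮ ξ in C(0, ρ), (gFun ξ * ξ⁻¹) • ∑' m, ξ⁻¹ ^ m • D m) := by
    simp only [circleIntegral]
    refine intervalIntegral.hasSum_integral_of_dominated_convergence
      (fun m _ => (|ρ| * K) * ((ρ⁻¹ * (‖(t : ℂ) * ω‖ * ‖A‖)) ^ m / m.factorial * ‖ψ‖))
      (fun m => Continuous.aestronglyMeasurable ?_)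
      (fun m => ae_of_all _ fun θ _ => ?_) (ae_of_all _ fun _ _ => hs _) intervalIntegrable_const
      (ae_of_all _ fun θ _ => ?_)
    · refine Continuous.smul ?_ ((hcm hcg).smul ((hcm (hcp m)).smul continuous_const))
      rw [show deriv (circleMap 0 ρ) = _ from funext fun θ => deriv_circleMap 0 ρ θ]
      exact (continuous_circleMap 0 ρ).mul continuous_const
    · rw [norm_smul, norm_smul, deriv_circleMap, norm_mul, norm_circleMap_zero, Complex.norm_I,
        mul_one, mul_assoc]
      refine mul_le_mul_of_nonneg_left (mul_le_mul (hK _ (hmem θ))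
        (hP.norm_smul_dysonTerm_le A _ ψ (hmem θ) m) (norm_nonneg _) ?_) (abs_nonneg _)
      exact (norm_nonneg _).trans (hK _ (hmem θ))
    · refine (HasSum.const_smul _ (HasSum.const_smul _ (Summable.hasSum ?_)))
      refine Summable.of_norm_bounded (hs 1) fun m => ?_
      rw [one_mul]
      exact hP.norm_smul_dysonTerm_le A _ ψ (hmem θ) m
  rw [← hsum.tsum_eq, ← tsum_const_smul'', hP.dyson_apply]
  refine tsum_congr fun m => ?_
  have h : ∮ ξ in C(0, ρ), (gFun ξ * ξ⁻¹) • ξ⁻¹ ^ m • D m =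
      (∮ ξ in C(0, ρ), gFun ξ * ξ⁻¹ * ξ⁻¹ ^ m) • D m := by
    rw [← circleIntegral.integral_smul_const]
    refine circleIntegral.integral_congr hρ0.le fun ξ _ => ?_
    simp only [smul_smul, mul_assoc]
  rw [h, circleIntegral_gFun hρ0 hρ1, smul_smul, inv_mul_cancel₀ Complex.two_pi_I_ne_zero, one_smul]

end IsHalfPlaneSemigroup

end Contour

/-! ### Convergence and multiplication operators in `L²` -/

section LTwo

variable {α : Type*} {mα : MeasurableSpace α} {μ : Measure α}

theorem norm_sq_eq_integral_norm_sq (u : Lp ℂ 2 μ) : ‖u‖ ^ 2 = ∫ x, ‖u x‖ ^ 2 ∂μ := by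
  have h : ((‖u‖ ^ 2 : ℝ) : ℂ) = ((∫ x, ‖u x‖ ^ 2 ∂μ : ℝ) : ℂ) := by
    rw [← integral_complex_ofReal]
    push_cast
    have h1 := inner_self_eq_norm_sq_to_K (𝕜 := ℂ) u
    rw [L2.inner_def] at h1
    simp only [inner_self_eq_norm_sq_to_K] at h1
    exact h1.symm
  exact_mod_cast h

theorem integrable_norm_sq_coeFn (u : Lp ℂ 2 μ) : Integrable (fun x => ‖u x‖ ^ 2) μ :=
  (Lp.memLp u).integrable_norm_pow (p := 2) two_ne_zero

/-- Dominated convergence in `L²`, for a family indexed by an arbitrary countably generated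
filter; the members are given by explicit representatives `f i`. -/
theorem tendsto_Lp_two_of_dominated {ι : Type*} {l : Filter ι} [l.IsCountablyGenerated]
    {u : ι → Lp ℂ 2 μ} {u₀ g : Lp ℂ 2 μ} {f : ι → α → ℂ} {f₀ : α → ℂ} (hu : ∀ i, u i =ᵐ[μ] f i)
    (hu₀ : u₀ =ᵐ[μ] f₀) (hg : ∀ᶠ i in l, ∀ᵐ x ∂μ, ‖f i x‖ ≤ ‖g x‖)
    (hlim : ∀ᵐ x ∂μ, Tendsto (fun i => f i x) l (𝓝 (f₀ x))) : Tendsto u l (𝓝 u₀) := by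
  rw [tendsto_iff_norm_sub_tendsto_zero]
  have h0 : Tendsto (fun i => ∫ x, ‖f i x - f₀ x‖ ^ 2 ∂μ) l (𝓝 (∫ _, (0 : ℝ) ∂μ)) := by
    refine tendsto_integral_filter_of_dominated_convergence
      (fun x => 2 * (‖g x‖ ^ 2 + ‖u₀ x‖ ^ 2)) (Eventually.of_forall fun i => ?_) ?_
      (((integrable_norm_sq_coeFn g).add (integrable_norm_sq_coeFn u₀)).const_mul 2) ?_
    · exact ((((Lp.aestronglyMeasurable (u i)).congr (hu i)).sub
        ((Lp.aestronglyMeasurable u₀).congr hu₀)).norm.pow 2)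
    · filter_upwards [hg] with i hi
      filter_upwards [hi, hu₀] with x hx hx₀
      rw [Real.norm_of_nonneg (by positivity), ← hx₀]
      have h1 := norm_sub_le (f i x) (u₀ x)
      have h2 : ‖f i x - u₀ x‖ ^ 2 ≤ (‖g x‖ + ‖u₀ x‖) ^ 2 := by
        gcongr
        linarith
      nlinarith [sq_nonneg (‖g x‖ - ‖u₀ x‖)]
    · filter_upwards [hlim] with x hx
      have h1 := (tendsto_iff_norm_sub_tendsto_zero.1 hx).pow 2
      simpa using h1
  have h1 : Tendsto (fun i => ‖u i - u₀‖ ^ 2) l (𝓝 0) := by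
    rw [integral_zero] at h0
    refine h0.congr fun i => ?_
    rw [norm_sq_eq_integral_norm_sq]
    refine integral_congr_ae ?_
    filter_upwards [Lp.coeFn_sub (u i) u₀, hu i, hu₀] with x h1 h2 h3
    rw [h1, Pi.sub_apply, h2, h3]
  have h2 := (Real.continuous_sqrt.tendsto 0).comp h1
  rw [Real.sqrt_zero] at h2
  exact h2.congr fun i => Real.sqrt_sq (norm_nonneg _)

/-- An `L²` limit of functions converging almost everywhere is the pointwise limit. -/
theorem ae_eq_of_tendsto_Lp_two {ι : Type*} {l : Filter ι} [l.IsCountablyGenerated] [l.NeBot]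
    {u : ι → Lp ℂ 2 μ} {u₀ : Lp ℂ 2 μ} {f : ι → α → ℂ} {f₀ : α → ℂ} (hu : ∀ i, u i =ᵐ[μ] f i)
    (h : Tendsto u l (𝓝 u₀)) (hlim : ∀ᵐ x ∂μ, Tendsto (fun i => f i x) l (𝓝 (f₀ x))) :
    u₀ =ᵐ[μ] f₀ := by
  obtain ⟨i, hi⟩ := exists_seq_tendsto l
  obtain ⟨ns, hns, hae⟩ :=
    (tendstoInMeasure_of_tendsto_Lp (h.comp hi)).exists_seq_tendsto_ae
  have hall : ∀ᵐ x ∂μ, ∀ n, u (i n) x = f (i n) x := ae_all_iff.2 fun n => hu (i n)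
  filter_upwards [hae, hlim, hall] with x h1 h2 h3
  refine tendsto_nhds_unique h1 ((h2.comp (hi.comp hns.tendsto_atTop)).congr fun n => ?_)
  simp only [Function.comp, h3]

/-- Multiplication by an essentially bounded function, as an operator on `L²`. -/
def boundedMul {f : α → ℂ} (hf : MemLp f ∞ μ) : Lp ℂ 2 μ →L[ℂ] Lp ℂ 2 μ :=
  (ContinuousLinearMap.mul ℂ ℂ).holderL μ ∞ 2 2 hf.toLp

theorem coeFn_boundedMul {f : α → ℂ} (hf : MemLp f ∞ μ) (φ : Lp ℂ 2 μ) :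
    boundedMul hf φ =ᵐ[μ] fun x => f x * φ x := by
  have h := ContinuousLinearMap.coeFn_holder (r := 2) (ContinuousLinearMap.mul ℂ ℂ) hf.toLp φ
  filter_upwards [h, hf.coeFn_toLp] with x h1 h2
  rw [h2] at h1
  exact h1

end LTwo

/-! ### The free Hamiltonian in Fourier space -/

section FreeHamiltonian

open FourierTransform

variable {d : ℕ}

/-- The symbol `2 π² ‖ξ‖²` of `H₀ = -½ Δ`, in the normalization of the Fourier transform with
kernel `e^{-2πi⟨x, ξ⟩}`. -/
def kineticSymbol (ξ : EuclideanSpace ℝ (Fin d)) : ℝ := 2 * π ^ 2 * ‖ξ‖ ^ 2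

theorem kineticSymbol_nonneg (ξ : EuclideanSpace ℝ (Fin d)) : 0 ≤ kineticSymbol ξ := by
  unfold kineticSymbol
  positivity

theorem continuous_kineticSymbol : Continuous (kineticSymbol (d := d)) := by
  unfold kineticSymbol
  fun_prop

/-- `(f, h)` lies in the graph of `H₀` if and only if `ĥ = 2 π² ‖ξ‖² f̂`. -/
theorem mem_graph_freeHamiltonian_iff_fourier (f h : L2Space d) :
    (f, h) ∈ (freeHamiltonian d).graph ↔
      (𝓕 h : L2Space d) =ᵐ[volume] fun ξ => (kineticSymbol ξ : ℂ) * (𝓕 f : L2Space d) ξ := by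
  have hgrowth :
      (fun x : EuclideanSpace ℝ (Fin d) => Complex.ofReal (‖x‖ ^ 2)).HasTemperateGrowth := by
    fun_prop
  rw [mem_graph_freeHamiltonian, Lp.toTemperedDistributionCLM_apply,
    Lp.toTemperedDistributionCLM_apply, TemperedDistribution.laplacian_eq_fourierMultiplierCLM,
    TemperedDistribution.fourierMultiplierCLM_apply, Lp.fourier_toTemperedDistribution_eq]
  have hinj : ∀ T : 𝓢'(EuclideanSpace ℝ (Fin d), ℂ),
      Lp.toTemperedDistribution h = 𝓕⁻ T ↔ Lp.toTemperedDistribution (𝓕 h : L2Space d) = T := by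
    intro T
    rw [← Lp.fourier_toTemperedDistribution_eq]
    constructor
    · intro hT
      rw [hT, fourier_fourierInv_eq]
    · intro hT
      rw [← hT, fourierInv_fourier_eq]
  have hsm : (-(1 / 2 : ℂ)) • (-(2 * π) ^ 2 • 𝓕⁻ (TemperedDistribution.smulLeftCLM ℂ
      (fun x : EuclideanSpace ℝ (Fin d) => Complex.ofReal (‖x‖ ^ 2))
        (Lp.toTemperedDistribution (𝓕 f : L2Space d)))) =
      𝓕⁻ ((2 * π ^ 2 : ℂ) • TemperedDistribution.smulLeftCLM ℂ
        (fun x : EuclideanSpace ℝ (Fin d) => Complex.ofReal (‖x‖ ^ 2))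
          (Lp.toTemperedDistribution (𝓕 f : L2Space d))) := by
    rw [FourierTransform.fourierInv_smul]
    ext g
    simp only [_root_.smul_apply, smul_eq_mul, Complex.real_smul]
    push_cast
    ring
  rw [hsm, hinj]
  have happ : ∀ g : 𝓢(EuclideanSpace ℝ (Fin d), ℂ),
      ((2 * π ^ 2 : ℂ) • TemperedDistribution.smulLeftCLM ℂ
        (fun x : EuclideanSpace ℝ (Fin d) => Complex.ofReal (‖x‖ ^ 2))
          (Lp.toTemperedDistribution (𝓕 f : L2Space d))) g =
      ∫ x, g x • ((kineticSymbol x : ℂ) * (𝓕 f : L2Space d) x) := by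
    intro g
    rw [_root_.smul_apply, TemperedDistribution.smulLeftCLM_apply_apply,
      Lp.toTemperedDistribution_apply, ← integral_smul]
    refine integral_congr_ae (ae_of_all _ fun x => ?_)
    simp only [SchwartzMap.smulLeftCLM_apply_apply hgrowth, smul_eq_mul, kineticSymbol]
    push_cast
    ring
  have hloc : ∀ u : L2Space d, LocallyIntegrable u volume := fun u =>
    (Lp.memLp u).locallyIntegrable one_le_two
  constructor
  · intro H
    refine ae_eq_of_integral_contDiff_smul_eq (hloc _)
      (LocallyIntegrable.continuous_mul (Complex.continuous_ofReal.comp continuous_kineticSymbol)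
        (hloc _)) fun g hg hgc => ?_
    · have hg₁ : HasCompactSupport (Complex.ofRealCLM ∘ g) := hgc.comp_left rfl
      have hg₂ : ContDiff ℝ (⊤ : ℕ∞) (Complex.ofRealCLM ∘ g) := Complex.ofRealCLM.contDiff.comp hg
      have h1 := DFunLike.congr_fun H (hg₁.toSchwartzMap hg₂)
      rw [happ, Lp.toTemperedDistribution_apply] at h1
      simpa using h1
  · intro H
    ext g
    rw [happ, Lp.toTemperedDistribution_apply]
    refine integral_congr_ae ?_
    filter_upwards [H] with x hx
    rw [hx]

theorem dense_domain_freeHamiltonian : Dense ((freeHamiltonian d).domain : Set (L2Space d)) := by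
  refine (SchwartzMap.denseRange_toLpCLM (E := EuclideanSpace ℝ (Fin d)) (F := ℂ) (p := 2)
    (μ := volume) ENNReal.ofNat_ne_top).mono ?_
  rintro _ ⟨φ, rfl⟩
  refine LinearPMap.mem_domain_of_mem_graph (y := ((-(1 / 2 : ℂ)) • Δ φ).toLp 2 volume) ?_
  rw [mem_graph_freeHamiltonian]
  simp only [Lp.toTemperedDistributionCLM_apply, SchwartzMap.toLpCLM_apply,
    Lp.toTemperedDistribution_toLp_eq, TemperedDistribution.laplacian_toTemperedDistributionCLM_eq,
    map_smul]

end FreeHamiltonian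

/-! ### The free semigroup on the right half-plane -/

section FreeSemigroup

open FourierTransform

variable {d : ℕ}

/-- The projection of `ℂ` onto the closed right half-plane. -/
def toRightHalfPlane (z : ℂ) : ℂ := ⟨max z.re 0, z.im⟩

theorem toRightHalfPlane_of_nonneg {z : ℂ} (hz : 0 ≤ z.re) : toRightHalfPlane z = z := by
  apply Complex.ext <;> simp [toRightHalfPlane, hz]

theorem continuous_toRightHalfPlane : Continuous toRightHalfPlane := by
  have h : toRightHalfPlane = fun z : ℂ => ((max z.re 0 : ℝ) : ℂ) + z.im * Complex.I := by
    funext z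
    exact Complex.mk_eq_add_mul_I _ _
  rw [h]
  fun_prop

/-- The Fourier symbol `e^{-z 2π²‖ξ‖²}` of `e^{-z H₀}`. For `Re z < 0` the real part of `z` is
replaced by zero, which keeps the symbol bounded. -/
def heatSymbol (z : ℂ) (ξ : EuclideanSpace ℝ (Fin d)) : ℂ :=
  Complex.exp (-(toRightHalfPlane z * kineticSymbol ξ))

theorem norm_heatSymbol_le (z : ℂ) (ξ : EuclideanSpace ℝ (Fin d)) : ‖heatSymbol z ξ‖ ≤ 1 := by
  rw [heatSymbol, Complex.norm_exp, Real.exp_le_one_iff, Complex.neg_re, Complex.re_mul_ofReal]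
  exact neg_nonpos.2 (mul_nonneg (le_max_right _ _) (kineticSymbol_nonneg ξ))

theorem continuous_heatSymbol (z : ℂ) : Continuous (heatSymbol (d := d) z) := by
  have := continuous_kineticSymbol (d := d)
  unfold heatSymbol
  fun_prop

theorem continuous_heatSymbol_left (ξ : EuclideanSpace ℝ (Fin d)) :
    Continuous fun z => heatSymbol z ξ := by
  have := continuous_toRightHalfPlane
  unfold heatSymbol
  fun_prop

theorem memLp_heatSymbol (z : ℂ) : MemLp (heatSymbol (d := d) z) ∞ volume :=
  memLp_top_of_bound (continuous_heatSymbol z).aestronglyMeasurable 1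
    (ae_of_all _ (norm_heatSymbol_le z))

/-- The operator `e^{-z H₀}` for `Re z ≥ 0`, as a Fourier multiplier. -/
def freeSemigroup (d : ℕ) (z : ℂ) : L2Space d →L[ℂ] L2Space d :=
  ((Lp.fourierTransformₗᵢ (EuclideanSpace ℝ (Fin d)) ℂ).symm.toContinuousLinearEquiv :
      L2Space d →L[ℂ] L2Space d).comp
    ((boundedMul (memLp_heatSymbol z)).comp
      ((Lp.fourierTransformₗᵢ (EuclideanSpace ℝ (Fin d)) ℂ).toContinuousLinearEquiv :
        L2Space d →L[ℂ] L2Space d))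

theorem fourier_freeSemigroup (z : ℂ) (ψ : L2Space d) :
    (𝓕 (freeSemigroup d z ψ) : L2Space d) =ᵐ[volume]
      fun ξ => heatSymbol z ξ * (𝓕 ψ : L2Space d) ξ := by
  have h : (𝓕 (freeSemigroup d z ψ) : L2Space d) = boundedMul (memLp_heatSymbol z) (𝓕 ψ) :=
    (Lp.fourierTransformₗᵢ (EuclideanSpace ℝ (Fin d)) ℂ).apply_symm_apply _
  rw [h]
  exact coeFn_boundedMul _ _

theorem fourier_L2_injective : Function.Injective fun u : L2Space d => (𝓕 u : L2Space d) :=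
  (Lp.fourierTransformₗᵢ (EuclideanSpace ℝ (Fin d)) ℂ).injective

theorem continuous_fourier_L2 : Continuous fun u : L2Space d => (𝓕 u : L2Space d) :=
  (Lp.fourierTransformₗᵢ (EuclideanSpace ℝ (Fin d)) ℂ).continuous

theorem tendsto_fourier_L2_iff {ι : Type*} {l : Filter ι} {u : ι → L2Space d} {v : L2Space d} :
    Tendsto (fun i => (𝓕 (u i) : L2Space d)) l (𝓝 (𝓕 v)) ↔ Tendsto u l (𝓝 v) :=
  (Lp.fourierTransformₗᵢ (EuclideanSpace ℝ (Fin d)) ℂ).toHomeomorph.isInducing.tendsto_nhds_iff.symm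

theorem isHalfPlaneSemigroup_freeSemigroup (d : ℕ) : IsHalfPlaneSemigroup (freeSemigroup d) where
  at_zero := by
    refine ContinuousLinearMap.ext fun ψ => fourier_L2_injective (Lp.ext ?_)
    filter_upwards [fourier_freeSemigroup 0 ψ] with ξ h
    rw [h]
    simp [heatSymbol, toRightHalfPlane_of_nonneg]
  at_add z w hz hw := by
    refine ContinuousLinearMap.ext fun ψ => fourier_L2_injective (Lp.ext ?_)
    filter_upwards [fourier_freeSemigroup (z + w) ψ, fourier_freeSemigroup w ψ,
      fourier_freeSemigroup z (freeSemigroup d w ψ)] with ξ h1 h2 h3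
    rw [ContinuousLinearMap.comp_apply, h1, h3, h2, ← mul_assoc]
    congr 1
    rw [heatSymbol, heatSymbol, heatSymbol, toRightHalfPlane_of_nonneg hz,
      toRightHalfPlane_of_nonneg hw, toRightHalfPlane_of_nonneg (by simpa using add_nonneg hz hw),
      ← Complex.exp_add]
    congr 1
    ring
  norm_le z := by
    refine ContinuousLinearMap.opNorm_le_bound _ zero_le_one fun ψ => ?_
    rw [← Lp.norm_fourier_eq, ← Lp.norm_fourier_eq ψ]
    refine Lp.norm_le_mul_norm_of_ae_le_mul ?_
    filter_upwards [fourier_freeSemigroup z ψ] with ξ h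
    rw [h, norm_mul]
    gcongr
    exact norm_heatSymbol_le z ξ
  strong_cont ψ := by
    refine continuous_iff_continuousAt.2 fun z => tendsto_fourier_L2_iff.1 ?_
    refine tendsto_Lp_two_of_dominated (g := 𝓕 ψ) (fun w => fourier_freeSemigroup w ψ)
      (fourier_freeSemigroup z ψ) (Eventually.of_forall fun w => ae_of_all _ fun ξ => ?_)
      (ae_of_all _ fun ξ => ?_)
    · rw [norm_mul]
      exact mul_le_of_le_one_left (norm_nonneg _) (norm_heatSymbol_le w ξ)
    · exact ((continuous_heatSymbol_left ξ).tendsto z).mul_const _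

theorem norm_exp_neg_sub_one_le {w : ℂ} (hw : 0 ≤ w.re) : ‖Complex.exp (-w) - 1‖ ≤ ‖w‖ := by
  have h := Convex.norm_image_sub_le_of_norm_deriv_le (𝕜 := ℂ) (f := fun w : ℂ => Complex.exp (-w))
    (s := {w : ℂ | 0 ≤ w.re}) (x := 0) (y := w) (C := 1) (fun x _ => by fun_prop)
    (fun x hx => by
      have hd : HasDerivAt (fun w : ℂ => Complex.exp (-w)) (Complex.exp (-x) * -1) x :=
        (hasDerivAt_neg x).cexp
      rw [hd.deriv, norm_mul, norm_neg, norm_one, mul_one, Complex.norm_exp, Real.exp_le_one_iff]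
      simpa using hx)
    (convex_halfSpace_re_ge 0) (by simp) hw
  simpa using h

/-- The infinitesimal generator of `t ↦ e^{-t ω H₀}` is `-ω H₀`, with the full domain of `H₀`. The
filter `l` allows one-sided and two-sided derivatives at zero. -/
theorem mem_graph_freeHamiltonian_iff_tendsto {ω : ℂ} (hω : ω ≠ 0) {l : Filter ℝ} [l.NeBot]
    [l.IsCountablyGenerated] (hl : l ≤ 𝓝[≠] 0) (hlω : ∀ᶠ h : ℝ in l, 0 ≤ ((h : ℂ) * ω).re)
    (x y : L2Space d) :
    (x, y) ∈ (freeHamiltonian d).graph ↔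
      Tendsto (fun h : ℝ => (h : ℂ)⁻¹ • (freeSemigroup d (h * ω) x - x)) l (𝓝 (-(ω • y))) := by
  rw [mem_graph_freeHamiltonian_iff_fourier, ← tendsto_fourier_L2_iff]
  have hu : ∀ h : ℝ, (𝓕 ((h : ℂ)⁻¹ • (freeSemigroup d (h * ω) x - x)) : L2Space d) =ᵐ[volume]
      fun ξ => (h : ℂ)⁻¹ * ((heatSymbol (h * ω) ξ - 1) * (𝓕 x : L2Space d) ξ) := by
    intro h
    rw [FourierTransform.fourier_smul, sub_eq_add_neg, FourierTransform.fourier_add,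
      ← neg_one_smul ℂ x, FourierTransform.fourier_smul, neg_one_smul, ← sub_eq_add_neg]
    filter_upwards [Lp.coeFn_smul (h : ℂ)⁻¹ ((𝓕 (freeSemigroup d (h * ω) x) : L2Space d) - 𝓕 x),
      Lp.coeFn_sub (𝓕 (freeSemigroup d (h * ω) x) : L2Space d) (𝓕 x),
      fourier_freeSemigroup (h * ω) x] with ξ h1 h2 h3
    rw [h1, Pi.smul_apply, h2, Pi.sub_apply, h3, smul_eq_mul, sub_one_mul]
  have hy : (𝓕 (-(ω • y)) : L2Space d) =ᵐ[volume] fun ξ => -(ω * (𝓕 y : L2Space d) ξ) := by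
    rw [← neg_smul, FourierTransform.fourier_smul]
    filter_upwards [Lp.coeFn_smul (-ω) (𝓕 y : L2Space d)] with ξ h1
    rw [h1, Pi.smul_apply, smul_eq_mul, neg_mul]
  have hlim : ∀ ξ : EuclideanSpace ℝ (Fin d), Tendsto
      (fun h : ℝ => (h : ℂ)⁻¹ * ((heatSymbol (h * ω) ξ - 1) * (𝓕 x : L2Space d) ξ)) l
      (𝓝 (-(ω * (kineticSymbol ξ * (𝓕 x : L2Space d) ξ)))) := by
    intro ξ
    have hd : HasDerivAt (fun h : ℝ => Complex.exp (-((h : ℂ) * ω * kineticSymbol ξ)))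
        (-(ω * kineticSymbol ξ)) 0 := by
      have h1 : HasDerivAt (fun h : ℝ => -((h : ℂ) * ω * kineticSymbol ξ))
          (-(1 * ω * kineticSymbol ξ)) 0 :=
        (((hasDerivAt_id (0 : ℝ)).ofReal_comp.mul_const ω).mul_const _).neg
      have h2 := h1.cexp
      simpa using h2
    have h1 := (hasDerivAt_iff_tendsto_slope_zero.1 hd).mono_left hl
    have h2 := h1.mul_const ((𝓕 x : L2Space d) ξ)
    have e : -(ω * (kineticSymbol ξ : ℂ)) * (𝓕 x : L2Space d) ξ =
        -(ω * (kineticSymbol ξ * (𝓕 x : L2Space d) ξ)) := by ring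
    rw [e] at h2
    refine h2.congr' ?_
    filter_upwards [hlω] with h hh
    rw [heatSymbol, toRightHalfPlane_of_nonneg hh, ← mul_assoc, ← Complex.ofReal_inv,
      ← Complex.real_smul]
    simp
  constructor
  · intro H
    refine tendsto_Lp_two_of_dominated (g := ω • (𝓕 y : L2Space d)) hu hy ?_ ?_
    · filter_upwards [hlω, hl self_mem_nhdsWithin] with h hh h0
      filter_upwards [H, Lp.coeFn_smul ω (𝓕 y : L2Space d)] with ξ hξ h2
      rw [h2, Pi.smul_apply, hξ, norm_mul, norm_mul, heatSymbol, toRightHalfPlane_of_nonneg hh,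
        norm_smul, norm_mul, norm_inv]
      have h3 : ‖Complex.exp (-(h * ω * kineticSymbol ξ)) - 1‖ ≤ ‖(h : ℂ) * ω * kineticSymbol ξ‖ :=
        norm_exp_neg_sub_one_le (by
          rw [Complex.re_mul_ofReal]
          exact mul_nonneg hh (kineticSymbol_nonneg ξ))
      have h4 : ‖(h : ℂ)‖ ≠ 0 := by simpa using h0
      calc ‖(h : ℂ)‖⁻¹ * (‖Complex.exp (-(h * ω * kineticSymbol ξ)) - 1‖ * ‖(𝓕 x : L2Space d) ξ‖)
          ≤ ‖(h : ℂ)‖⁻¹ * (‖(h : ℂ) * ω * kineticSymbol ξ‖ * ‖(𝓕 x : L2Space d) ξ‖) := by gcongr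
        _ = ‖ω‖ * (‖(kineticSymbol ξ : ℂ)‖ * ‖(𝓕 x : L2Space d) ξ‖) := by
            rw [norm_mul, norm_mul]
            field_simp
    · filter_upwards [H] with ξ hξ
      rw [hξ]
      exact hlim ξ
  · intro H
    have h1 := ae_eq_of_tendsto_Lp_two hu H (ae_of_all _ hlim)
    filter_upwards [h1, hy] with ξ h2 h3
    rw [h3, neg_inj] at h2
    exact mul_left_cancel₀ hω h2

theorem inner_L2_eq_fourier (x y : L2Space d) : inner ℂ x y =
    ∫ ξ, inner ℂ ((𝓕 x : L2Space d) ξ) ((𝓕 y : L2Space d) ξ) := by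
  rw [← Lp.inner_fourier_eq, L2.inner_def]

/-- `H₀` is symmetric. -/
theorem inner_im_eq_zero_of_mem_graph_freeHamiltonian {x y : L2Space d}
    (h : (x, y) ∈ (freeHamiltonian d).graph) : (inner ℂ x y).im = 0 := by
  rw [mem_graph_freeHamiltonian_iff_fourier] at h
  rw [inner_L2_eq_fourier]
  have h1 : ∫ ξ, inner ℂ ((𝓕 x : L2Space d) ξ) ((𝓕 y : L2Space d) ξ) =
      ∫ ξ, ((kineticSymbol ξ * ‖(𝓕 x : L2Space d) ξ‖ ^ 2 : ℝ) : ℂ) := by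
    refine integral_congr_ae ?_
    filter_upwards [h] with ξ hξ
    rw [hξ, ← smul_eq_mul, inner_smul_right, inner_self_eq_norm_sq_to_K]
    simp
  rw [h1, integral_complex_ofReal, Complex.ofReal_im]

/-- The matrix coefficients of `e^{-z H₀}` are differentiated under the integral sign in Fourier
space. -/
theorem differentiableOn_freeSemigroup (d : ℕ) :
    DifferentiableOn ℂ (freeSemigroup d) {z | 0 < z.re} := by
  refine differentiableOn_of_weakly_differentiableOn isOpen_re_pos (M := fun _ => 1)
    continuous_const (fun z _ => (isHalfPlaneSemigroup_freeSemigroup d).norm_le z) fun x y => ?_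
  set p : EuclideanSpace ℝ (Fin d) → ℂ :=
    fun ξ => inner ℂ ((𝓕 y : L2Space d) ξ) ((𝓕 x : L2Space d) ξ) with hp
  have hpint : Integrable p := L2.integrable_inner _ _
  have hrep : ∀ z ∈ {z : ℂ | 0 < z.re}, inner ℂ y (freeSemigroup d z x) =
      ∫ ξ, Complex.exp (-(z * kineticSymbol ξ)) * p ξ := by
    intro z hz
    rw [inner_L2_eq_fourier]
    refine integral_congr_ae ?_
    filter_upwards [fourier_freeSemigroup z x] with ξ h
    rw [h, ← smul_eq_mul, inner_smul_right, heatSymbol, toRightHalfPlane_of_nonneg (le_of_lt hz)]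
  refine DifferentiableOn.congr (fun z₀ hz₀ => ?_) hrep
  have hz₀' : 0 < z₀.re := hz₀
  have hexp : ∀ z : ℂ, Continuous fun ξ : EuclideanSpace ℝ (Fin d) =>
      Complex.exp (-(z * kineticSymbol ξ)) := by
    have := continuous_kineticSymbol (d := d)
    intro z
    fun_prop
  have hre : ∀ z ∈ Metric.ball z₀ (z₀.re / 2), z₀.re / 2 ≤ z.re := by
    intro z hz
    rw [mem_ball_iff_norm'] at hz
    have := (Complex.abs_re_le_norm (z₀ - z)).trans hz.le
    rw [Complex.sub_re, abs_le] at this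
    linarith [this.2]
  have hnorm : ∀ z : ℂ, z₀.re / 2 ≤ z.re → ∀ ξ : EuclideanSpace ℝ (Fin d),
      ‖Complex.exp (-(z * kineticSymbol ξ))‖ ≤ Real.exp (-(z₀.re / 2 * kineticSymbol ξ)) := by
    intro z hz ξ
    rw [Complex.norm_exp, Complex.neg_re, Complex.re_mul_ofReal]
    have := mul_le_mul_of_nonneg_right hz (kineticSymbol_nonneg ξ)
    gcongr
  refine ((hasDerivAt_integral_of_dominated_loc_of_deriv_le (bound := fun ξ => 2 / z₀.re * ‖p ξ‖)
    (F' := fun z ξ => -kineticSymbol ξ * Complex.exp (-(z * kineticSymbol ξ)) * p ξ)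
    (Metric.ball_mem_nhds z₀ (half_pos hz₀'))
    (Eventually.of_forall fun z => (hexp z).aestronglyMeasurable.mul hpint.aestronglyMeasurable)
    ?_ ?_ (ae_of_all _ fun ξ z hz => ?_) (hpint.norm.const_mul _)
    (ae_of_all _ fun ξ z hz => ?_)).2.differentiableAt).differentiableWithinAt
  · refine hpint.norm.mono ((hexp z₀).aestronglyMeasurable.mul hpint.aestronglyMeasurable)
      (ae_of_all _ fun ξ => ?_)
    rw [Pi.mul_apply, norm_mul, norm_norm]
    refine mul_le_of_le_one_left (norm_nonneg _) ((hnorm z₀ (by linarith) ξ).trans ?_)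
    rw [Real.exp_le_one_iff]
    have := mul_nonneg (half_pos hz₀').le (kineticSymbol_nonneg ξ)
    linarith
  · refine AEStronglyMeasurable.mul (Continuous.aestronglyMeasurable ?_) hpint.aestronglyMeasurable
    have := continuous_kineticSymbol (d := d)
    fun_prop
  · rw [norm_mul, norm_mul, norm_neg, Complex.norm_real,
      Real.norm_of_nonneg (kineticSymbol_nonneg ξ)]
    refine mul_le_mul_of_nonneg_right ?_ (norm_nonneg _)
    have h1 := mul_le_mul_of_nonneg_left (hnorm z (hre z hz) ξ) (kineticSymbol_nonneg ξ)
    refine h1.trans ?_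
    -- the kinetic symbol is `2 / Re z₀` times `s`, and `s e^{-s} ≤ 1`
    set s := z₀.re / 2 * kineticSymbol ξ with hs
    have h2 : s * Real.exp (-s) ≤ 1 := by
      have h3 := Real.add_one_le_exp s
      rw [Real.exp_neg, ← div_eq_mul_inv, div_le_one (Real.exp_pos s)]
      linarith
    have h4 : kineticSymbol ξ = 2 / z₀.re * s := by
      rw [hs]
      field_simp
    calc kineticSymbol ξ * Real.exp (-s) = 2 / z₀.re * (s * Real.exp (-s)) := by
          rw [← mul_assoc, ← h4]
      _ ≤ 2 / z₀.re * 1 := by gcongr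
      _ = 2 / z₀.re := mul_one _
  · have h1 : HasDerivAt (fun z : ℂ => -(z * kineticSymbol ξ)) (-(1 * kineticSymbol ξ)) z :=
      ((hasDerivAt_id z).mul_const _).neg
    have h2 := h1.cexp.mul_const (p ξ)
    refine h2.congr_deriv ?_
    ring

end FreeSemigroup

/-! ### The semigroups and the group generated by the free and the perturbed Hamiltonian -/

section Graphs

variable {H : Type*} [NormedAddCommGroup H] [NormedSpace ℂ H]

theorem mem_graph_neg_iff (B : H →ₗ.[ℂ] H) (x y : H) : (x, y) ∈ (-B).graph ↔ (x, -y) ∈ B.graph := by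
  simp only [LinearPMap.mem_graph_iff, LinearPMap.neg_apply]
  exact ⟨fun ⟨z, h1, h2⟩ => ⟨z, h1, by rw [← h2, neg_neg]⟩,
    fun ⟨z, h1, h2⟩ => ⟨z, h1, by rw [h2, neg_neg]⟩⟩

theorem mem_graph_smul_iff {c : ℂ} (hc : c ≠ 0) (B : H →ₗ.[ℂ] H) (x y : H) :
    (x, y) ∈ (c • B).graph ↔ (x, c⁻¹ • y) ∈ B.graph := by
  simp only [LinearPMap.mem_graph_iff, LinearPMap.smul_apply]
  exact ⟨fun ⟨z, h1, h2⟩ => ⟨z, h1, by rw [← h2, inv_smul_smul₀ hc]⟩,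
    fun ⟨z, h1, h2⟩ => ⟨z, h1, by rw [h2, smul_inv_smul₀ hc]⟩⟩

theorem mem_graph_add_toPMap_iff (B : H →ₗ.[ℂ] H) (A : H →L[ℂ] H) (x y : H) :
    (x, y) ∈ (B + A.toLinearMap.toPMap ⊤).graph ↔ (x, y - A x) ∈ B.graph := by
  simp only [LinearPMap.mem_graph_iff]
  constructor
  · rintro ⟨⟨z, hz⟩, h1, h2⟩
    simp only at h1 h2
    subst h1
    refine ⟨⟨z, hz.1⟩, rfl, ?_⟩
    rw [← h2, LinearPMap.add_apply]
    exact (add_sub_cancel_right _ _).symm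
  · rintro ⟨⟨z, hz⟩, h1, h2⟩
    simp only at h1 h2
    subst h1
    refine ⟨⟨z, hz, trivial⟩, rfl, ?_⟩
    rw [LinearPMap.add_apply]
    exact eq_sub_iff_add_eq.1 h2

end Graphs

section Generation

variable {H : Type*} [NormedAddCommGroup H] [NormedSpace ℂ H] {P : ℂ → H →L[ℂ] H}

namespace IsHalfPlaneSemigroup

theorem isC0SemigroupOf (hP : IsHalfPlaneSemigroup P) {ω : ℂ} (hω : 0 ≤ ω.re) {B : H →ₗ.[ℂ] H}
    (hB : ∀ x y : H, (x, y) ∈ B.graph ↔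
      Tendsto (fun h : ℝ => (h : ℂ)⁻¹ • (P (h * ω) x - x)) (𝓝[>] 0) (𝓝 y)) :
    IsC0SemigroupOf (fun t => P (t * ω)) B where
  map_zero := by simp [hP.at_zero]
  map_add s t hs ht := by
    have hre : ∀ r : ℝ, 0 ≤ r → 0 ≤ ((r : ℂ) * ω).re := fun r hr => by
      rw [Complex.re_ofReal_mul]
      exact mul_nonneg hr hω
    rw [← hP.at_add _ _ (hre s hs) (hre t ht)]
    push_cast
    rw [add_mul]
  strong_cont x := (hP.continuous_apply (by fun_prop) continuous_const).continuousOn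
  generator := hB

variable [CompleteSpace H]

/-- A bounded perturbation keeps the domain of the generator: the Dyson series and the unperturbed
semigroup are differentiable at zero on the same vectors. -/
theorem isC0SemigroupOf_dyson (hP : IsHalfPlaneSemigroup P) (A : H →L[ℂ] H) {ω : ℂ}
    (hω : 0 ≤ ω.re) {B : H →ₗ.[ℂ] H} (hB : ∀ x y : H, (x, y) ∈ B.graph ↔
      Tendsto (fun h : ℝ => (h : ℂ)⁻¹ • (P (h * ω) x - x)) (𝓝[>] 0) (𝓝 (y - ω • A x))) :
    IsC0SemigroupOf (fun t => dyson P A (t * ω)) B where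
  map_zero := by simp [hP.dyson_zero]
  map_add s t hs ht := hP.dyson_add_ray A (J := Ici 0)
    (fun t ht => by
      rw [Complex.re_ofReal_mul]
      exact mul_nonneg ht hω)
    (fun t ht r hr => mul_nonneg hr.1 ht) hs ht
  strong_cont x := (hP.continuous_dyson_apply A (by fun_prop) continuous_const).continuousOn
  generator x y := by
    rw [hP.tendsto_slope_dyson_iff A ω x y (nhdsGT_le_nhdsNE 0),
      hB]

/-- On the imaginary axis both directions of time stay in the closed half-plane, so that the Dyson
series gives a group. -/
theorem isC0GroupOf_dyson (hP : IsHalfPlaneSemigroup P) (A : H →L[ℂ] H) {ω : ℂ}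
    (hω : ω.re = 0) {B : H →ₗ.[ℂ] H} (hB : ∀ x y : H, (x, y) ∈ B.graph ↔
      Tendsto (fun h : ℝ => (h : ℂ)⁻¹ • (P (h * ω) x - x)) (𝓝[≠] 0) (𝓝 (y - ω • A x))) :
    IsC0GroupOf (fun t => dyson P A (t * ω)) B where
  map_zero := by simp [hP.dyson_zero]
  map_add s t := hP.dyson_add_ray A (J := univ)
    (fun t _ => by rw [Complex.re_ofReal_mul, hω, mul_zero])
    (fun _ _ _ _ => mem_univ _) (mem_univ s) (mem_univ t)
  strong_cont x := hP.continuous_dyson_apply A (by fun_prop) continuous_const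
  generator x y := by
    rw [hP.tendsto_slope_dyson_iff A ω x y le_rfl, hB]

theorem norm_dyson_ray_le (hP : IsHalfPlaneSemigroup P) (A : H →L[ℂ] H) (ω : ℂ) {t s : ℝ}
    (hs : s ∈ Icc 0 t) : ‖dyson P A (s * ω)‖ ≤ Real.exp (t * ‖ω‖ * ‖A‖) := by
  refine (hP.norm_dyson_le A _).trans ?_
  rw [norm_mul, Complex.norm_real, Real.norm_of_nonneg hs.1]
  have := hs.2
  gcongr

end IsHalfPlaneSemigroup

end Generation

section Hamiltonian

variable {d : ℕ}

theorem dense_domain_hamiltonian {V : EuclideanSpace ℝ (Fin d) → ℝ} (hV : MemLp V ∞ volume) :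
    Dense ((hamiltonian hV).domain : Set (L2Space d)) := by
  have h : (hamiltonian hV).domain = (freeHamiltonian d).domain := by
    rw [hamiltonian, LinearPMap.add_domain]
    exact inf_top_eq _
  rw [h]
  exact dense_domain_freeHamiltonian

theorem isC0SemigroupOf_neg_freeHamiltonian :
    IsC0SemigroupOf (fun t => freeSemigroup d (t * 1)) (-freeHamiltonian d) := by
  refine (isHalfPlaneSemigroup_freeSemigroup d).isC0SemigroupOf (by simp) fun x y => ?_
  rw [mem_graph_neg_iff, mem_graph_freeHamiltonian_iff_tendsto one_ne_zero
    (nhdsGT_le_nhdsNE 0), one_smul, neg_neg]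
  filter_upwards [self_mem_nhdsWithin] with h hh
  simpa using le_of_lt hh

theorem isC0SemigroupOf_neg_I_smul_freeHamiltonian :
    IsC0SemigroupOf (fun t => freeSemigroup d (t * Complex.I))
      ((-Complex.I) • freeHamiltonian d) := by
  refine (isHalfPlaneSemigroup_freeSemigroup d).isC0SemigroupOf (by simp) fun x y => ?_
  rw [mem_graph_smul_iff (neg_ne_zero.2 Complex.I_ne_zero),
    mem_graph_freeHamiltonian_iff_tendsto Complex.I_ne_zero
    (nhdsGT_le_nhdsNE 0), ← neg_smul,
    smul_inv_smul₀ (neg_ne_zero.2 Complex.I_ne_zero)]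
  filter_upwards with h
  simp

theorem isC0SemigroupOf_neg_hamiltonian {V : EuclideanSpace ℝ (Fin d) → ℝ}
    (hV : MemLp V ∞ volume) :
    IsC0SemigroupOf (fun t => dyson (freeSemigroup d) (-mulOp hV) (t * 1)) (-hamiltonian hV) := by
  refine (isHalfPlaneSemigroup_freeSemigroup d).isC0SemigroupOf_dyson _ (by simp) fun x y => ?_
  rw [mem_graph_neg_iff, hamiltonian, mem_graph_add_toPMap_iff,
    mem_graph_freeHamiltonian_iff_tendsto one_ne_zero
    (nhdsGT_le_nhdsNE 0)]
  · have e : -((1 : ℂ) • (-y - mulOp hV x)) = y - (1 : ℂ) • (-mulOp hV) x := by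
      rw [one_smul, one_smul, neg_apply]
      abel
    rw [e]
  · filter_upwards [self_mem_nhdsWithin] with h hh
    simpa using le_of_lt hh

theorem isC0GroupOf_neg_I_smul_hamiltonian {V : EuclideanSpace ℝ (Fin d) → ℝ}
    (hV : MemLp V ∞ volume) :
    IsC0GroupOf (fun t => dyson (freeSemigroup d) (-mulOp hV) (t * Complex.I))
      ((-Complex.I) • hamiltonian hV) := by
  refine (isHalfPlaneSemigroup_freeSemigroup d).isC0GroupOf_dyson _ (by simp) fun x y => ?_
  rw [mem_graph_smul_iff (neg_ne_zero.2 Complex.I_ne_zero), hamiltonian, mem_graph_add_toPMap_iff,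
    mem_graph_freeHamiltonian_iff_tendsto Complex.I_ne_zero le_rfl]
  · have e : -(Complex.I • ((-Complex.I)⁻¹ • y - mulOp hV x)) =
        y - Complex.I • (-mulOp hV) x := by
      rw [neg_apply, smul_neg, sub_neg_eq_add, ← neg_smul, smul_sub,
        smul_inv_smul₀ (neg_ne_zero.2 Complex.I_ne_zero), neg_smul, sub_neg_eq_add]
    rw [e]
  · filter_upwards with h
    simp

theorem c0Semigroup_neg_freeHamiltonian {t : ℝ} (ht : 0 ≤ t) :
    c0Semigroup (-freeHamiltonian d) t = freeSemigroup d (t * 1) :=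
  isC0SemigroupOf_neg_freeHamiltonian.eq isC0SemigroupOf_neg_freeHamiltonian.c0Semigroup
    dense_domain_freeHamiltonian ht fun _ _ => (isHalfPlaneSemigroup_freeSemigroup d).norm_le _

theorem c0Semigroup_neg_I_smul_freeHamiltonian {t : ℝ} (ht : 0 ≤ t) :
    c0Semigroup ((-Complex.I) • freeHamiltonian d) t = freeSemigroup d (t * Complex.I) :=
  isC0SemigroupOf_neg_I_smul_freeHamiltonian.eq
    isC0SemigroupOf_neg_I_smul_freeHamiltonian.c0Semigroup
    dense_domain_freeHamiltonian ht fun _ _ => (isHalfPlaneSemigroup_freeSemigroup d).norm_le _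

theorem c0Semigroup_neg_hamiltonian {V : EuclideanSpace ℝ (Fin d) → ℝ}
    (hV : MemLp V ∞ volume) {t : ℝ} (ht : 0 ≤ t) :
    c0Semigroup (-hamiltonian hV) t = dyson (freeSemigroup d) (-mulOp hV) (t * 1) :=
  (isC0SemigroupOf_neg_hamiltonian hV).eq (isC0SemigroupOf_neg_hamiltonian hV).c0Semigroup
    (dense_domain_hamiltonian hV) ht fun _ hs =>
      (isHalfPlaneSemigroup_freeSemigroup d).norm_dyson_ray_le _ _ hs

theorem c0Group_neg_I_smul_hamiltonian {V : EuclideanSpace ℝ (Fin d) → ℝ}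
    (hV : MemLp V ∞ volume) : c0Group ((-Complex.I) • hamiltonian hV) =
      fun t : ℝ => dyson (freeSemigroup d) (-mulOp hV) (t * Complex.I) :=
  (isC0GroupOf_neg_I_smul_hamiltonian hV).eq (isC0GroupOf_neg_I_smul_hamiltonian hV).c0Group
    (dense_domain_hamiltonian hV) fun _ _ => ⟨_, fun _ hs =>
      (isHalfPlaneSemigroup_freeSemigroup d).norm_dyson_ray_le _ _ hs⟩

theorem coeFn_mulOp {V : EuclideanSpace ℝ (Fin d) → ℝ} (hV : MemLp V ∞ volume) (φ : L2Space d) :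
    mulOp hV φ =ᵐ[volume] fun x => (V x : ℂ) * φ x :=
  coeFn_boundedMul (hV.ofReal (K := ℂ)) φ

theorem inner_mulOp_self_im {V : EuclideanSpace ℝ (Fin d) → ℝ} (hV : MemLp V ∞ volume)
    (φ : L2Space d) : (inner ℂ φ (mulOp hV φ)).im = 0 := by
  rw [L2.inner_def]
  have h1 : ∫ x, inner ℂ (φ x) (mulOp hV φ x) = ∫ x, ((V x * ‖φ x‖ ^ 2 : ℝ) : ℂ) := by
    refine integral_congr_ae ?_
    filter_upwards [coeFn_mulOp hV φ] with x hx
    rw [hx, ← smul_eq_mul, inner_smul_right, inner_self_eq_norm_sq_to_K]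
    simp
  rw [h1, integral_complex_ofReal, Complex.ofReal_im]

/-- The Schrödinger group is unitary, because `H₀ + V` is symmetric. -/
theorem c0Group_mem_unitary {V : EuclideanSpace ℝ (Fin d) → ℝ} (hV : MemLp V ∞ volume) (t : ℝ) :
    c0Group ((-Complex.I) • hamiltonian hV) t ∈ unitary (L2Space d →L[ℂ] L2Space d) := by
  refine (isC0GroupOf_neg_I_smul_hamiltonian hV).c0Group.mem_unitary
    (dense_domain_hamiltonian hV) (fun x y hxy => ?_) t
  rw [mem_graph_smul_iff (neg_ne_zero.2 Complex.I_ne_zero), hamiltonian,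
    mem_graph_add_toPMap_iff] at hxy
  have h1 := inner_im_eq_zero_of_mem_graph_freeHamiltonian hxy
  rw [inner_sub_right, Complex.sub_im, inner_mulOp_self_im, sub_zero, inner_smul_right] at h1
  simpa using h1

end Hamiltonian

/-! ### The exponential of an absolutely continuous function -/

section Exponential

/-- The fundamental theorem of calculus for `exp (-∫₀ˢ f)`. As `f` is merely measurable, this
function of `s` is only Lipschitz, and its derivative is computed almost everywhere by Lebesgue's
differentiation theorem. -/
theorem exp_neg_integral_eq_one_sub {f : ℝ → ℝ} (hf : Measurable f) (hf1 : ∀ s, |f s| ≤ 1) {t : ℝ}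
    (ht : 0 ≤ t) : Real.exp (-∫ u in (0 : ℝ)..t, f u) =
      1 - ∫ s in (0 : ℝ)..t, Real.exp (-∫ u in (0 : ℝ)..s, f u) * f s := by
  set F : ℝ → ℝ := fun s => ∫ u in (0 : ℝ)..s, f u with hF
  have hloc : LocallyIntegrable f volume := by
    refine (locallyIntegrable_const (1 : ℝ)).mono hf.aestronglyMeasurable (ae_of_all _ fun s => ?_)
    simpa using hf1 s
  have hint : ∀ a b, IntervalIntegrable f volume a b := fun a b =>
    intervalIntegrable_iff.2
      ((hloc.integrableOn_isCompact isCompact_uIcc).mono_set uIoc_subset_uIcc)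
  have hFL : ∀ a b, |F b - F a| ≤ |b - a| := by
    intro a b
    rw [hF]
    simp only
    rw [intervalIntegral.integral_interval_sub_left (hint _ _) (hint _ _)]
    have := intervalIntegral.norm_integral_le_of_norm_le_const (a := a) (b := b) (f := f) (C := 1)
      fun x _ => hf1 x
    simpa using this
  have hFb : ∀ s ∈ Icc 0 t, F s ∈ Icc (-t) t := by
    intro s hs
    have h1 := hFL 0 s
    have h2 : F 0 = 0 := by simp [hF]
    rw [h2, sub_zero, sub_zero, abs_of_nonneg hs.1] at h1
    exact abs_le.1 (h1.trans hs.2)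
  have hexp : LipschitzOnWith (Real.exp t).toNNReal (fun x => Real.exp (-x)) (Icc (-t) t) := by
    refine Convex.lipschitzOnWith_of_nnnorm_hasDerivWithin_le (convex_Icc _ _)
      (f' := fun x => Real.exp (-x) * -1)
      (fun x _ => ((hasDerivAt_neg x).exp).hasDerivWithinAt) fun x hx => ?_
    rw [← NNReal.coe_le_coe, coe_nnnorm, Real.coe_toNNReal _ (Real.exp_pos _).le, mul_neg_one,
      norm_neg, Real.norm_of_nonneg (Real.exp_pos _).le]
    exact Real.exp_le_exp.2 (by linarith [hx.1])
  have hac : AbsolutelyContinuousOnInterval (fun s => Real.exp (-F s)) 0 t := by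
    have hF1 : LipschitzOnWith 1 F (Icc 0 t) := LipschitzOnWith.of_dist_le_mul fun x _ y _ => by
      simpa [Real.dist_eq] using hFL y x
    have h := hexp.comp hF1 hFb
    rw [← uIcc_of_le ht] at h
    exact h.absolutelyContinuousOnInterval
  have h1 := hac.integral_deriv_eq_sub
  have h2 : ∫ s in (0 : ℝ)..t, deriv (fun s => Real.exp (-F s)) s =
      ∫ s in (0 : ℝ)..t, -(Real.exp (-F s) * f s) := by
    refine intervalIntegral.integral_congr_ae ?_
    filter_upwards [_root_.LocallyIntegrable.ae_hasDerivAt_integral hloc] with s hs _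
    have h3 : HasDerivAt (fun s => Real.exp (-F s)) (Real.exp (-F s) * -f s) s := (hs 0).neg.exp
    rw [h3.deriv, mul_neg]
  rw [h2, intervalIntegral.integral_neg] at h1
  have h3 : F 0 = 0 := by simp [hF]
  rw [h3, neg_zero, Real.exp_zero] at h1
  linarith

end Exponential

/-! ### Independence of the past for processes with independent increments -/

section Increments

variable {Ω T E : Type*} {mΩ : MeasurableSpace Ω} {μ : Measure Ω} [LinearOrder T]
  [NormedAddCommGroup E] [MeasurableSpace E] [BorelSpace E] [SecondCountableTopology E]

/-- If the process starts at zero, its values up to time `s` are independent of the increments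
after time `s`: finitely many past values are sums of increments over disjoint intervals. -/
theorem _root_.ProbabilityTheory.HasIndepIncrements.indepFun_past {X : T → Ω → E}
    (h : HasIndepIncrements X μ) (hX : ∀ i, Measurable (X i)) {b s t : T} (hb : ∀ i, b ≤ i)
    (h0 : ∀ ω, X b ω = 0) (hst : s ≤ t) {ι : Type*} (u : ι → T) (hu : ∀ i, u i ≤ s) :
    IndepFun (fun ω i => X (u i) ω) (fun ω => X t ω - X s ω) μ := by
  classical
  have hprob : IsProbabilityMeasure μ := (h 0 (fun _ => b) fun _ _ _ => le_rfl).isProbabilityMeasure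
  refine IndepFun.process_indepFun (fun i => hX _) ((hX t).sub (hX s)) fun I => ?_
  -- enumerate `b`, `s` and the times in `I`, and continue with `t`
  set J : Finset T := insert b (insert s (I.image u)) with hJ
  have hJs : ∀ j ∈ J, j ≤ s := by
    intro j hj
    simp only [hJ, Finset.mem_insert, Finset.mem_image] at hj
    rcases hj with rfl | rfl | ⟨i, _, rfl⟩
    · exact hb s
    · exact le_rfl
    · exact hu i
  have hbJ : b ∈ J := by simp [hJ]
  have hsJ : s ∈ J := by simp [hJ]
  have hJpos : 0 < J.card := Finset.card_pos.2 ⟨b, hbJ⟩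
  set τ : ℕ → T := fun k => if hk : k < J.card then J.orderEmbOfFin rfl ⟨k, hk⟩ else t with hτ
  have hτlt : ∀ k (hk : k < J.card), τ k = J.orderEmbOfFin rfl ⟨k, hk⟩ := fun k hk => by
    simp only [hτ, hk, dif_pos]
  have hτge : ∀ k, J.card ≤ k → τ k = t := fun k hk => by simp only [hτ, not_lt.2 hk, dif_neg,
    not_false_eq_true]
  have hτmono : Monotone τ := by
    intro k l hkl
    by_cases hl : l < J.card
    · rw [hτlt k (hkl.trans_lt hl), hτlt l hl]
      exact (J.orderEmbOfFin rfl).monotone hkl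
    · rw [hτge l (not_lt.1 hl)]
      by_cases hk : k < J.card
      · rw [hτlt k hk]
        exact (hJs _ (Finset.orderEmbOfFin_mem J rfl _)).trans hst
      · rw [hτge k (not_lt.1 hk)]
  have hsurj : ∀ j ∈ J, ∃ k, k < J.card ∧ τ k = j := by
    intro j hj
    have hr : j ∈ Set.range (J.orderEmbOfFin rfl) := by
      rw [Finset.range_orderEmbOfFin]
      exact hj
    obtain ⟨k, hk⟩ := hr
    exact ⟨k, k.2, by rw [hτlt k k.2]; exact hk⟩
  have hτ0 : τ 0 = b := by
    obtain ⟨k, _, hk⟩ := hsurj b hbJ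
    exact le_antisymm (hk ▸ hτmono (Nat.zero_le k)) (hb _)
  have hτlast : τ (J.card - 1) = s := by
    obtain ⟨k, hk, hk'⟩ := hsurj s hsJ
    refine le_antisymm ?_ (hk' ▸ hτmono (Nat.le_sub_one_of_lt hk))
    rw [hτlt _ (Nat.sub_lt hJpos one_pos)]
    exact hJs _ (Finset.orderEmbOfFin_mem J rfl _)
  have hτn : τ J.card = t := hτge _ le_rfl
  set Y : ℕ → Ω → E := fun i ω => X (τ (i + 1)) ω - X (τ i) ω with hY
  have hYm : ∀ i, Measurable (Y i) := fun i => (hX _).sub (hX _)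
  have hind : iIndepFun Y μ := h.nat hτmono
  have hfin := hind.indepFun_finset (Finset.range (J.card - 1)) {J.card - 1} (by simp) hYm
  have hI : ∀ i : I, ∃ k, k < J.card ∧ τ k = u i := fun i => hsurj _ (by
    simp only [hJ, Finset.mem_insert, Finset.mem_image]
    exact Or.inr (Or.inr ⟨i, i.2, rfl⟩))
  choose κ hκ hκu using hI
  have htel : ∀ k ω, X (τ k) ω = ∑ j ∈ Finset.range k, Y j ω := by
    intro k ω
    rw [Finset.sum_range_sub (fun i => X (τ i) ω), hτ0, h0, sub_zero]
  have hψ : Measurable fun v : ({J.card - 1} : Finset ℕ) → E =>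
      v ⟨J.card - 1, Finset.mem_singleton_self _⟩ := measurable_pi_apply _
  have hcomp := hfin.comp
    (φ := fun (v : Finset.range (J.card - 1) → E) (i : I) =>
      ∑ j : Finset.range (J.card - 1), if (j : ℕ) < κ i then v j else 0)
    (ψ := fun v : ({J.card - 1} : Finset ℕ) → E => v ⟨J.card - 1, Finset.mem_singleton_self _⟩)
    (measurable_pi_lambda _ fun i => Finset.measurable_sum _ fun j _ => by
      split_ifs
      · exact measurable_pi_apply j
      · exact measurable_const) hψ
  convert! hcomp using 1
  · funext ω i
    simp only [Function.comp]
    rw [← hκu, htel, Finset.sum_coe_sort (Finset.range (J.card - 1))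
      (fun j => if j < κ i then Y j ω else 0), ← Finset.sum_filter]
    congr 1
    ext j
    have := hκ i
    simp only [Finset.mem_range, Finset.mem_filter]
    omega
  · funext ω
    simp only [Function.comp, hY]
    rw [Nat.sub_add_cancel hJpos, hτn, hτlast]

end Increments

/-! ### Gaussian averages of translations in `L²` -/

section WeakIdentification

variable {α Ω : Type*} {mα : MeasurableSpace α} {mΩ : MeasurableSpace Ω} {μ : Measure α}
  {m : Measure Ω}

theorem integrable_inner_of_memLp_two {f g : α → ℂ} (hf : MemLp f 2 μ) (hg : MemLp g 2 μ) :
    Integrable (fun x => inner ℂ (f x) (g x)) μ := by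
  have h := L2.integrable_inner (𝕜 := ℂ) hf.toLp hg.toLp
  refine h.congr ?_
  filter_upwards [hf.coeFn_toLp, hg.coeFn_toLp] with x h1 h2
  rw [h1, h2]

/-- A vector `v` of `L²` represented weakly by a square integrable function `h` of an additional
random parameter is, pointwise almost everywhere, the expectation of `h`. -/
theorem ae_eq_integral_of_forall_inner_eq [SigmaFinite μ] [IsProbabilityMeasure m]
    {h : α × Ω → ℂ} (hh : MemLp h 2 (μ.prod m)) {v : Lp ℂ 2 μ}
    (hv : ∀ φ : Lp ℂ 2 μ, ∫ p, inner ℂ (φ p.1) (h p) ∂(μ.prod m) = inner ℂ φ v) :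
    ∀ᵐ x ∂μ, Integrable (fun ω => h (x, ω)) m ∧ v x = ∫ ω, h (x, ω) ∂m := by
  have hsec : ∀ᵐ x ∂μ, Integrable (fun ω => h (x, ω)) m := by
    have h1 := ((memLp_two_iff_integrable_sq_norm hh.1).1 hh).prod_right_ae
    have h2 := hh.1.prodMk_left
    filter_upwards [h1, h2] with x h3 h4
    exact ((memLp_two_iff_integrable_sq_norm h4).2 h3).integrable one_le_two
  have hfst : MeasurePreserving Prod.fst (μ.prod m) μ := measurePreserving_fst
  have hint : ∀ s, MeasurableSet s → μ s < ∞ → Integrable h ((μ.restrict s).prod m) := by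
    intro s hs hμs
    have : IsFiniteMeasure (μ.restrict s) := ⟨by simpa using hμs⟩
    refine (MemLp.mono_measure ?_ hh).integrable one_le_two
    have e : (μ.restrict s).prod m = (μ.prod m).restrict (s ×ˢ univ) := by
      rw [← Measure.prod_restrict, Measure.restrict_univ]
    rw [e]
    exact Measure.restrict_le_self
  have hae : v =ᵐ[μ] fun x => ∫ ω, h (x, ω) ∂m := by
    refine ae_eq_of_forall_setIntegral_eq_of_sigmaFinite
      (fun s _ hμs => integrableOn_Lp_of_measure_ne_top v one_le_two hμs.ne)
      (fun s hs hμs => (hint s hs hμs).integral_prod_left) fun s hs hμs => ?_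
    rw [← L2.inner_indicatorConstLp_one (𝕜 := ℂ) hs hμs.ne, ← hv, ← integral_prod _ (hint s hs hμs)]
    have e : (μ.restrict s).prod m = (μ.prod m).restrict (s ×ˢ univ) := by
      rw [← Measure.prod_restrict, Measure.restrict_univ]
    rw [e, ← integral_indicator (hs.prod MeasurableSet.univ)]
    refine integral_congr_ae ?_
    filter_upwards [hfst.quasiMeasurePreserving.ae (indicatorConstLp_coeFn (p := 2) (hs := hs)
      (hμs := hμs.ne) (c := (1 : ℂ)))] with p hp
    rw [hp]
    by_cases hps : p.1 ∈ s <;> simp [hps]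
  filter_upwards [hsec, hae] with x h1 h2
  exact ⟨h1, h2⟩

end WeakIdentification

section Translation

open FourierTransform

variable {d : ℕ} {Ω : Type*} {mΩ : MeasurableSpace Ω} {m : Measure Ω} [IsProbabilityMeasure m]

/-- If the initial position is distributed according to Lebesgue measure, so is the position after
an independent displacement. -/
theorem measurePreserving_fst_add {Y : Ω → EuclideanSpace ℝ (Fin d)} (hY : Measurable Y) :
    MeasurePreserving (fun p : EuclideanSpace ℝ (Fin d) × Ω => p.1 + Y p.2) (volume.prod m)
      volume := by
  have h1 : MeasurePreserving (fun p : Ω × EuclideanSpace ℝ (Fin d) => (id p.1, p.2 + Y p.1))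
      (m.prod volume) (m.prod volume) :=
    (MeasurePreserving.id m).skew_product (g := fun ω x => x + Y ω)
      (measurable_snd.add (hY.comp measurable_fst))
      (ae_of_all _ fun ω => (measurePreserving_add_right volume (Y ω)).map_eq)
  exact (measurePreserving_snd.comp h1).comp Measure.measurePreserving_swap

/-- Translation by `w` on `L²`. -/
def translateL2 (w : EuclideanSpace ℝ (Fin d)) : L2Space d →ₗᵢ[ℂ] L2Space d :=
  Lp.compMeasurePreservingₗᵢ ℂ (fun x => x + w) (measurePreserving_add_right volume w)

theorem coeFn_translateL2 (w : EuclideanSpace ℝ (Fin d)) (ψ : L2Space d) :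
    translateL2 w ψ =ᵐ[volume] fun x => ψ (x + w) :=
  Lp.coeFn_compMeasurePreserving ψ (measurePreserving_add_right volume w)

theorem memLp_fourierChar (w : EuclideanSpace ℝ (Fin d)) :
    MemLp (fun ξ : EuclideanSpace ℝ (Fin d) => (Real.fourierChar (inner ℝ w ξ) : ℂ)) ∞ volume :=
  memLp_top_of_bound (Continuous.aestronglyMeasurable (by fun_prop)) 1
    (ae_of_all _ fun ξ => (Circle.norm_coe _).le)

/-- The Fourier transform turns translation into modulation; on `L²` this follows by density from
Schwartz functions. -/
theorem fourier_translateL2 (w : EuclideanSpace ℝ (Fin d)) (ψ : L2Space d) :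
    (𝓕 (translateL2 w ψ) : L2Space d) = boundedMul (memLp_fourierChar w) (𝓕 ψ) := by
  refine DenseRange.induction_on (SchwartzMap.denseRange_toLpCLM (E := EuclideanSpace ℝ (Fin d))
    (F := ℂ) (p := 2) (μ := volume) ENNReal.ofNat_ne_top) ψ (isClosed_eq
      (continuous_fourier_L2.comp (translateL2 w).continuous)
      ((boundedMul (memLp_fourierChar w)).continuous.comp continuous_fourier_L2)) fun φ => ?_
  have e : translateL2 w (φ.toLp 2 volume) = (φ.compSubConstCLM ℂ (-w)).toLp 2 volume := by
    refine Lp.ext ?_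
    filter_upwards [coeFn_translateL2 w (φ.toLp 2 volume),
      (measurePreserving_add_right volume w).quasiMeasurePreserving.ae (φ.coeFn_toLp 2 volume),
      (φ.compSubConstCLM ℂ (-w)).coeFn_toLp 2 volume] with x h1 h2 h3
    rw [h1, h2, h3, SchwartzMap.compSubConstCLM_apply, sub_neg_eq_add]
  rw [SchwartzMap.toLpCLM_apply, e, SchwartzMap.toLp_fourier_eq, SchwartzMap.toLp_fourier_eq]
  refine Lp.ext ?_
  filter_upwards [(𝓕 (φ.compSubConstCLM ℂ (-w))).coeFn_toLp 2 volume,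
    coeFn_boundedMul (memLp_fourierChar w) ((𝓕 φ).toLp 2 volume),
    (𝓕 φ).coeFn_toLp 2 volume] with ξ h1 h2 h3
  rw [h1, h2, h3, SchwartzMap.fourier_coe, SchwartzMap.fourier_coe]
  have e2 : (φ.compSubConstCLM ℂ (-w) : EuclideanSpace ℝ (Fin d) → ℂ) = φ ∘ fun v => v + w := by
    funext x
    rw [SchwartzMap.compSubConstCLM_apply, sub_neg_eq_add, Function.comp_apply]
  rw [e2]
  exact congrFun (VectorFourier.fourierIntegral_comp_add_right Real.fourierChar volume
    (innerₗ (EuclideanSpace ℝ (Fin d))) φ w) ξ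

/-- The centred Gaussian law on `ℝᵈ` with covariance matrix `r I`. -/
def brownianLaw (d : ℕ) (r : ℝ) : Measure (EuclideanSpace ℝ (Fin d)) :=
  (stdGaussian (EuclideanSpace ℝ (Fin d))).map (fun x => √r • x)

instance (r : ℝ) : IsProbabilityMeasure (brownianLaw d r) :=
  Measure.isProbabilityMeasure_map (measurable_const_smul (√r)).aemeasurable

/-- The characteristic function of Brownian increments is the Fourier symbol of `e^{-r H₀}`. -/
theorem integral_fourierChar_brownianLaw {r : ℝ} (hr : 0 ≤ r) (ξ : EuclideanSpace ℝ (Fin d)) :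
    ∫ w, (Real.fourierChar (inner ℝ w ξ) : ℂ) ∂(brownianLaw d r) = heatSymbol r ξ := by
  rw [brownianLaw, integral_map (measurable_const_smul (√r)).aemeasurable
    (Continuous.aestronglyMeasurable (by fun_prop))]
  have h := charFun_stdGaussian ((2 * π * √r) • ξ)
  rw [charFun_apply] at h
  have e : ∀ w : EuclideanSpace ℝ (Fin d), (Real.fourierChar (inner ℝ (√r • w) ξ) : ℂ) =
      Complex.exp (inner ℝ w ((2 * π * √r) • ξ) * Complex.I) := by
    intro w
    rw [Real.fourierChar_apply, real_inner_smul_left, real_inner_smul_right]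
    congr 2
    push_cast
    ring
  simp only [e]
  rw [h, heatSymbol, toRightHalfPlane_of_nonneg (by simpa using hr), kineticSymbol, norm_smul]
  congr 1
  rw [Real.norm_of_nonneg (by positivity)]
  have h2 : ((√r : ℝ) : ℂ) ^ 2 = (r : ℂ) := by
    rw [← Complex.ofReal_pow, Real.sq_sqrt hr]
  push_cast
  linear_combination (-(2 * π ^ 2 * (‖ξ‖ : ℂ) ^ 2)) * h2

theorem memLp_comp_fst_add {Y : Ω → EuclideanSpace ℝ (Fin d)} (hY : Measurable Y) (ψ : L2Space d) :
    MemLp (fun p : EuclideanSpace ℝ (Fin d) × Ω => ψ (p.1 + Y p.2)) 2 (volume.prod m) :=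
  (Lp.memLp ψ).comp_measurePreserving (measurePreserving_fst_add hY)

theorem memLp_comp_fst (φ : L2Space d) :
    MemLp (fun p : EuclideanSpace ℝ (Fin d) × Ω => φ p.1) 2 (volume.prod m) :=
  (Lp.memLp φ).comp_measurePreserving measurePreserving_fst

/-- The weak form of the identity between Gaussian averages of translations and the heat
semigroup, by Plancherel's theorem and the characteristic function of the Gaussian law. -/
theorem integral_inner_brownianLaw {r : ℝ} (hr : 0 ≤ r) (φ ψ : L2Space d) :
    ∫ p : EuclideanSpace ℝ (Fin d) × EuclideanSpace ℝ (Fin d),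
      inner ℂ (φ p.1) (ψ (p.1 + p.2)) ∂(volume.prod (brownianLaw d r)) =
        inner ℂ φ (freeSemigroup d r ψ) := by
  have hint : Integrable (fun p : EuclideanSpace ℝ (Fin d) × EuclideanSpace ℝ (Fin d) =>
      inner ℂ (φ p.1) (ψ (p.1 + p.2))) (volume.prod (brownianLaw d r)) :=
    integrable_inner_of_memLp_two (memLp_comp_fst φ) (memLp_comp_fst_add measurable_id ψ)
  rw [integral_prod_symm _ hint]
  set p : EuclideanSpace ℝ (Fin d) → ℂ :=
    fun ξ => inner ℂ ((𝓕 φ : L2Space d) ξ) ((𝓕 ψ : L2Space d) ξ) with hp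
  have hpint : Integrable p := L2.integrable_inner _ _
  have h1 : ∀ w : EuclideanSpace ℝ (Fin d), ∫ x, inner ℂ (φ x) (ψ (x + w)) =
      ∫ ξ, (Real.fourierChar (inner ℝ w ξ) : ℂ) * p ξ := by
    intro w
    have h2 : ∫ x, inner ℂ (φ x) (ψ (x + w)) = inner ℂ φ (translateL2 w ψ) := by
      rw [L2.inner_def]
      refine integral_congr_ae ?_
      filter_upwards [coeFn_translateL2 w ψ] with x hx
      rw [hx]
    rw [h2, inner_L2_eq_fourier, fourier_translateL2]
    refine integral_congr_ae ?_
    filter_upwards [coeFn_boundedMul (memLp_fourierChar w) (𝓕 ψ : L2Space d)] with ξ hξ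
    rw [hξ, ← smul_eq_mul, inner_smul_right]
  simp only [h1]
  rw [integral_integral_swap]
  · rw [inner_L2_eq_fourier]
    refine integral_congr_ae ?_
    filter_upwards [fourier_freeSemigroup r ψ] with ξ hξ
    rw [integral_mul_const, integral_fourierChar_brownianLaw hr, hξ,
      ← smul_eq_mul (heatSymbol (r : ℂ) ξ) ((𝓕 ψ : L2Space d) ξ), inner_smul_right]
  · have h3 : Integrable (fun q : EuclideanSpace ℝ (Fin d) × EuclideanSpace ℝ (Fin d) => p q.2)
        ((brownianLaw d r).prod volume) := hpint.comp_snd _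
    refine h3.norm.mono (AEStronglyMeasurable.mul (Continuous.aestronglyMeasurable (by fun_prop))
      h3.aestronglyMeasurable) (ae_of_all _ fun q => ?_)
    rw [Function.uncurry, norm_mul, norm_norm]
    exact mul_le_of_le_one_left (norm_nonneg _) (Circle.norm_coe _).le

/-- The heat semigroup is averaging over Gaussian translations, pointwise almost everywhere. -/
theorem ae_integral_brownianLaw {r : ℝ} (hr : 0 ≤ r) (ψ : L2Space d) :
    ∀ᵐ x, ∫ w, ψ (x + w) ∂(brownianLaw d r) = freeSemigroup d r ψ x := by
  filter_upwards [ae_eq_integral_of_forall_inner_eq (memLp_comp_fst_add measurable_id ψ)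
    (integral_inner_brownianLaw hr · ψ)] with x hx
  exact hx.2.symm

end Translation

/-! ### Wiener paths started from Lebesgue measure -/

section WienerPaths

variable {d : ℕ} {t : ℝ}

instance : SecondCountableTopology (WienerSpace d t) :=
  inferInstanceAs (SecondCountableTopology {y : PathSpace d t // ∀ h : (0 : ℝ) ∈ Icc (0 : ℝ) t,
    y ⟨0, h⟩ = 0})

instance : PolishSpace (WienerSpace d t) := by
  have h : IsClosed {y : PathSpace d t | ∀ h : (0 : ℝ) ∈ Icc (0 : ℝ) t, y ⟨0, h⟩ = 0} := by
    simp only [Set.ofPred_forall]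
    exact isClosed_iInter fun h => isClosed_eq (continuous_eval_const _) continuous_const
  exact h.polishSpace

theorem continuous_wienerSpace_val : Continuous fun y : WienerSpace d t => y.1 :=
  continuous_subtype_val

theorem continuous_wienerSpace_eval (u : Icc (0 : ℝ) t) :
    Continuous fun y : WienerSpace d t => y.1 u :=
  (continuous_eval_const u).comp continuous_wienerSpace_val

/-- The path `y`, stopped at time `s`. -/
def stopPath (s : Icc (0 : ℝ) t) (y : WienerSpace d t) : WienerSpace d t :=
  ⟨y.1.comp ⟨fun u => min u s, by fun_prop⟩, fun h => by
    have e : min (⟨0, h⟩ : Icc (0 : ℝ) t) s = ⟨0, h⟩ := min_eq_left s.2.1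
    simp only [ContinuousMap.comp_apply, ContinuousMap.coe_mk, e]
    exact y.2 h⟩

theorem stopPath_apply (s u : Icc (0 : ℝ) t) (y : WienerSpace d t) :
    (stopPath s y).1 u = y.1 (min u s) := rfl

theorem measurable_stopPath (s : Icc (0 : ℝ) t) : Measurable (stopPath (d := d) s) := by
  have h : Continuous (stopPath (d := d) s) := Continuous.subtype_mk
    ((ContinuousMap.continuous_precomp ⟨fun u => min u s, by fun_prop⟩).comp
      continuous_wienerSpace_val) _
  exact h.measurable

/-- The Borel sets of the Wiener space are generated by countably many evaluations, so that the
stopped path, as a random element of the Wiener space, is independent of later increments. -/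
theorem IsWienerMeasure.indepFun_stopPath {m : Measure (WienerSpace d t)} (hm : IsWienerMeasure m)
    {s r : Icc (0 : ℝ) t} (hsr : s ≤ r) :
    IndepFun (stopPath s) (fun y => y.1 r - y.1 s) m := by
  have h0 : (0 : ℝ) ∈ Icc (0 : ℝ) t := ⟨le_rfl, s.2.1.trans s.2.2⟩
  have : Nonempty (Icc (0 : ℝ) t) := ⟨s⟩
  set ι : WienerSpace d t → ℕ → EuclideanSpace ℝ (Fin d) :=
    fun y n => y.1 (TopologicalSpace.denseSeq (Icc (0 : ℝ) t) n) with hι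
  have hemb : MeasurableEmbedding ι := by
    refine Continuous.measurableEmbedding
      (continuous_pi fun n => continuous_wienerSpace_eval _) fun y z hyz => ?_
    refine Subtype.ext (DFunLike.coe_injective ?_)
    exact (TopologicalSpace.denseRange_denseSeq (Icc (0 : ℝ) t)).equalizer y.1.continuous
      z.1.continuous hyz
  have h := hm.indep_increments.indepFun_past
    (fun i => (continuous_wienerSpace_eval i).measurable) (b := ⟨0, h0⟩) (fun i => i.2.1)
    (fun y => y.2 h0) hsr (fun n : ℕ => min (TopologicalSpace.denseSeq (Icc (0 : ℝ) t) n) s)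
    (fun n => min_le_right _ _)
  rw [IndepFun_iff_Indep] at h ⊢
  have e : (fun (y : WienerSpace d t) (n : ℕ) =>
      y.1 (min (TopologicalSpace.denseSeq (Icc (0 : ℝ) t) n) s)) = ι ∘ stopPath s := rfl
  rw [e, ← MeasurableSpace.comap_comp, hemb.comap_eq] at h
  exact h

theorem IsWienerMeasure.map_increment {m : Measure (WienerSpace d t)} (hm : IsWienerMeasure m)
    {s r : Icc (0 : ℝ) t} (hsr : s ≤ r) :
    m.map (fun y => y.1 r - y.1 s) = brownianLaw d (r - s) :=
  hm.law_increment s r hsr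

/-- The position at time `s` of the path `y` started from `x`, for `p = (x, y)`; the path is
extended to all times `s` by constants. -/
def wienerPath (ht : 0 ≤ t) (s : ℝ) (p : EuclideanSpace ℝ (Fin d) × WienerSpace d t) :
    EuclideanSpace ℝ (Fin d) :=
  p.1 + p.2.1 (projIcc 0 t ht s)

theorem continuous_wienerPath (ht : 0 ≤ t) : Continuous
    fun q : ℝ × EuclideanSpace ℝ (Fin d) × WienerSpace d t => wienerPath ht q.1 q.2 := by
  have h1 : Continuous fun q : ℝ × EuclideanSpace ℝ (Fin d) × WienerSpace d t => q.2.2.1 :=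
    continuous_wienerSpace_val.comp (continuous_snd.comp continuous_snd)
  have h2 : Continuous fun q : ℝ × EuclideanSpace ℝ (Fin d) × WienerSpace d t =>
      projIcc 0 t ht q.1 := continuous_projIcc.comp continuous_fst
  unfold wienerPath
  exact (continuous_fst.comp continuous_snd).add (h1.eval h2)

theorem pathAt_pathShift (ht : 0 ≤ t) {s : ℝ} (hs : s ∈ Icc 0 t) (y : WienerSpace d t)
    (x : EuclideanSpace ℝ (Fin d)) : pathAt (pathShift y x) s = wienerPath ht s (x, y) := by
  rw [pathAt, dif_pos hs, wienerPath, projIcc_of_mem ht hs, pathShift, add_comm]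
  rfl

theorem wienerPath_zero (ht : 0 ≤ t) (p : EuclideanSpace ℝ (Fin d) × WienerSpace d t) :
    wienerPath ht 0 p = p.1 := by
  have h0 : (0 : ℝ) ∈ Icc (0 : ℝ) t := ⟨le_rfl, ht⟩
  rw [wienerPath, projIcc_of_mem ht h0, p.2.2 h0, add_zero]

theorem wienerPath_stopPath (ht : 0 ≤ t) {s u : ℝ} (hs : s ∈ Icc 0 t) (hu : u ≤ s)
    (x : EuclideanSpace ℝ (Fin d)) (y : WienerSpace d t) :
    wienerPath ht u (x, stopPath ⟨s, hs⟩ y) = wienerPath ht u (x, y) := by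
  have e : min (projIcc 0 t ht u) ⟨s, hs⟩ = projIcc 0 t ht u := by
    refine min_eq_left ?_
    rw [← projIcc_of_mem ht hs]
    exact monotone_projIcc ht hu
  simp only [wienerPath, stopPath_apply, e]

section Measure

variable {m : Measure (WienerSpace d t)} [IsProbabilityMeasure m]

theorem measurePreserving_wienerPath (ht : 0 ≤ t) (s : ℝ) :
    MeasurePreserving (wienerPath ht s) ((volume : Measure (EuclideanSpace ℝ (Fin d))).prod m)
      volume :=
  measurePreserving_fst_add (continuous_wienerSpace_eval _).measurable

theorem memLp_comp_wienerPath (ht : 0 ≤ t) (s : ℝ) (ψ : L2Space d) :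
    MemLp (fun p => ψ (wienerPath ht s p)) 2
      ((volume : Measure (EuclideanSpace ℝ (Fin d))).prod m) :=
  (Lp.memLp ψ).comp_measurePreserving (measurePreserving_wienerPath ht s)

theorem memLp_mul_comp_wienerPath (ht : 0 ≤ t) (s : ℝ) (ψ : L2Space d)
    {G : EuclideanSpace ℝ (Fin d) × WienerSpace d t → ℂ} (hG : Measurable G) {C : ℝ}
    (hGC : ∀ p, ‖G p‖ ≤ C) :
    MemLp (fun p => G p * ψ (wienerPath ht s p)) 2
      ((volume : Measure (EuclideanSpace ℝ (Fin d))).prod m) := by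
  have h := memLp_comp_wienerPath (m := m) ht s ψ
  refine h.of_le_mul (hG.aestronglyMeasurable.mul h.1) (c := C) (ae_of_all _ fun p => ?_)
  rw [norm_mul]
  exact mul_le_mul_of_nonneg_right (hGC p) (norm_nonneg _)

theorem integrable_inner_wienerPath (ht : 0 ≤ t) (s : ℝ) (φ ψ : L2Space d)
    {G : EuclideanSpace ℝ (Fin d) × WienerSpace d t → ℂ} (hG : Measurable G) {C : ℝ}
    (hGC : ∀ p, ‖G p‖ ≤ C) :
    Integrable (fun p => inner ℂ (φ p.1) (G p * ψ (wienerPath ht s p)))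
      ((volume : Measure (EuclideanSpace ℝ (Fin d))).prod m) :=
  integrable_inner_of_memLp_two (memLp_comp_fst φ) (memLp_mul_comp_wienerPath ht s ψ hG hGC)

end Measure

/-- The Markov property: given the path up to time `s`, a function of the position at time `r` can
be replaced by its image under the heat semigroup at the position at time `s`. -/
theorem IsWienerMeasure.integral_inner_markov {m : Measure (WienerSpace d t)}
    (hm : IsWienerMeasure m) (ht : 0 ≤ t) {s r : ℝ} (hs : s ∈ Icc 0 t) (hr : r ∈ Icc 0 t)
    (hsr : s ≤ r) {G : EuclideanSpace ℝ (Fin d) × WienerSpace d t → ℂ} (hG : Measurable G) {C : ℝ}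
    (hGC : ∀ p, ‖G p‖ ≤ C) (hGs : ∀ x y, G (x, stopPath ⟨s, hs⟩ y) = G (x, y)) (φ ψ : L2Space d) :
    ∫ p, inner ℂ (φ p.1) (G p * ψ (wienerPath ht r p)) ∂(volume.prod m) =
      ∫ p, inner ℂ (φ p.1) (G p * freeSemigroup d (r - s : ℝ) ψ (wienerPath ht s p))
        ∂(volume.prod m) := by
  have := hm.isProbabilityMeasure
  have hsr' : (⟨s, hs⟩ : Icc (0 : ℝ) t) ≤ ⟨r, hr⟩ := hsr
  have hI1 := integrable_inner_wienerPath (m := m) ht r φ ψ hG hGC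
  have hI2 := integrable_inner_wienerPath (m := m) ht s φ (freeSemigroup d (r - s : ℝ) ψ) hG hGC
  rw [integral_prod _ hI1, integral_prod _ hI2]
  refine integral_congr_ae ?_
  have hK := (measurePreserving_wienerPath (m := m) ht s).quasiMeasurePreserving.ae
    (ae_integral_brownianLaw (sub_nonneg.2 hsr) ψ)
  filter_upwards [Measure.ae_ae_of_ae_prod hK, hI1.prod_right_ae] with x hx hxi
  -- the integrand as a function of the stopped path and of the increment
  set h : WienerSpace d t × EuclideanSpace ℝ (Fin d) → ℂ :=
    fun q => inner ℂ (φ x) (G (x, q.1) * ψ (wienerPath ht s (x, q.1) + q.2)) with hh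
  have hsplit : ∀ y : WienerSpace d t, inner ℂ (φ x) (G (x, y) * ψ (wienerPath ht r (x, y))) =
      h (stopPath ⟨s, hs⟩ y, y.1 ⟨r, hr⟩ - y.1 ⟨s, hs⟩) := by
    intro y
    simp only [hh, hGs, wienerPath_stopPath ht hs le_rfl]
    congr 3
    simp only [wienerPath, projIcc_of_mem ht hs, projIcc_of_mem ht hr]
    abel_nf
  have hpath : Measurable fun q : WienerSpace d t × EuclideanSpace ℝ (Fin d) =>
      wienerPath ht s (x, q.1) + q.2 := by
    have h1 : Continuous fun q : WienerSpace d t × EuclideanSpace ℝ (Fin d) =>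
        wienerPath ht s (x, q.1) := (continuous_wienerPath ht).comp
          (continuous_const.prodMk (continuous_const.prodMk continuous_fst))
    exact (h1.add continuous_snd).measurable
  have hhm : StronglyMeasurable h := by
    have h1 : StronglyMeasurable fun q : WienerSpace d t × EuclideanSpace ℝ (Fin d) =>
        ψ (wienerPath ht s (x, q.1) + q.2) := (Lp.stronglyMeasurable ψ).comp_measurable hpath
    have h2 : Measurable fun q : WienerSpace d t × EuclideanSpace ℝ (Fin d) => G (x, q.1) :=
      hG.comp (measurable_const.prodMk measurable_fst)
    exact StronglyMeasurable.inner stronglyMeasurable_const (h2.stronglyMeasurable.mul h1)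
  have hpair : Measurable fun y : WienerSpace d t =>
      (stopPath ⟨s, hs⟩ y, y.1 ⟨r, hr⟩ - y.1 ⟨s, hs⟩) :=
    (measurable_stopPath _).prodMk ((continuous_wienerSpace_eval _).measurable.sub
      (continuous_wienerSpace_eval _).measurable)
  have hinc : Measurable fun y : WienerSpace d t => y.1 ⟨r, hr⟩ - y.1 ⟨s, hs⟩ :=
    (continuous_wienerSpace_eval _).measurable.sub (continuous_wienerSpace_eval _).measurable
  have hlaw : m.map (fun y => (stopPath ⟨s, hs⟩ y, y.1 ⟨r, hr⟩ - y.1 ⟨s, hs⟩)) =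
      (m.map (stopPath ⟨s, hs⟩)).prod (brownianLaw d (r - s)) := by
    rw [(indepFun_iff_map_prod_eq_prod_map_map (measurable_stopPath _).aemeasurable
      hinc.aemeasurable).1 (hm.indepFun_stopPath hsr'), hm.map_increment hsr']
  have : IsProbabilityMeasure (m.map (stopPath (⟨s, hs⟩ : Icc (0 : ℝ) t))) :=
    Measure.isProbabilityMeasure_map (measurable_stopPath _).aemeasurable
  have hhi : Integrable h ((m.map (stopPath ⟨s, hs⟩)).prod (brownianLaw d (r - s))) := by
    rw [← hlaw, integrable_map_measure hhm.aestronglyMeasurable hpair.aemeasurable]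
    exact hxi.congr (ae_of_all _ hsplit)
  calc ∫ y, inner ℂ (φ x) (G (x, y) * ψ (wienerPath ht r (x, y))) ∂m
      = ∫ y, h (stopPath ⟨s, hs⟩ y, y.1 ⟨r, hr⟩ - y.1 ⟨s, hs⟩) ∂m :=
        integral_congr_ae (ae_of_all _ hsplit)
    _ = ∫ q, h q ∂((m.map (stopPath ⟨s, hs⟩)).prod (brownianLaw d (r - s))) := by
        rw [← hlaw, integral_map hpair.aemeasurable hhm.aestronglyMeasurable]
    _ = ∫ y, ∫ w, h (stopPath ⟨s, hs⟩ y, w) ∂(brownianLaw d (r - s)) ∂m := by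
        rw [integral_prod _ hhi, integral_map (measurable_stopPath _).aemeasurable
          hhi.1.integral_prod_right']
    _ = ∫ y, inner ℂ (φ x) (G (x, y) * freeSemigroup d (r - s : ℝ) ψ (wienerPath ht s (x, y)))
          ∂m := by
        refine integral_congr_ae ?_
        filter_upwards [hx] with y hy
        simp only [hh, hGs, wienerPath_stopPath ht hs le_rfl]
        rw [← hy]
        simp only [RCLike.inner_apply]
        rw [integral_mul_const, integral_const_mul]

end WienerPaths

/-! ### The Feynman–Kac formula -/

section FeynmanKac

variable {d : ℕ} {t : ℝ} {U : EuclideanSpace ℝ (Fin d) → ℝ}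

/-- The Feynman–Kac weight `exp (-∫₀ˢ U(x + y(u)) du)` of the path `x + y`, for `p = (x, y)`. -/
def feynmanKacWeight (U : EuclideanSpace ℝ (Fin d) → ℝ) (ht : 0 ≤ t) (s : ℝ)
    (p : EuclideanSpace ℝ (Fin d) × WienerSpace d t) : ℝ :=
  Real.exp (-∫ u in (0 : ℝ)..s, U (wienerPath ht u p))

theorem measurable_comp_wienerPath (hU : Measurable U) (ht : 0 ≤ t) : Measurable
    fun q : ℝ × EuclideanSpace ℝ (Fin d) × WienerSpace d t => U (wienerPath ht q.1 q.2) :=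
  hU.comp (continuous_wienerPath ht).measurable

theorem measurable_feynmanKacWeight (hU : Measurable U) (ht : 0 ≤ t) : Measurable
    fun q : ℝ × EuclideanSpace ℝ (Fin d) × WienerSpace d t => feynmanKacWeight U ht q.1 q.2 := by
  have h1 : Measurable fun r : (ℝ × EuclideanSpace ℝ (Fin d) × WienerSpace d t) × ℝ =>
      U (wienerPath ht (r.1.1 * r.2) r.1.2) :=
    (measurable_comp_wienerPath hU ht).comp
      (((measurable_fst.comp measurable_fst).mul measurable_snd).prodMk
        (measurable_snd.comp measurable_fst))
  have h2 : Measurable fun q : ℝ × EuclideanSpace ℝ (Fin d) × WienerSpace d t =>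
      ∫ v in Ioc (0 : ℝ) 1, U (wienerPath ht (q.1 * v) q.2) :=
    (h1.stronglyMeasurable.integral_prod_right' (ν := volume.restrict (Ioc (0 : ℝ) 1))).measurable
  have h3 : (fun q : ℝ × EuclideanSpace ℝ (Fin d) × WienerSpace d t =>
      feynmanKacWeight U ht q.1 q.2) = fun q =>
        Real.exp (-(q.1 * ∫ v in Ioc (0 : ℝ) 1, U (wienerPath ht (q.1 * v) q.2))) := by
    funext q
    rw [feynmanKacWeight, ← intervalIntegral.integral_of_le zero_le_one, ← smul_eq_mul,
      intervalIntegral.smul_integral_comp_mul_left (fun u => U (wienerPath ht u q.2)), mul_zero,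
      mul_one]
  -- after rescaling, the time integral has fixed limits and depends measurably on the parameters
  rw [h3]
  exact Real.measurable_exp.comp (measurable_fst.mul h2).neg

theorem feynmanKacWeight_le (hU1 : ∀ x, |U x| ≤ 1) (ht : 0 ≤ t) {s : ℝ} (hs : s ∈ Icc 0 t)
    (p : EuclideanSpace ℝ (Fin d) × WienerSpace d t) : feynmanKacWeight U ht s p ≤ Real.exp t := by
  refine Real.exp_le_exp.2 ?_
  have h := intervalIntegral.norm_integral_le_of_norm_le_const (a := 0) (b := s)
    (f := fun u => U (wienerPath ht u p)) (C := 1) fun u _ => hU1 _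
  rw [one_mul, sub_zero, abs_of_nonneg hs.1] at h
  exact (neg_le_abs _).trans (h.trans hs.2)

theorem norm_feynmanKacWeight_le (hU1 : ∀ x, |U x| ≤ 1) (ht : 0 ≤ t) {s : ℝ} (hs : s ∈ Icc 0 t)
    (p : EuclideanSpace ℝ (Fin d) × WienerSpace d t) :
    ‖(feynmanKacWeight U ht s p : ℂ)‖ ≤ Real.exp t := by
  have h : 0 ≤ feynmanKacWeight U ht s p := (Real.exp_pos _).le
  rw [Complex.norm_real, Real.norm_of_nonneg h]
  exact feynmanKacWeight_le hU1 ht hs p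

theorem measurable_ofReal_feynmanKacWeight (hU : Measurable U) (ht : 0 ≤ t) (s : ℝ) :
    Measurable fun p : EuclideanSpace ℝ (Fin d) × WienerSpace d t =>
      (feynmanKacWeight U ht s p : ℂ) :=
  Complex.measurable_ofReal.comp
    ((measurable_feynmanKacWeight hU ht).comp (measurable_const.prodMk measurable_id))

/-- The weight at time `s` depends on the path up to time `s` only. -/
theorem feynmanKacWeight_stopPath (ht : 0 ≤ t) {s : ℝ} (hs : s ∈ Icc 0 t)
    (x : EuclideanSpace ℝ (Fin d)) (y : WienerSpace d t) :
    feynmanKacWeight U ht s (x, stopPath ⟨s, hs⟩ y) = feynmanKacWeight U ht s (x, y) := by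
  rw [feynmanKacWeight, feynmanKacWeight]
  congr 2
  refine intervalIntegral.integral_congr fun u hu => ?_
  rw [uIcc_of_le hs.1] at hu
  simp only [wienerPath_stopPath ht hs hu.2]

theorem feynmanKacWeight_eq_one_sub (hU : Measurable U) (hU1 : ∀ x, |U x| ≤ 1) (ht : 0 ≤ t) {s : ℝ}
    (hs : 0 ≤ s) (p : EuclideanSpace ℝ (Fin d) × WienerSpace d t) :
    feynmanKacWeight U ht s p =
      1 - ∫ u in (0 : ℝ)..s, feynmanKacWeight U ht u p * U (wienerPath ht u p) :=
  exp_neg_integral_eq_one_sub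
    ((measurable_comp_wienerPath hU ht).comp (measurable_id.prodMk measurable_const))
    (fun _ => hU1 _) hs

/-- The sesquilinear form `∫ φ̄(x) exp (-∫₀ˢ U(x + y(u)) du) ψ(x + y(s)) m(dy) dx`. -/
def feynmanKacForm (U : EuclideanSpace ℝ (Fin d) → ℝ) (m : Measure (WienerSpace d t)) (ht : 0 ≤ t)
    (s : ℝ) (φ ψ : L2Space d) : ℂ :=
  ∫ p, inner ℂ (φ p.1) ((feynmanKacWeight U ht s p : ℂ) * ψ (wienerPath ht s p)) ∂(volume.prod m)

theorem norm_feynmanKacForm_le {m : Measure (WienerSpace d t)} [IsProbabilityMeasure m]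
    (hU : Measurable U) (hU1 : ∀ x, |U x| ≤ 1) (ht : 0 ≤ t) {s : ℝ} (hs : s ∈ Icc 0 t)
    (φ ψ : L2Space d) : ‖feynmanKacForm U m ht s φ ψ‖ ≤ Real.exp t * ‖φ‖ * ‖ψ‖ := by
  have hb := norm_feynmanKacWeight_le (d := d) (U := U) hU1 ht hs
  have h1 := memLp_mul_comp_wienerPath (m := m) ht s ψ
    (measurable_ofReal_feynmanKacWeight hU ht s) hb
  have hf := measurePreserving_fst (μ := (volume : Measure (EuclideanSpace ℝ (Fin d)))) (ν := m)
  have hX := measurePreserving_wienerPath (m := m) ht s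
  have h2 : feynmanKacForm U m ht s φ ψ =
      inner ℂ (Lp.compMeasurePreserving Prod.fst hf φ) h1.toLp := by
    rw [L2.inner_def, feynmanKacForm]
    refine integral_congr_ae ?_
    filter_upwards [Lp.coeFn_compMeasurePreserving φ hf, h1.coeFn_toLp] with p h3 h4
    rw [h3, h4, Function.comp_apply]
  have h3 : ‖h1.toLp‖ ≤ Real.exp t * ‖ψ‖ := by
    rw [← Lp.norm_compMeasurePreserving ψ hX]
    refine Lp.norm_le_mul_norm_of_ae_le_mul ?_
    filter_upwards [Lp.coeFn_compMeasurePreserving ψ hX, h1.coeFn_toLp] with p h3 h4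
    rw [h3, h4, Function.comp_apply, norm_mul]
    exact mul_le_mul_of_nonneg_right (hb p) (norm_nonneg _)
  rw [h2]
  refine (norm_inner_le_norm _ _).trans ?_
  rw [Lp.norm_compMeasurePreserving, mul_comm (Real.exp t), mul_assoc]
  gcongr

/-- The weak form of Duhamel's formula for the Feynman–Kac form: expand the weight by the
fundamental theorem of calculus and apply the Markov property under the time integral. -/
theorem IsWienerMeasure.feynmanKacForm_duhamel {m : Measure (WienerSpace d t)}
    (hm : IsWienerMeasure m) (hU : Measurable U) (hU1 : ∀ x, |U x| ≤ 1) (ht : 0 ≤ t)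
    {A : L2Space d →L[ℂ] L2Space d} (hA : ∀ ψ, A ψ =ᵐ[volume] fun x => -((U x : ℂ) * ψ x))
    {r : ℝ} (hr : r ∈ Icc 0 t) (φ ψ : L2Space d) :
    IntervalIntegrable
      (fun s => feynmanKacForm U m ht s φ (A (freeSemigroup d (r - s : ℝ) ψ))) volume 0 r ∧
    feynmanKacForm U m ht r φ ψ = inner ℂ φ (freeSemigroup d r ψ) +
      ∫ s in (0 : ℝ)..r, feynmanKacForm U m ht s φ (A (freeSemigroup d (r - s : ℝ) ψ)) := by
  have := hm.isProbabilityMeasure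
  set μ : Measure (EuclideanSpace ℝ (Fin d) × WienerSpace d t) := volume.prod m with hμ
  set G : ℝ → EuclideanSpace ℝ (Fin d) × WienerSpace d t → ℂ := fun s p =>
    ((feynmanKacWeight U ht s p * U (wienerPath ht s p) : ℝ) : ℂ) with hG
  have hGm : Measurable (Function.uncurry G) := Complex.measurable_ofReal.comp
    ((measurable_feynmanKacWeight hU ht).mul (measurable_comp_wienerPath hU ht))
  have hGms : ∀ s, Measurable (G s) := fun s => hGm.comp (measurable_const.prodMk measurable_id)
  have hGb : ∀ s ∈ Icc 0 t, ∀ p, ‖G s p‖ ≤ Real.exp t := by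
    intro s hs p
    simp only [hG, Complex.ofReal_mul, norm_mul]
    rw [Complex.norm_real (U _)]
    exact (mul_le_of_le_one_right (norm_nonneg _) (hU1 _)).trans
      (norm_feynmanKacWeight_le hU1 ht hs p)
  -- the Markov property at the intermediate time `s`
  have hmarkov : ∀ s ∈ Ioc 0 r, ∫ p, inner ℂ (φ p.1) (G s p * ψ (wienerPath ht r p)) ∂μ =
      -feynmanKacForm U m ht s φ (A (freeSemigroup d (r - s : ℝ) ψ)) := by
    intro s hs
    have hst : s ∈ Icc 0 t := ⟨hs.1.le, hs.2.trans hr.2⟩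
    rw [hm.integral_inner_markov ht hst hr hs.2 (hGms s) (hGb s hst)
      (fun x y => by simp only [hG, feynmanKacWeight_stopPath, wienerPath_stopPath ht hst le_rfl]),
      feynmanKacForm, ← integral_neg]
    refine integral_congr_ae ?_
    filter_upwards [(measurePreserving_wienerPath (m := m) ht s).quasiMeasurePreserving.ae
      (hA (freeSemigroup d (r - s : ℝ) ψ))] with p hp
    rw [hp, ← inner_neg_right]
    congr 1
    simp only [hG]
    push_cast
    ring
  have hφψ := integrable_inner_wienerPath (m := m) ht r φ ψ (G := fun _ => 1) measurable_const
    (C := 1) (fun _ => by simp)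
  simp only [one_mul] at hφψ
  have hint : Integrable (Function.uncurry fun (s : ℝ)
      (p : EuclideanSpace ℝ (Fin d) × WienerSpace d t) =>
        inner ℂ (φ p.1) (G s p * ψ (wienerPath ht r p))) ((volume.restrict (Ioc 0 r)).prod μ) := by
    have h1 : Integrable (fun q : ℝ × EuclideanSpace ℝ (Fin d) × WienerSpace d t =>
        inner ℂ (φ q.2.1) (ψ (wienerPath ht r q.2))) ((volume.restrict (Ioc 0 r)).prod μ) :=
      hφψ.comp_snd _
    have h2 : Integrable (fun q : ℝ × EuclideanSpace ℝ (Fin d) × WienerSpace d t =>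
        G q.1 q.2 * inner ℂ (φ q.2.1) (ψ (wienerPath ht r q.2)))
          ((volume.restrict (Ioc 0 r)).prod μ) := by
      refine h1.bdd_mul (c := Real.exp t) hGm.aestronglyMeasurable ?_
      have h3 : ∀ᵐ s ∂(volume.restrict (Ioc 0 r)), s ∈ Ioc 0 r := ae_restrict_mem measurableSet_Ioc
      filter_upwards [Measure.quasiMeasurePreserving_fst.ae h3] with q hq
      exact hGb _ ⟨hq.1.le, hq.2.trans hr.2⟩ _
    refine h2.congr (ae_of_all _ fun q => ?_)
    simp only [Function.uncurry, ← smul_eq_mul (G q.1 q.2), inner_smul_right]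
  have hII : IntegrableOn (fun s => -feynmanKacForm U m ht s φ (A (freeSemigroup d (r - s : ℝ) ψ)))
      (Ioc 0 r) := by
    refine hint.integral_prod_left.congr ?_
    filter_upwards [ae_restrict_mem measurableSet_Ioc] with s hs
    exact hmarkov s hs
  refine ⟨(intervalIntegrable_iff_integrableOn_Ioc_of_le hr.1).2 (by simpa using hII.neg), ?_⟩
  -- the fundamental theorem of calculus along the path
  have hexp : ∀ p, inner ℂ (φ p.1) ((feynmanKacWeight U ht r p : ℂ) * ψ (wienerPath ht r p)) =
      inner ℂ (φ p.1) (ψ (wienerPath ht r p)) -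
        ∫ s in Ioc 0 r, inner ℂ (φ p.1) (G s p * ψ (wienerPath ht r p)) := by
    intro p
    rw [feynmanKacWeight_eq_one_sub hU hU1 ht hr.1, intervalIntegral.integral_of_le hr.1]
    simp only [hG, RCLike.inner_apply]
    rw [integral_mul_const, integral_mul_const, integral_complex_ofReal]
    push_cast
    ring
  have hfree : ∫ p, inner ℂ (φ p.1) (ψ (wienerPath ht r p)) ∂μ =
      inner ℂ φ (freeSemigroup d r ψ) := by
    have h0 : (0 : ℝ) ∈ Icc 0 t := ⟨le_rfl, ht⟩
    have h1 := hm.integral_inner_markov ht h0 hr hr.1 (G := fun _ => 1) measurable_const (C := 1)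
      (fun _ => by simp) (fun _ _ => rfl) φ ψ
    simp only [one_mul, wienerPath_zero, sub_zero] at h1
    rw [h1, L2.inner_def]
    rw [integral_fun_fst fun x => inner ℂ (φ x) (freeSemigroup d r ψ x)]
    simp
  have hint' : Integrable (fun p => ∫ s in Ioc 0 r,
      inner ℂ (φ p.1) (G s p * ψ (wienerPath ht r p))) μ := hint.integral_prod_right
  rw [feynmanKacForm]
  simp only [hexp]
  rw [integral_sub hφψ hint', hfree, ← integral_integral_swap hint,
    intervalIntegral.integral_of_le hr.1, sub_eq_add_neg, ← integral_neg]
  congr 1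
  refine setIntegral_congr_fun measurableSet_Ioc fun s hs => ?_
  simp only [hmarkov s hs, neg_neg]

/-- The weak Feynman–Kac formula. Both sides satisfy the same Volterra equation in time, for all
vectors `ψ` simultaneously, so the difference is smaller than every term of an exponential
series. -/
theorem IsWienerMeasure.feynmanKacForm_eq {m : Measure (WienerSpace d t)}
    (hm : IsWienerMeasure m) (hU : Measurable U) (hU1 : ∀ x, |U x| ≤ 1) (ht : 0 ≤ t)
    {A : L2Space d →L[ℂ] L2Space d} (hA : ∀ ψ, A ψ =ᵐ[volume] fun x => -((U x : ℂ) * ψ x))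
    {r : ℝ} (hr : r ∈ Icc 0 t) (φ ψ : L2Space d) :
    feynmanKacForm U m ht r φ ψ = inner ℂ φ (dyson (freeSemigroup d) A r ψ) := by
  have := hm.isProbabilityMeasure
  have hP := isHalfPlaneSemigroup_freeSemigroup d
  set D : ℝ → L2Space d → ℂ := fun r ψ =>
    feynmanKacForm U m ht r φ ψ - inner ℂ φ (dyson (freeSemigroup d) A r ψ) with hD
  have hvolterra : ∀ r ∈ Icc 0 t, ∀ ψ,
      D r ψ = ∫ s in (0 : ℝ)..r, D s (A (freeSemigroup d (r - s : ℝ) ψ)) := by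
    intro r hr ψ
    obtain ⟨h1, h2⟩ := hm.feynmanKacForm_duhamel hU hU1 ht hA hr φ ψ
    have h3 := hP.dyson_duhamel_right A (ω := 1) (by simp) hr.1 ψ
    simp only [mul_one, one_smul] at h3
    have hc : Continuous fun s : ℝ =>
        dyson (freeSemigroup d) A s (A (freeSemigroup d (r - s : ℝ) ψ)) :=
      hP.continuous_dyson_apply A (by fun_prop)
        (A.continuous.comp (hP.continuous_apply (by fun_prop) continuous_const))
    have h4 : inner ℂ φ (dyson (freeSemigroup d) A r ψ) = inner ℂ φ (freeSemigroup d r ψ) +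
        ∫ s in (0 : ℝ)..r,
          inner ℂ φ (dyson (freeSemigroup d) A s (A (freeSemigroup d (r - s : ℝ) ψ))) := by
      rw [h3, inner_add_right]
      congr 1
      exact ((innerSL ℂ φ).intervalIntegral_comp_comm (hc.intervalIntegrable 0 r)).symm
    simp only [hD]
    rw [h2, h4, intervalIntegral.integral_sub h1
      ((continuous_const.inner hc).intervalIntegrable 0 r)]
    ring
  set C : ℝ := Real.exp t * ‖φ‖ + ‖φ‖ * Real.exp (t * ‖A‖) with hC
  have hC0 : 0 ≤ C := by positivity
  have hbound : ∀ n : ℕ, ∀ r ∈ Icc 0 t, ∀ ψ,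
      ‖D r ψ‖ ≤ C * ((‖A‖ * r) ^ n / n.factorial) * ‖ψ‖ := by
    intro n
    induction n with
    | zero =>
      intro r hr ψ
      have h1 := norm_feynmanKacForm_le (m := m) hU hU1 ht hr φ ψ
      have h2 : ‖inner ℂ φ (dyson (freeSemigroup d) A r ψ)‖ ≤
          ‖φ‖ * (Real.exp (t * ‖A‖) * ‖ψ‖) := by
        refine (norm_inner_le_norm _ _).trans ?_
        gcongr
        refine (ContinuousLinearMap.le_of_opNorm_le _ (hP.norm_dyson_le A r) ψ).trans ?_
        rw [Complex.norm_real, Real.norm_of_nonneg hr.1]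
        have := hr.2
        gcongr
      calc ‖D r ψ‖ ≤ Real.exp t * ‖φ‖ * ‖ψ‖ + ‖φ‖ * (Real.exp (t * ‖A‖) * ‖ψ‖) :=
            (norm_sub_le _ _).trans (add_le_add h1 h2)
        _ = C * ((‖A‖ * r) ^ 0 / (Nat.factorial 0 : ℕ)) * ‖ψ‖ := by
            rw [hC]
            simp only [pow_zero, Nat.factorial_zero, Nat.cast_one, div_one]
            ring
    | succ n ih =>
      intro r hr ψ
      rw [hvolterra r hr ψ]
      refine (intervalIntegral.norm_integral_le_of_norm_le hr.1
        (g := fun s => C * ‖A‖ ^ (n + 1) / n.factorial * ‖ψ‖ * s ^ n)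
        (ae_of_all _ fun s hs => ?_) (Continuous.intervalIntegrable (by fun_prop) _ _)).trans ?_
      · refine (ih s ⟨hs.1.le, hs.2.trans hr.2⟩ _).trans ?_
        have h1 : ‖A (freeSemigroup d (r - s : ℝ) ψ)‖ ≤ ‖A‖ * ‖ψ‖ :=
          (A.le_opNorm _).trans (by gcongr; exact hP.norm_apply_le _ _)
        have h2 : 0 ≤ s := hs.1.le
        calc C * ((‖A‖ * s) ^ n / n.factorial) * ‖A (freeSemigroup d (r - s : ℝ) ψ)‖
            ≤ C * ((‖A‖ * s) ^ n / n.factorial) * (‖A‖ * ‖ψ‖) := by gcongr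
          _ = C * ‖A‖ ^ (n + 1) / n.factorial * ‖ψ‖ * s ^ n := by ring
      · rw [intervalIntegral.integral_const_mul, integral_pow, Nat.factorial_succ]
        apply le_of_eq
        push_cast
        have h1 : (n.factorial : ℝ) ≠ 0 := by positivity
        have h2 : (n : ℝ) + 1 ≠ 0 := by positivity
        field_simp
        ring
  have hlim : Tendsto (fun n : ℕ => C * ((‖A‖ * r) ^ n / n.factorial) * ‖ψ‖) atTop (𝓝 0) := by
    have h := ((FloorSemiring.tendsto_pow_div_factorial_atTop (‖A‖ * r)).const_mul C).mul_const ‖ψ‖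
    simpa using h
  have h0 : ‖D r ψ‖ ≤ 0 := ge_of_tendsto' hlim fun n => hbound n r hr ψ
  exact sub_eq_zero.1 (norm_le_zero_iff.1 h0)

/-- The Feynman–Kac formula for a bounded Borel potential, pointwise almost everywhere. -/
theorem IsWienerMeasure.feynmanKac {m : Measure (WienerSpace d t)}
    (hm : IsWienerMeasure m) (hU : Measurable U) (hU1 : ∀ x, |U x| ≤ 1) (ht : 0 ≤ t)
    {A : L2Space d →L[ℂ] L2Space d} (hA : ∀ ψ, A ψ =ᵐ[volume] fun x => -((U x : ℂ) * ψ x))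
    (ψ : L2Space d) : ∀ᵐ x, Integrable
      (fun y => (feynmanKacWeight U ht t (x, y) : ℂ) * ψ (wienerPath ht t (x, y))) m ∧
      dyson (freeSemigroup d) A t ψ x =
        ∫ y, (feynmanKacWeight U ht t (x, y) : ℂ) * ψ (wienerPath ht t (x, y)) ∂m := by
  have := hm.isProbabilityMeasure
  have htt : t ∈ Icc 0 t := ⟨ht, le_rfl⟩
  exact ae_eq_integral_of_forall_inner_eq (memLp_mul_comp_wienerPath ht t ψ
    (measurable_ofReal_feynmanKacWeight hU ht t) (norm_feynmanKacWeight_le hU1 ht htt))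
    fun φ => hm.feynmanKacForm_eq hU hU1 ht hA htt φ ψ

end FeynmanKac

/-! ### Passage to essentially bounded potentials -/

section Potential

variable {d : ℕ} {V : EuclideanSpace ℝ (Fin d) → ℝ}

/-- A potential of essential supremum less than one agrees almost everywhere with a Borel function
bounded by one everywhere. -/
theorem exists_measurable_abs_le_one (hV : MemLp V ∞ volume) (hV1 : eLpNorm V ∞ volume < 1) :
    ∃ U : EuclideanSpace ℝ (Fin d) → ℝ, Measurable U ∧ (∀ x, |U x| ≤ 1) ∧ V =ᵐ[volume] U := by
  refine ⟨fun x => max (-1) (min 1 (hV.1.mk V x)),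
    measurable_const.max (measurable_const.min hV.1.stronglyMeasurable_mk.measurable),
    fun x => abs_le.2 ⟨le_max_left _ _, max_le (by norm_num) (min_le_left _ _)⟩, ?_⟩
  have h : ∀ᵐ x, ‖V x‖ₑ < 1 := by
    rw [eLpNorm_exponent_top] at hV1
    exact ae_lt_of_essSup_lt hV1
  filter_upwards [hV.1.ae_eq_mk, h] with x h1 h2
  have h3 : |V x| ≤ 1 := by
    rw [← ofReal_norm, ENNReal.ofReal_lt_one] at h2
    exact h2.le
  rw [← h1, min_eq_right (abs_le.1 h3).2, max_eq_right (abs_le.1 h3).1]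

theorem neg_mulOp_apply_ae_eq (hV : MemLp V ∞ volume) {U : EuclideanSpace ℝ (Fin d) → ℝ}
    (hVU : V =ᵐ[volume] U) (ψ : L2Space d) :
    (-mulOp hV) ψ =ᵐ[volume] fun x => -((U x : ℂ) * ψ x) := by
  rw [neg_apply]
  filter_upwards [Lp.coeFn_neg (mulOp hV ψ), coeFn_mulOp hV ψ, hVU] with x h1 h2 h3
  rw [h1, Pi.neg_apply, h2, h3]

/-- Almost every translated Wiener path spends no time in a Lebesgue null set. -/
theorem ae_ae_ae_comp_wienerPath_eq {t : ℝ} {m : Measure (WienerSpace d t)} [IsProbabilityMeasure m]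
    (ht : 0 ≤ t) {U : EuclideanSpace ℝ (Fin d) → ℝ} (hVU : V =ᵐ[volume] U) :
    ∀ᵐ x, ∀ᵐ y ∂m, (∀ᵐ s : ℝ, V (wienerPath ht s (x, y)) = U (wienerPath ht s (x, y))) := by
  set N : Set (EuclideanSpace ℝ (Fin d)) := toMeasurable volume {x | ¬ V x = U x} with hN
  have hN0 : volume N = 0 := by
    rw [hN, measure_toMeasurable]
    exact hVU
  have hmeas : MeasurableSet
      {q : ℝ × EuclideanSpace ℝ (Fin d) × WienerSpace d t | wienerPath ht q.1 q.2 ∉ N} :=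
    (continuous_wienerPath ht).measurable (measurableSet_toMeasurable _ _).compl
  have h1 : ∀ᵐ s : ℝ, ∀ᵐ p ∂((volume : Measure (EuclideanSpace ℝ (Fin d))).prod m),
      wienerPath ht s p ∉ N := ae_of_all _ fun s =>
    (measurePreserving_wienerPath ht s).quasiMeasurePreserving.ae
      (measure_eq_zero_iff_ae_notMem.1 hN0)
  rw [Measure.ae_ae_comm hmeas] at h1
  filter_upwards [Measure.ae_ae_of_ae_prod h1] with x hx
  filter_upwards [hx] with y hy
  filter_upwards [hy] with s hs
  by_contra hne
  exact hs (subset_toMeasurable _ _ hne)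

/-- Changing the potential on a null set does not change the weight of a path that spends no time
in it. -/
theorem exp_neg_integral_pathAt_pathShift {t : ℝ} (ht : 0 ≤ t) {U : EuclideanSpace ℝ (Fin d) → ℝ}
    {x : EuclideanSpace ℝ (Fin d)} {y : WienerSpace d t}
    (h : ∀ᵐ s : ℝ, V (wienerPath ht s (x, y)) = U (wienerPath ht s (x, y))) {s : ℝ}
    (hs : s ∈ Icc 0 t) :
    Real.exp (-∫ u in (0 : ℝ)..s, V (pathAt (pathShift y x) u)) =
      feynmanKacWeight U ht s (x, y) := by
  rw [feynmanKacWeight]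
  congr 2
  refine intervalIntegral.integral_congr_ae ?_
  filter_upwards [h] with u hu hus
  rw [uIoc_of_le hs.1] at hus
  rw [pathAt_pathShift ht ⟨hus.1.le, hus.2.trans hs.2⟩, hu]

theorem IsWienerMeasure.isFunctionSpaceIntegral_dyson {t : ℝ} {m : Measure (WienerSpace d t)}
    (hm : IsWienerMeasure m) (ht : 0 ≤ t) (hV : MemLp V ∞ volume) (hV1 : eLpNorm V ∞ volume < 1) :
    IsFunctionSpaceIntegral m (potentialFunctional V t)
      (dyson (freeSemigroup d) (-mulOp hV) t) := by
  have := hm.isProbabilityMeasure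
  obtain ⟨U, hU, hU1, hVU⟩ := exists_measurable_abs_le_one hV hV1
  intro ψ
  have htt : t ∈ Icc 0 t := ⟨ht, le_rfl⟩
  filter_upwards [hm.feynmanKac hU hU1 ht (neg_mulOp_apply_ae_eq hV hVU) ψ,
    ae_ae_ae_comp_wienerPath_eq (m := m) ht hVU] with x h1 h2
  have h3 : (fun y => (feynmanKacWeight U ht t (x, y) : ℂ) * ψ (wienerPath ht t (x, y))) =ᵐ[m]
      fun y => potentialFunctional V t (pathShift y x) * ψ (pathAt (pathShift y x) t) := by
    filter_upwards [h2] with y hy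
    rw [potentialFunctional, exp_neg_integral_pathAt_pathShift ht hy htt, pathAt_pathShift ht htt]
  exact ⟨h1.1.congr h3, h1.2.trans (integral_congr_ae h3)⟩

/-- The Wiener integral of `ψ(x + y(t))` is the free heat semigroup. -/
theorem IsWienerMeasure.ae_integral_comp_wienerPath {t : ℝ} {m : Measure (WienerSpace d t)}
    (hm : IsWienerMeasure m) (ht : 0 ≤ t) (ψ : L2Space d) :
    ∀ᵐ x, Integrable (fun y => ψ (wienerPath ht t (x, y))) m ∧
      freeSemigroup d t ψ x = ∫ y, ψ (wienerPath ht t (x, y)) ∂m := by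
  have h := hm.feynmanKac (U := fun _ => 0) measurable_const (by simp) ht (A := 0) (fun φ => by
    filter_upwards [Lp.coeFn_zero ℂ 2 (volume : Measure (EuclideanSpace ℝ (Fin d)))] with x hx
    rw [zero_apply, hx]
    simp) ψ
  have e : dyson (freeSemigroup d) 0 t ψ = freeSemigroup d t ψ := by
    rw [(isHalfPlaneSemigroup_freeSemigroup d).dyson_duhamel]
    simp
  rw [e] at h
  simpa [feynmanKacWeight] using h

/-- The Wiener integral representation of the perturbed heat semigroup, with the free part split
off by the fundamental theorem of calculus along each path. -/
theorem IsWienerMeasure.ae_dyson_eq_sub_integral {t : ℝ} {m : Measure (WienerSpace d t)}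
    (hm : IsWienerMeasure m) (ht : 0 ≤ t) (hV : MemLp V ∞ volume) (hV1 : eLpNorm V ∞ volume < 1)
    (ψ : L2Space d) : ∀ᵐ x : EuclideanSpace ℝ (Fin d),
      Integrable (fun y => ∫ s in (0 : ℝ)..t,
        ((Real.exp (-∫ u in (0 : ℝ)..s, V (pathAt (pathShift y x) u)) *
          V (pathAt (pathShift y x) s) : ℝ) : ℂ) * ψ (pathAt (pathShift y x) t)) m ∧
      dyson (freeSemigroup d) (-mulOp hV) t ψ x = freeSemigroup d t ψ x -
        ∫ y, (∫ s in (0 : ℝ)..t,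
          ((Real.exp (-∫ u in (0 : ℝ)..s, V (pathAt (pathShift y x) u)) *
            V (pathAt (pathShift y x) s) : ℝ) : ℂ) * ψ (pathAt (pathShift y x) t)) ∂m := by
  have := hm.isProbabilityMeasure
  obtain ⟨U, hU, hU1, hVU⟩ := exists_measurable_abs_le_one hV hV1
  have htt : t ∈ Icc 0 t := ⟨ht, le_rfl⟩
  filter_upwards [hm.feynmanKac hU hU1 ht (neg_mulOp_apply_ae_eq hV hVU) ψ,
    ae_ae_ae_comp_wienerPath_eq (m := m) ht hVU, hm.ae_integral_comp_wienerPath ht ψ]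
    with x h1 h2 h3
  have h4 : (fun y => ψ (wienerPath ht t (x, y)) -
      (feynmanKacWeight U ht t (x, y) : ℂ) * ψ (wienerPath ht t (x, y))) =ᵐ[m]
      fun y => ∫ s in (0 : ℝ)..t,
        ((Real.exp (-∫ u in (0 : ℝ)..s, V (pathAt (pathShift y x) u)) *
          V (pathAt (pathShift y x) s) : ℝ) : ℂ) * ψ (pathAt (pathShift y x) t) := by
    filter_upwards [h2] with y hy
    have h5 : ∫ s in (0 : ℝ)..t, ((Real.exp (-∫ u in (0 : ℝ)..s, V (pathAt (pathShift y x) u)) *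
          V (pathAt (pathShift y x) s) : ℝ) : ℂ) * ψ (pathAt (pathShift y x) t) =
        ∫ s in (0 : ℝ)..t, ((feynmanKacWeight U ht s (x, y) * U (wienerPath ht s (x, y)) : ℝ) : ℂ) *
          ψ (wienerPath ht t (x, y)) := by
      refine intervalIntegral.integral_congr_ae ?_
      filter_upwards [hy] with s hs hst
      rw [uIoc_of_le ht] at hst
      have hst' : s ∈ Icc 0 t := ⟨hst.1.le, hst.2⟩
      rw [exp_neg_integral_pathAt_pathShift ht hy hst', pathAt_pathShift ht hst',
        pathAt_pathShift ht htt, hs]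
    rw [h5, intervalIntegral.integral_mul_const, intervalIntegral.integral_ofReal,
      feynmanKacWeight_eq_one_sub hU hU1 ht ht]
    push_cast
    ring
  refine ⟨(h3.1.sub h1.1).congr h4, ?_⟩
  rw [← integral_congr_ae h4, integral_sub h3.1 h1.1, ← h1.2, ← h3.2]
  ring

/-- The perturbed semigroup on the closed half-plane is an analytic-in-time Feynman integral. -/
theorem isAnalyticInTimeIntegral_dyson {m : (t : ℝ) → Measure (WienerSpace d t)}
    (hm : ∀ t, 0 < t → IsWienerMeasure (m t)) (hV : MemLp V ∞ volume)
    (hV1 : eLpNorm V ∞ volume < 1) : IsAnalyticInTimeIntegral m (potentialFunctional V)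
      (dyson (freeSemigroup d) (-mulOp hV)) where
  eq_integral t ht := (hm t ht).isFunctionSpaceIntegral_dyson ht.le hV hV1
  analytic := (isHalfPlaneSemigroup_freeSemigroup d).differentiableOn_dyson
    (differentiableOn_freeSemigroup d) _
  strong_cont _ := ((isHalfPlaneSemigroup_freeSemigroup d).continuous_dyson_apply _ continuous_id
    continuous_const).continuousOn

/-- The analytic-in-time Feynman integral is unique on the closed half-plane, by the identity
theorem on the open half-plane and strong continuity up to its boundary. -/
theorem IsAnalyticInTimeIntegral.eqOn {m : (t : ℝ) → Measure (WienerSpace d t)}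
    {F : (t : ℝ) → PathSpace d t → ℂ} {J J' : ℂ → L2Space d →L[ℂ] L2Space d}
    (hJ : IsAnalyticInTimeIntegral m F J) (hJ' : IsAnalyticInTimeIntegral m F J') :
    EqOn J J' {z | 0 ≤ z.re} := by
  have hpos : ∀ t : ℝ, 0 < t → J t = J' t := by
    intro t ht
    refine ContinuousLinearMap.ext fun ψ => Lp.ext ?_
    filter_upwards [hJ.eq_integral t ht ψ, hJ'.eq_integral t ht ψ] with x h1 h2
    rw [h1.2, h2.2]
  have hopen : EqOn J J' {z | 0 < z.re} := by
    refine (hJ.analytic.analyticOnNhd isOpen_re_pos).eqOn_of_preconnected_of_frequently_eq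
      (hJ'.analytic.analyticOnNhd isOpen_re_pos) (convex_halfSpace_re_gt 0).isPreconnected
      (z₀ := 1) (by simp) ?_
    have h1 : Tendsto (fun s : ℝ => (s : ℂ)) (𝓝[>] 1) (𝓝[≠] 1) := by
      refine tendsto_nhdsWithin_iff.2 ⟨?_, ?_⟩
      · exact (Complex.continuous_ofReal.tendsto' 1 1 (by simp)).mono_left nhdsWithin_le_nhds
      · filter_upwards [self_mem_nhdsWithin] with s hs
        simpa using (ne_of_gt hs : s ≠ 1)
    refine h1.frequently (Eventually.frequently ?_)
    filter_upwards [self_mem_nhdsWithin] with s hs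
    exact hpos s (zero_lt_one.trans hs)
  intro z hz
  refine ContinuousLinearMap.ext fun ψ => ?_
  have h1 : Tendsto (fun s : ℝ => z + s) (𝓝[>] 0) (𝓝[{z | 0 ≤ z.re}] z) := by
    refine tendsto_nhdsWithin_iff.2 ⟨?_, ?_⟩
    · have hc : Continuous fun s : ℝ => z + s := by fun_prop
      exact (hc.tendsto' 0 z (by simp)).mono_left nhdsWithin_le_nhds
    · filter_upwards [self_mem_nhdsWithin] with s hs
      have hz' : 0 ≤ z.re := hz
      have hs' : 0 < s := hs
      simp only [Complex.add_re, Complex.ofReal_re]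
      linarith
  have h2 := (hJ.strong_cont ψ z hz).tendsto.comp h1
  have h3 := (hJ'.strong_cont ψ z hz).tendsto.comp h1
  refine tendsto_nhds_unique (h2.congr' ?_) h3
  filter_upwards [self_mem_nhdsWithin] with s hs
  have hz' : 0 ≤ z.re := hz
  have hs' : 0 < s := hs
  simp only [Function.comp]
  rw [hopen (by
    simp only [mem_ofPred_eq, Complex.add_re, Complex.ofReal_re]
    linarith : z + s ∈ {z : ℂ | 0 < z.re})]

end Potential

end

theorem mainTheorem2 {d : ℕ} (V : EuclideanSpace ℝ (Fin d) → ℝ) (hV : MemLp V ∞ volume)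
    (hV1 : eLpNorm V ∞ volume < 1) :
    -- the semigroups and groups in question exist
    IsC0SemigroupOf (c0Semigroup (-freeHamiltonian d)) (-freeHamiltonian d) ∧
    IsC0SemigroupOf (c0Semigroup (-hamiltonian hV)) (-hamiltonian hV) ∧
    IsC0SemigroupOf (c0Semigroup ((-Complex.I) • freeHamiltonian d))
      ((-Complex.I) • freeHamiltonian d) ∧
    IsC0GroupOf (c0Group ((-Complex.I) • hamiltonian hV)) ((-Complex.I) • hamiltonian hV) ∧
    (∀ t : ℝ, c0Group ((-Complex.I) • hamiltonian hV) t ∈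
      unitary (L2Space d →L[ℂ] L2Space d)) ∧
    -- the reduced disentanglings are the heat semigroup and the Schrödinger group
    (∀ ρ : ℝ, 0 < ρ → ρ < 1 → ∀ t : ℝ, 0 ≤ t →
      (ReducedDisentanglingConverges ρ gFun t (-freeHamiltonian d) (fun _ => -mulOp hV) ∧
        ∀ ψ : L2Space d,
          reducedDisentangling ρ gFun t (-freeHamiltonian d) (fun _ => -mulOp hV) ψ =
            c0Semigroup (-hamiltonian hV) t ψ) ∧
      (ReducedDisentanglingConverges ρ gFun t ((-Complex.I) • freeHamiltonian d)
          (fun _ => (-Complex.I) • mulOp hV) ∧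
        ∀ ψ : L2Space d,
          reducedDisentangling ρ gFun t ((-Complex.I) • freeHamiltonian d)
              (fun _ => (-Complex.I) • mulOp hV) ψ =
            c0Group ((-Complex.I) • hamiltonian hV) t ψ)) ∧
    -- the representations through Wiener measure
    (∀ m : (t : ℝ) → Measure (WienerSpace d t), (∀ t, 0 < t → IsWienerMeasure (m t)) →
      (∀ ρ : ℝ, 0 < ρ → ρ < 1 → ∀ t : ℝ, 0 < t → ∀ ψ : L2Space d,
        ∀ᵐ x : EuclideanSpace ℝ (Fin d),
          Integrable (fun y => ∫ s in (0 : ℝ)..t,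
            ((Real.exp (-∫ u in (0 : ℝ)..s, V (pathAt (pathShift y x) u)) *
              V (pathAt (pathShift y x) s) : ℝ) : ℂ) * ψ (pathAt (pathShift y x) t)) (m t) ∧
          reducedDisentangling ρ gFun t (-freeHamiltonian d) (fun _ => -mulOp hV) ψ x =
            c0Semigroup (-freeHamiltonian d) t ψ x -
              ∫ y, (∫ s in (0 : ℝ)..t,
                ((Real.exp (-∫ u in (0 : ℝ)..s, V (pathAt (pathShift y x) u)) *
                  V (pathAt (pathShift y x) s) : ℝ) : ℂ) *
                    ψ (pathAt (pathShift y x) t)) ∂(m t)) ∧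
      (∃ J, IsAnalyticInTimeIntegral m (potentialFunctional V) J) ∧
      ∀ J, IsAnalyticInTimeIntegral m (potentialFunctional V) J →
        (∀ t : ℝ, 0 < t → J t = c0Semigroup (-hamiltonian hV) t) ∧
        ∀ t : ℝ, J (Complex.I * t) = c0Group ((-Complex.I) • hamiltonian hV) t) := by
  have hP := isHalfPlaneSemigroup_freeSemigroup d
  have hB1 : ∀ t : ℝ, 0 ≤ t → c0Semigroup (-freeHamiltonian d) t = freeSemigroup d (t * 1) :=
    fun t ht => c0Semigroup_neg_freeHamiltonian ht
  have hBI : ∀ t : ℝ, 0 ≤ t →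
      c0Semigroup ((-Complex.I) • freeHamiltonian d) t = freeSemigroup d (t * Complex.I) :=
    fun t ht => c0Semigroup_neg_I_smul_freeHamiltonian ht
  have eA1 : (fun _ : ℝ => -mulOp hV) = fun _ => (1 : ℂ) • (-mulOp hV) := by
    simp only [one_smul]
  have eAI : (fun _ : ℝ => (-Complex.I) • mulOp hV) = fun _ => Complex.I • (-mulOp hV) := by
    simp only [neg_smul, smul_neg]
  refine ⟨isC0SemigroupOf_neg_freeHamiltonian.c0Semigroup,
    (isC0SemigroupOf_neg_hamiltonian hV).c0Semigroup,
    isC0SemigroupOf_neg_I_smul_freeHamiltonian.c0Semigroup,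
    (isC0GroupOf_neg_I_smul_hamiltonian hV).c0Group, c0Group_mem_unitary hV,
    fun ρ hρ0 hρ1 t ht => ⟨⟨?_, fun ψ => ?_⟩, ?_, fun ψ => ?_⟩, fun m hm =>
    ⟨fun ρ hρ0 hρ1 t ht ψ => ?_, ⟨_, isAnalyticInTimeIntegral_dyson hm hV hV1⟩, fun J hJ =>
    ⟨fun t ht => ?_, fun t => ?_⟩⟩⟩
  · rw [eA1]
    exact hP.reducedDisentanglingConverges hB1 _ hρ0 hρ1 ht
  · rw [eA1, hP.reducedDisentangling_eq hB1 _ hρ0 hρ1 ht, c0Semigroup_neg_hamiltonian hV ht]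
  · rw [eAI]
    exact hP.reducedDisentanglingConverges hBI _ hρ0 hρ1 ht
  · rw [eAI, hP.reducedDisentangling_eq hBI _ hρ0 hρ1 ht, c0Group_neg_I_smul_hamiltonian]
  · rw [eA1, hP.reducedDisentangling_eq hB1 _ hρ0 hρ1 ht.le, hB1 t ht.le, mul_one]
    exact (hm t ht).ae_dyson_eq_sub_integral ht.le hV hV1 ψ
  · rw [hJ.eqOn (isAnalyticInTimeIntegral_dyson hm hV hV1)
      (by simpa using ht.le : (t : ℂ) ∈ {z : ℂ | 0 ≤ z.re}), c0Semigroup_neg_hamiltonian hV ht.le,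
      mul_one]
  · rw [hJ.eqOn (isAnalyticInTimeIntegral_dyson hm hV hV1)
      (by simp : Complex.I * t ∈ {z : ℂ | 0 ≤ z.re}), c0Group_neg_I_smul_hamiltonian, mul_comm]
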